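/- **Setting.** Consider a first-come first-served single-server queue with infinite waiting room. Packets $n=0,1,2,\dots$ arrive at times $\alpha_n$ and depart at times $\beta_n$, where $\alpha_{n+1}=\alpha_n+G_{n+1}$ and $\beta_{n+1}=\max(\alpha_{n+1},\beta_n)+H_{n+1}$; the interarrival times $G_1,G_2,\dots$ are i.i.d. copies of a random variable $G\ge 0$, the service times $H_1,H_2,\dots$ are i.i.d. copies of a random variable $H\ge 0$, the two sequences are independent, and the initial pair $\alpha_0\le\beta_0$ is arbitrary. Assume that $\mathrm E[G]$ and $\mathrm E[H]$ are positive and finite, put $\lambda=1/\mathrm E[G]$ and $\rho=\lambda\mathrm E[H]$, and assume $\rho<1$. The system delay of packet $n$ is $D_n=\beta_n-\alpha_n$. The age of information (AoI) at time $t\ge\beta_0$ is $A_t=t-\alpha_{M_t}$, where $M_t=\sup\{n:\beta_n\le t\}$; before $\beta_0$ it is an arbitrary measurable process. The stationary delay $D\geq 0$ and the stationary AoI $A\geq 0$ are random variables whose distributions are given by the asymptotic frequencies: with probability one, for all $x$, $$\Pr(D\le x)=\lim_{N\to\infty}\frac1N\sum_{n=1}^N\mathbf 1_{\{D_n\le x\}},\qquad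 \Pr(A\le x)=\lim_{T\to\infty}\frac1T\int_0^T\mathbf 1_{\{A_t\le x\}}\,dt .$$ For a random variable $Y\ge0$ write $y^*(s)=\mathrm E[e^{-sY}]$ for its Laplace–Stieltjes transform, $y^{(n)}$ for the $n$th derivative of $y^*$, and $\tilde y^*(s)=(1-y^*(s))/(s\,\mathrm E[Y])$. **Theorem.** In each of the two cases below the limits defining $D$ and $A$ exist with probability one and are the distribution functions of probability laws on $[0,\infty)$; if the $D_n$ ($n\ge0$) are identically distributed, then each $D_n$ has the law of $D$, and if the $A_t$ ($t\ge0$) are identically distributed, then each $A_t$ has the law of $A$. Moreover: (i) In the FCFS M/GI/1 queue ($G$ exponential with rate $\lambda$), for all $s>0$, $$d^*(s)=\frac{(1-\rho)s}{s-\lambda+\lambda h^*(s)}\,h^*(s),$$ $$a^*(s)=\rho\, d^*(s)\tilde h^*(s)+d^*(s+\lambda)\,\frac{\lambda}{s+\lambda}\,h^*(s)=d^*(s)-\frac{(1-\rho)s}{s+\lambda h^*(s+\lambda)}\,h^*(s).$$ If $\mathrm E[H^2]<\infty$, then $\mathrm E[A]$ is finite and $$\mathrm E[A]=\frac{\lambda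 \mathrm E[H^2]}{2(1-\rho)}+\mathrm E[H]+\frac{1-\rho}{\rho h^*(\lambda)}\,\mathrm E[H].$$ If $\mathrm E[H^3]<\infty$, then $\mathrm E[A^2]$ is finite and $$\mathrm E[A^2]=\frac{2(1-\rho)\bigl[1+\rho h^*(\lambda)-\lambda(-h^{(1)}(\lambda))\bigr](\mathrm E[H])^2}{(\rho h^*(\lambda))^2}+\frac{\lambda\mathrm E[H^3]}{3(1-\rho)}+\frac{(\lambda\mathrm E[H^2])^2}{2(1-\rho)^2}+\frac{\mathrm E[H^2]}{1-\rho}.$$ (ii) In the FCFS GI/M/1 queue ($H$ exponential with rate $\mu>0$), the equation $x=g^*(\mu-\mu x)$ has a unique solution $x=\gamma$ with $0<x<1$, and for all $s>0$, $$d^*(s)=\frac{\mu-\mu\gamma}{s+\mu-\mu\gamma},\qquad a^*(s)=\bigl[\rho\, d^*(s)+\tilde g^*(s)-\tilde g^*(s+\mu-\mu\gamma)\bigr]\frac{\mu}{s+\mu}.$$ If $\mathrm E[G^2]<\infty$, then $\mathrm E[A]$ is finite and $$\mathrm E[A]=\frac{\mathrm E[G^2]}{2\mathrm E[G]}+\mathrm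 E[H]+\frac{\rho}{1-\gamma}\bigl(-g^{(1)}(\mu-\mu\gamma)\bigr).$$ If $\mathrm E[G^3]<\infty$, then $\mathrm E[A^2]$ is finite and $$\mathrm E[A^2]=\frac{\mathrm E[G^3]}{3\mathrm E[G]}+\rho\,\mathrm E[G^2]+2(\mathrm E[H])^2+\frac{\rho}{1-\gamma}\Bigl[g^{(2)}(\mu-\mu\gamma)+2\Bigl(1+\frac1{1-\gamma}\Bigr)\bigl(-g^{(1)}(\mu-\mu\gamma)\bigr)\mathrm E[H]\Bigr].$$ -/

import Mathlib

open MeasureTheory ProbabilityTheory Filter Topology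

noncomputable section

/-- The Laplace-Stieltjes transform `y*(s) = E[exp (-s Y)]` of the law `ν` of a random variable. -/
def lst (ν : Measure ℝ) (s : ℝ) : ℝ := ∫ x, Real.exp (-(s * x)) ∂ν

/-- The Laplace-Stieltjes transform `(1 - y*(s)) / (s E[Y])` of the residual time of `ν`. -/
def residualLST (ν : Measure ℝ) (s : ℝ) : ℝ := (1 - lst ν s) / (s * ∫ x, x ∂ν)

/-- The data of a first-come first-served single-server queue with i.i.d. interarrival times
(law `νG`) and i.i.d. service times (law `νH`) on a probability space `(Ω, P)`.
Packets are numbered `0, 1, 2, …`, and `interarrival n`, `service n` are the interarrival time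
between the packets `n` and `n + 1` and the service time of the packet `n + 1`.
The initial condition is arbitrary: the packet `0` arrives at the random time `arrival₀`
and departs at the random time `departure₀`, and `initialAge` is the age of the
displayed information before `departure₀`. -/
structure FCFSQueue {Ω : Type*} [MeasurableSpace Ω] (P : Measure Ω) (νG νH : Measure ℝ) where
  /-- arrival time of the packet `0` -/
  arrival₀ : Ω → ℝ
  /-- departure time of the packet `0` -/
  departure₀ : Ω → ℝ
  /-- age of information before the departure of the packet `0` -/
  initialAge : ℝ → Ω → ℝ
  /-- interarrival times -/
  interarrival : ℕ → Ω → ℝ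
  /-- service times -/
  service : ℕ → Ω → ℝ
  measurable_arrival₀ : Measurable arrival₀
  measurable_departure₀ : Measurable departure₀
  measurable_initialAge : Measurable (Function.uncurry initialAge)
  measurable_interarrival : ∀ n, Measurable (interarrival n)
  measurable_service : ∀ n, Measurable (service n)
  arrival₀_le_departure₀ : ∀ᵐ ω ∂P, arrival₀ ω ≤ departure₀ ω
  interarrival_nonneg : ∀ n, ∀ᵐ ω ∂P, 0 ≤ interarrival n ω
  service_nonneg : ∀ n, ∀ᵐ ω ∂P, 0 ≤ service n ω
  hasLaw_interarrival : ∀ n, HasLaw (interarrival n) νG P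
  hasLaw_service : ∀ n, HasLaw (service n) νH P
  indep : iIndepFun (Sum.elim interarrival service) P

namespace FCFSQueue

variable {Ω : Type*} [MeasurableSpace Ω] {P : Measure Ω} {νG νH : Measure ℝ}

/-- `α_n`, the arrival time (and time-stamp) of the packet `n`. -/
def arrival (Q : FCFSQueue P νG νH) : ℕ → Ω → ℝ
  | 0, ω => Q.arrival₀ ω
  | n + 1, ω => Q.arrival n ω + Q.interarrival n ω

/-- `β_n`, the departure time of the packet `n`: its service starts as soon as it has arrived
and its predecessor has departed. -/
def departure (Q : FCFSQueue P νG νH) : ℕ → Ω → ℝ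
  | 0, ω => Q.departure₀ ω
  | n + 1, ω => max (Q.arrival (n + 1) ω) (Q.departure n ω) + Q.service n ω

/-- `D_n = β_n - α_n`, the system delay of the packet `n`. -/
def delay (Q : FCFSQueue P νG νH) (n : ℕ) (ω : Ω) : ℝ := Q.departure n ω - Q.arrival n ω

/-- `M_t = sup {n ; β_n ≤ t}`, the number of the last packet that has departed by time `t`. -/
def lastDeparted (Q : FCFSQueue P νG νH) (t : ℝ) (ω : Ω) : ℕ :=
  sSup {n : ℕ | Q.departure n ω ≤ t}

/-- `A_t`, the age of information at time `t`: the time elapsed since the time-stamp of the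
last packet that has departed by time `t`. -/
def aoi (Q : FCFSQueue P νG νH) (t : ℝ) (ω : Ω) : ℝ :=
  open Classical in
  if Q.departure 0 ω ≤ t then t - Q.arrival (Q.lastDeparted t ω) ω else Q.initialAge t ω

/-- `ν` is the law of the stationary system delay `D`: with probability one it is the asymptotic
frequency distribution of `D_1, D_2, …`, and it is the law of every `D_n` whenever the delays
are identically distributed. -/
structure IsDelayLaw (Q : FCFSQueue P νG νH) (ν : Measure ℝ) : Prop where
  isProbabilityMeasure : IsProbabilityMeasure ν
  nonneg : ∀ᵐ x ∂ν, 0 ≤ x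
  frequency : ∀ᵐ ω ∂P, ∀ x : ℝ,
    Tendsto (fun N : ℕ => (1 / (N : ℝ)) *
        ∑ n ∈ Finset.Icc 1 N, Set.indicator {m : ℕ | Q.delay m ω ≤ x} (fun _ => (1 : ℝ)) n)
      atTop (𝓝 (ν.real (Set.Iic x)))
  stationary : (∀ n : ℕ, IdentDistrib (Q.delay n) (Q.delay 0) P P) →
    ∀ n : ℕ, HasLaw (Q.delay n) ν P

/-- `ν` is the law of the stationary age of information `A`: with probability one it is the
asymptotic frequency distribution of `(A_t)_{t ≥ 0}`, and it is the law of every `A_t`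
whenever these are identically distributed. -/
structure IsAoILaw (Q : FCFSQueue P νG νH) (ν : Measure ℝ) : Prop where
  isProbabilityMeasure : IsProbabilityMeasure ν
  nonneg : ∀ᵐ x ∂ν, 0 ≤ x
  frequency : ∀ᵐ ω ∂P, ∀ x : ℝ,
    Tendsto (fun T : ℝ => (1 / T) *
        ∫ t in (0 : ℝ)..T, Set.indicator {u : ℝ | Q.aoi u ω ≤ x} (fun _ => (1 : ℝ)) t)
      atTop (𝓝 (ν.real (Set.Iic x)))
  stationary : (∀ t : ℝ, 0 ≤ t → IdentDistrib (Q.aoi t) (Q.aoi 0) P P) →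
    ∀ t : ℝ, 0 ≤ t → HasLaw (Q.aoi t) ν P

end FCFSQueue

end

/-! The delays form a Markov chain D' = max(0, D - G) + H driven by i.i.d. pairs. Between two
departures the age grows at unit rate, from the delay D of the last delivered packet to the peak
max(D, G) + H. So everything is determined by a stationary law ν of the delay. The long-run
frequency of ages at most x is the mean time spent below x per departure interval, divided by E[G],
which is `aoiLaw`. Its transform is λ/s times the difference between the transforms of the delay and
of the peak age (`lst_aoiLaw`).

The ergodic theorem `IsIIDInput.tendsto_cesaro_lindley` is obtained by coupling. Two chains fed with
the same input merge, because the negative drift forces an idle period (`lindley_coalesce`). Hence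
the iterates T^k f of the transition operator converge pointwise to ∫ f dν
(`IsIIDInput.tendsto_iterate_lindleyOp`). Along a path, f and T^k f have asymptotically equal
averages, by a strong law for bounded orthogonal variables (`tendsto_average_of_orthogonal`). What
remains is tightness of the empirical laws.

Tightness comes from a balance of work. A step removes min(D, G) and adds H, so the averages of
θ(D_n), with θ(d) = E[(G - d)^+], are asymptotically at least m = E[G] - E[H]. If E[min(D, G)] =
E[H] under ν, then m is also the limit of T^k θ(0), the largest value of T^k θ on the half-line.
Since T^k θ vanishes at infinity, mass escaping to infinity would pull the averages below m
(`exists_cesaro_indicator_ge`). The balance would follow from stationarity if D had a finite mean.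
That is not assumed, so the balance is a separate condition (`IsBalancedDelay`), checked in each
case with transforms.

For Poisson arrivals a stationary law comes from Loynes' backward construction
(`IsIIDInput.exists_isStationaryDelay`). Stationarity gives an equation for d* with one unknown
constant d*(λ), and s → 0 shows that it equals 1 - ρ. For exponential service put k = μ - μγ. The
equation for γ becomes (1 - g*(k))/k = 1/μ, whose left side is strictly decreasing, and the
exponential law of rate k is verified to be stationary by uniqueness of transforms
(`ext_of_lst_eq`). The moments are limits at 0 of iterated difference quotients of the transforms,
and Fatou's lemma turns convergence of the quotients into finiteness of the moment
(`first_moment_of_tendsto`, `second_moment_of_tendsto`). -/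

/-! ### The Lindley recursion along a path -/

/-- The system delay of a packet, given the delay `d` of its predecessor and the pair `p` of its
interarrival time and its service time. -/
def lindleyStep (d : ℝ) (p : ℝ × ℝ) : ℝ := max 0 (d - p.1) + p.2

/-- The delays generated by the input `ξ` from the initial delay `d`. -/
def lindley (ξ : ℕ → ℝ × ℝ) (d : ℝ) : ℕ → ℝ
  | 0 => d
  | n + 1 => lindleyStep (lindley ξ d n) (ξ n)

lemma lindleyStep_mono (p : ℝ × ℝ) : Monotone fun d => lindleyStep d p := by
  intro a b hab
  simp only [lindleyStep]
  gcongr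

lemma lindleyStep_nonneg (d : ℝ) {p : ℝ × ℝ} (hp : 0 ≤ p.2) : 0 ≤ lindleyStep d p := by
  simp only [lindleyStep]
  positivity

lemma measurable_lindleyStep : Measurable fun q : ℝ × (ℝ × ℝ) => lindleyStep q.1 q.2 := by
  simp only [lindleyStep]
  fun_prop

lemma continuous_lindleyStep (p : ℝ × ℝ) : Continuous fun d => lindleyStep d p := by
  simp only [lindleyStep]
  fun_prop

lemma lindley_mono (ξ : ℕ → ℝ × ℝ) (n : ℕ) : Monotone fun d => lindley ξ d n := by
  induction n with
  | zero => exact monotone_id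
  | succ n ih => exact (lindleyStep_mono (ξ n)).comp ih

lemma lindley_nonneg {ξ : ℕ → ℝ × ℝ} (hξ : ∀ n, 0 ≤ (ξ n).2) {d : ℝ} (hd : 0 ≤ d) (n : ℕ) :
    0 ≤ lindley ξ d n := by
  cases n with
  | zero => exact hd
  | succ n => exact lindleyStep_nonneg _ (hξ n)

/-- The upper chain must meet an idle server, since otherwise it would follow the random walk to -∞.
By monotonicity the lower chain is idle at the same time, and both restart from the same service
time. -/
lemma lindley_coalesce_of_le {ξ : ℕ → ℝ × ℝ} (hξ : ∀ n, 0 ≤ (ξ n).2)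
    (hdrift : Tendsto (fun n => ∑ i ∈ Finset.range n, ((ξ i).2 - (ξ i).1)) atTop atBot)
    {x y : ℝ} (hxy : x ≤ y) : ∀ᶠ n in atTop, lindley ξ x n = lindley ξ y n := by
  obtain ⟨m, hm⟩ : ∃ m, lindley ξ y m - (ξ m).1 ≤ 0 := by
    by_contra! hbusy
    have hsum : ∀ n, lindley ξ y n = y + ∑ i ∈ Finset.range n, ((ξ i).2 - (ξ i).1) := by
      intro n
      induction n with
      | zero => simp [lindley]
      | succ n ih =>
        rw [Finset.sum_range_succ]
        simp only [lindley, lindleyStep]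
        rw [max_eq_right (hbusy n).le, ih]
        ring
    -- The index must be positive: the initial delay `y` may be negative, but the output of a step
    -- is not.
    obtain ⟨n, hn, hn1⟩ := ((hdrift.eventually_lt_atBot (-y)).and
      (eventually_ge_atTop 1)).exists
    have h0 : 0 ≤ lindley ξ y n := by
      obtain ⟨k, rfl⟩ : ∃ k, n = k + 1 := ⟨n - 1, by omega⟩
      exact lindleyStep_nonneg _ (hξ k)
    rw [hsum n] at h0
    linarith
  filter_upwards [eventually_ge_atTop (m + 1)] with n hn
  induction n, hn using Nat.le_induction with
  | base =>
    have h1 : lindley ξ x m - (ξ m).1 ≤ 0 := by linarith [lindley_mono ξ m hxy]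
    simp only [lindley, lindleyStep]
    rw [max_eq_left hm, max_eq_left h1]
  | succ n _ ih => simp only [lindley, ih]

lemma lindley_coalesce {ξ : ℕ → ℝ × ℝ} (hξ : ∀ n, 0 ≤ (ξ n).2)
    (hdrift : Tendsto (fun n => ∑ i ∈ Finset.range n, ((ξ i).2 - (ξ i).1)) atTop atBot)
    (x y : ℝ) : ∀ᶠ n in atTop, lindley ξ x n = lindley ξ y n := by
  rcases le_total x y with h | h
  · exact lindley_coalesce_of_le hξ hdrift h
  · exact (lindley_coalesce_of_le hξ hdrift h).mono fun _ => Eq.symm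

/-! ### Cesàro averages -/

lemma tendsto_average_congr {u v : ℕ → ℝ} {L : ℝ} (huv : u =ᶠ[atTop] v)
    (hu : Tendsto (fun N : ℕ => (∑ n ∈ Finset.range N, u n) / N) atTop (𝓝 L)) :
    Tendsto (fun N : ℕ => (∑ n ∈ Finset.range N, v n) / N) atTop (𝓝 L) := by
  have h0 : Tendsto (fun n => v n - u n) atTop (𝓝 0) := by
    refine tendsto_const_nhds.congr' ?_
    filter_upwards [huv] with n hn
    rw [hn, sub_self]
  have h := hu.add h0.cesaro
  rw [add_zero] at h
  refine h.congr fun N => ?_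
  rw [Finset.sum_sub_distrib]
  ring

/-- With averages A_n one has u_n = (n + 1) A_{n+1} - n A_n, and the two terms cancel after division
by n. -/
lemma tendsto_div_natCast_of_average {u : ℕ → ℝ} {L : ℝ}
    (hu : Tendsto (fun N : ℕ => (∑ n ∈ Finset.range N, u n) / N) atTop (𝓝 L)) :
    Tendsto (fun n : ℕ => u n / n) atTop (𝓝 0) := by
  have h1 := hu.comp (tendsto_add_atTop_nat 1)
  have h2 : Tendsto (fun n : ℕ => ((n + 1 : ℕ) : ℝ) / n) atTop (𝓝 1) := by
    have := (tendsto_const_nhds (x := (1 : ℝ))).add (tendsto_one_div_atTop_nhds_zero_nat (𝕜 := ℝ))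
    rw [add_zero] at this
    refine this.congr' ?_
    filter_upwards [eventually_gt_atTop 0] with n hn
    have : (n : ℝ) ≠ 0 := by positivity
    push_cast
    field_simp
  have h3 := (h1.mul h2).sub hu
  rw [mul_one, sub_self] at h3
  refine h3.congr' ?_
  filter_upwards [eventually_gt_atTop 0] with n hn
  have : (n : ℝ) ≠ 0 := by positivity
  have h' : ((n + 1 : ℕ) : ℝ) ≠ 0 := by positivity
  simp only [Function.comp_apply]
  rw [Finset.sum_range_succ]
  field_simp
  ring

/-- A sequence with a sublinear growth bound has averages bounded by affine functions. -/
lemma exists_le_affine_of_tendsto_div {u : ℕ → ℝ} {L ε : ℝ} (hε : 0 < ε)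
    (hu : Tendsto (fun n : ℕ => u n / n) atTop (𝓝 L)) :
    ∃ C, ∀ n : ℕ, u n ≤ (L + ε) * n + C := by
  have h : ∀ᶠ n : ℕ in atTop, u n - (L + ε) * n ≤ 0 := by
    filter_upwards [hu.eventually_lt_const (show L < L + ε by linarith), eventually_gt_atTop 0]
      with n hn hn0
    have : (0 : ℝ) < n := by positivity
    rw [div_lt_iff₀ this] at hn
    linarith
  obtain ⟨N, hN⟩ := eventually_atTop.1 h
  obtain ⟨C, hC⟩ := ((Finset.range N).finite_toSet.image
    (fun n : ℕ => u n - (L + ε) * n)).bddAbove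
  refine ⟨max C 0, fun n => ?_⟩
  by_cases hn : n < N
  · have := hC ⟨n, by simpa using hn, rfl⟩
    simp only at this
    linarith [le_max_left C 0]
  · linarith [hN n (by omega), le_max_right C 0]

lemma tendsto_sum_atBot_of_average {u : ℕ → ℝ} {L : ℝ} (hL : L < 0)
    (hu : Tendsto (fun N : ℕ => (∑ n ∈ Finset.range N, u n) / N) atTop (𝓝 L)) :
    Tendsto (fun N : ℕ => ∑ n ∈ Finset.range N, u n) atTop atBot := by
  obtain ⟨C, hC⟩ := exists_le_affine_of_tendsto_div (ε := -L / 2) (by linarith) hu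
  refine tendsto_atBot_mono hC ?_
  refine tendsto_atBot_add_const_right _ _ ?_
  refine Tendsto.const_mul_atTop_of_neg (by linarith) tendsto_natCast_atTop_atTop

/-- The delay grows sublinearly in a queue with negative drift. -/
lemma tendsto_lindley_div {ξ : ℕ → ℝ × ℝ} {a b d : ℝ} (hd : 0 ≤ d) (hξ : ∀ n, 0 ≤ (ξ n).2)
    (hba : b < a)
    (ha : Tendsto (fun N : ℕ => (∑ n ∈ Finset.range N, (ξ n).1) / N) atTop (𝓝 a))
    (hb : Tendsto (fun N : ℕ => (∑ n ∈ Finset.range N, (ξ n).2) / N) atTop (𝓝 b)) :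
    Tendsto (fun N : ℕ => lindley ξ d N / N) atTop (𝓝 0) := by
  set S : ℕ → ℝ := fun n => ∑ i ∈ Finset.range n, ((ξ i).1 - (ξ i).2) with hS
  have hSlim : Tendsto (fun n : ℕ => S n / n) atTop (𝓝 (a - b)) := by
    refine (ha.sub hb).congr fun n => ?_
    rw [hS]
    simp only [Finset.sum_sub_distrib]
    ring
  have hGS : Tendsto (fun n : ℕ => ((ξ n).1 + S n) / n) atTop (𝓝 (a - b)) := by
    have := (tendsto_div_natCast_of_average ha).add hSlim
    rw [zero_add] at this
    exact this.congr fun n => by ring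
  rw [tendsto_order]
  constructor
  · intro c hc
    filter_upwards with n
    exact hc.trans_le (div_nonneg (lindley_nonneg hξ hd n) n.cast_nonneg)
  · intro ε hε
    obtain ⟨C, hC⟩ := exists_le_affine_of_tendsto_div (ε := ε / 2) (by linarith) hGS
    -- The sum of the delay and `S` is unchanged by a busy step and is reset to `(ξ n).1 + S n` by
    -- an idle one, so it inherits the affine bound on the latter.
    have hbound : ∀ n : ℕ, lindley ξ d n + S n ≤ (a - b + ε / 2) * n + max C d := by
      intro n
      induction n with
      | zero => simp [lindley, hS]
      | succ n ih =>
        have hs : S (n + 1) = S n + ((ξ n).1 - (ξ n).2) := by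
          simp only [hS, Finset.sum_range_succ]
        have h1 := hC n
        have hpos : (a - b + ε / 2) * (n : ℝ) ≤ (a - b + ε / 2) * ((n + 1 : ℕ) : ℝ) := by
          push_cast
          nlinarith
        simp only [lindley, lindleyStep]
        rw [hs]
        rcases le_total 0 (lindley ξ d n - (ξ n).1) with h | h
        · rw [max_eq_right h]
          linarith
        · rw [max_eq_left h]
          linarith [le_max_left C d]
    have hup : Tendsto (fun n : ℕ => (a - b + ε / 2) + max C d / n - S n / n) atTop
        (𝓝 ((a - b + ε / 2) + 0 - (a - b))) :=
      (tendsto_const_nhds.add (tendsto_const_div_atTop_nhds_zero_nat _)).sub hSlim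
    have hlt : (a - b + ε / 2) + 0 - (a - b) < ε := by linarith
    filter_upwards [hup.eventually_lt_const hlt, eventually_gt_atTop 0] with n hn hn0
    have hnpos : (0 : ℝ) < n := by positivity
    refine lt_of_le_of_lt ?_ hn
    have := hbound n
    have h2 : lindley ξ d n / n ≤ ((a - b + ε / 2) * n + max C d - S n) / n := by
      gcongr
      linarith
    refine h2.trans (le_of_eq ?_)
    field_simp

/-! ### Bounded orthogonal sequences -/

lemma integral_sq_sum_le_of_orthogonal {Ω : Type*} [MeasurableSpace Ω] {P : Measure Ω}
    [IsProbabilityMeasure P] {Z : ℕ → Ω → ℝ} {C : ℝ} (hZ : ∀ n, Measurable (Z n))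
    (hC : ∀ n ω, |Z n ω| ≤ C) (horth : ∀ n m, n < m → ∫ ω, Z n ω * Z m ω ∂P = 0) (N : ℕ) :
    ∫ ω, (∑ n ∈ Finset.range N, Z n ω) ^ 2 ∂P ≤ N * C ^ 2 := by
  have hint : ∀ n m, Integrable (fun ω => Z n ω * Z m ω) P := fun n m => by
    refine Integrable.of_bound ((hZ n).mul (hZ m)).aestronglyMeasurable (C * C)
      (ae_of_all _ fun ω => ?_)
    rw [Real.norm_eq_abs, abs_mul]
    exact mul_le_mul (hC n ω) (hC m ω) (abs_nonneg _) ((abs_nonneg _).trans (hC n ω))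
  have h1 : ∀ ω, (∑ n ∈ Finset.range N, Z n ω) ^ 2
      = ∑ n ∈ Finset.range N, ∑ m ∈ Finset.range N, Z n ω * Z m ω := fun ω => by
    rw [sq, Finset.sum_mul_sum]
  simp_rw [h1]
  rw [integral_finsetSum _ fun n _ => integrable_finsetSum _ fun m _ => hint n m]
  have h2 : ∀ n ∈ Finset.range N,
      ∫ ω, ∑ m ∈ Finset.range N, Z n ω * Z m ω ∂P ≤ C ^ 2 := by
    intro n hn
    rw [integral_finsetSum _ fun m _ => hint n m, Finset.sum_eq_single_of_mem n hn]
    · calc ∫ ω, Z n ω * Z n ω ∂P ≤ ∫ _, C ^ 2 ∂P := by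
            refine integral_mono (hint n n) (integrable_const _) fun ω => ?_
            simp only
            rw [← sq, ← sq_abs]
            exact pow_le_pow_left₀ (abs_nonneg _) (hC n ω) 2
        _ = C ^ 2 := by simp
    · intro m _ hmn
      rcases lt_or_gt_of_ne hmn with h | h
      · simp_rw [mul_comm (Z n _)]
        exact horth m n h
      · exact horth n m h
  calc _ ≤ ∑ n ∈ Finset.range N, C ^ 2 := Finset.sum_le_sum h2
    _ = N * C ^ 2 := by simp

/-- The strong law of large numbers for bounded orthogonal random variables. -/
lemma tendsto_average_of_orthogonal {Ω : Type*} [MeasurableSpace Ω] {P : Measure Ω}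
    [IsProbabilityMeasure P] {Z : ℕ → Ω → ℝ} {C : ℝ} (hZ : ∀ n, Measurable (Z n))
    (hC : ∀ n ω, |Z n ω| ≤ C) (horth : ∀ n m, n < m → ∫ ω, Z n ω * Z m ω ∂P = 0) :
    ∀ᵐ ω ∂P, Tendsto (fun N : ℕ => (∑ n ∈ Finset.range N, Z n ω) / N) atTop (𝓝 0) := by
  set S : ℕ → Ω → ℝ := fun N ω => ∑ n ∈ Finset.range N, Z n ω with hS
  have hSm : ∀ N, Measurable (S N) := fun N => by
    simp only [hS]
    fun_prop
  have hSC : ∀ N ω, |S N ω| ≤ N * C := fun N ω => by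
    refine (Finset.abs_sum_le_sum_abs _ _).trans ?_
    refine (Finset.sum_le_sum fun n _ => hC n ω).trans (le_of_eq ?_)
    simp
  -- Along the squares the second moments of the averages are at most C²/k², which is summable, so
  -- these averages tend to 0 almost surely.
  have hsq : ∀ᵐ ω ∂P, ∑' k : ℕ, ENNReal.ofReal ((S (k ^ 2) ω / ((k ^ 2 : ℕ) : ℝ)) ^ 2) < ⊤ := by
    refine ae_lt_top (by fun_prop) ?_
    rw [lintegral_tsum fun k => by fun_prop]
    have hk : ∀ k : ℕ, ∫⁻ ω, ENNReal.ofReal ((S (k ^ 2) ω / ((k ^ 2 : ℕ) : ℝ)) ^ 2) ∂P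
        ≤ ENNReal.ofReal (C ^ 2 * (1 / (k : ℝ) ^ 2)) := by
      intro k
      rw [← ofReal_integral_eq_lintegral_ofReal ?_ (ae_of_all _ fun ω => by positivity)]
      · refine ENNReal.ofReal_le_ofReal ?_
        simp_rw [div_pow]
        rw [integral_div]
        rcases Nat.eq_zero_or_pos k with rfl | hkpos
        · simp
        · have hk0 : (0 : ℝ) < k := by positivity
          rw [div_le_iff₀ (by positivity)]
          refine (integral_sq_sum_le_of_orthogonal hZ hC horth (k ^ 2)).trans (le_of_eq ?_)
          push_cast
          field_simp
      · refine Integrable.of_bound (by fun_prop) (C ^ 2) (ae_of_all _ fun ω => ?_)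
        rw [Real.norm_eq_abs, abs_pow, abs_div, Nat.abs_cast]
        refine pow_le_pow_left₀ (by positivity) ?_ 2
        exact div_le_of_le_mul₀ (by positivity) ((abs_nonneg _).trans (hC 0 ω))
          ((hSC _ ω).trans (le_of_eq (mul_comm _ _)))
    refine ((ENNReal.tsum_le_tsum hk).trans_lt ?_).ne
    have hsum : Summable fun k : ℕ => C ^ 2 * (1 / (k : ℝ) ^ 2) :=
      (Real.summable_one_div_nat_pow.2 one_lt_two).mul_left _
    rw [← ENNReal.ofReal_tsum_of_nonneg (fun k => by positivity) hsum]
    exact ENNReal.ofReal_lt_top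
  filter_upwards [hsq] with ω hω
  have hC0 : 0 ≤ C := (abs_nonneg _).trans (hC 0 ω)
  have h1 : Tendsto (fun k : ℕ => |S (k ^ 2) ω / ((k ^ 2 : ℕ) : ℝ)|) atTop (𝓝 0) := by
    have h := ENNReal.tendsto_atTop_zero_of_tsum_ne_top hω.ne
    have h' := (ENNReal.tendsto_toReal ENNReal.zero_ne_top).comp h
    simp only [ENNReal.toReal_zero] at h'
    have h'' := (Real.continuous_sqrt.tendsto 0).comp h'
    rw [Real.sqrt_zero] at h''
    refine h''.congr fun k => ?_
    simp only [Function.comp_apply]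
    rw [ENNReal.toReal_ofReal (by positivity), Real.sqrt_sq_eq_abs]
  have hsqrt : Tendsto Nat.sqrt atTop atTop :=
    tendsto_atTop_atTop.2 fun b => ⟨b * b, fun a ha => Nat.le_sqrt.2 ha⟩
  have h2 : Tendsto (fun k : ℕ => |S (k ^ 2) ω / ((k ^ 2 : ℕ) : ℝ)| + 2 * C / k) atTop (𝓝 0) := by
    have := h1.add (tendsto_const_div_atTop_nhds_zero_nat (2 * C))
    rwa [add_zero] at this
  refine squeeze_zero_norm' ?_ (h2.comp hsqrt)
  filter_upwards [eventually_gt_atTop 0] with N hN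
  simp only [Function.comp_apply]
  set k := Nat.sqrt N with hk
  have hkpos : 0 < k := Nat.sqrt_pos.2 hN
  have hkN : k ^ 2 ≤ N := by
    rw [sq]
    exact Nat.sqrt_le N
  have hNk : N ≤ k ^ 2 + 2 * k := by
    have := Nat.sqrt_le_add N
    rw [← hk] at this
    nlinarith
  have hk0 : (0 : ℝ) < k := by exact_mod_cast hkpos
  have hN0 : (0 : ℝ) < N := by exact_mod_cast hN
  -- Between consecutive squares there are at most 2k further bounded terms, negligible against k².
  have hdiff : |S N ω - S (k ^ 2) ω| ≤ 2 * k * C := by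
    simp only [hS]
    rw [← Finset.sum_Ico_eq_sub _ hkN]
    refine (Finset.abs_sum_le_sum_abs _ _).trans ?_
    refine (Finset.sum_le_sum fun n _ => hC n ω).trans ?_
    rw [Finset.sum_const, Nat.card_Ico, nsmul_eq_mul]
    have : ((N - k ^ 2 : ℕ) : ℝ) ≤ 2 * k := by
      have : N - k ^ 2 ≤ 2 * k := by omega
      exact_mod_cast this
    gcongr
  have hk2 : ((k ^ 2 : ℕ) : ℝ) ≤ N := by exact_mod_cast hkN
  change |S N ω / N| ≤ _
  rw [abs_div, abs_div, Nat.abs_cast, Nat.abs_cast]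
  have h3 : |S N ω| ≤ |S (k ^ 2) ω| + 2 * k * C := by
    have := abs_add_le (S N ω - S (k ^ 2) ω) (S (k ^ 2) ω)
    rw [sub_add_cancel] at this
    linarith
  have hk2pos : (0 : ℝ) < ((k ^ 2 : ℕ) : ℝ) := by positivity
  calc |S N ω| / N ≤ (|S (k ^ 2) ω| + 2 * k * C) / ((k ^ 2 : ℕ) : ℝ) := by gcongr
    _ = |S (k ^ 2) ω| / ((k ^ 2 : ℕ) : ℝ) + 2 * C / k := by
      push_cast
      field_simp

/-! ### Independent inputs -/

/-- `ξ` is a sequence of independent random variables with law `π`. -/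
structure IsIIDInput {Ω E : Type*} [MeasurableSpace Ω] [mE : MeasurableSpace E] (P : Measure Ω)
    (π : Measure E) (ξ : ℕ → Ω → E) : Prop where
  measurable : ∀ n, Measurable (ξ n)
  map_eq : ∀ n, P.map (ξ n) = π
  indep : ∀ (A : Set ℕ) (n : ℕ), n ∉ A → Indep (⨆ i ∈ A, mE.comap (ξ i)) (mE.comap (ξ n)) P

lemma measurable_iSup_comap_of_mem {Ω E : Type*} [mE : MeasurableSpace E] {ξ : ℕ → Ω → E}
    {A : Set ℕ} {n : ℕ} (hn : n ∈ A) : Measurable[⨆ i ∈ A, mE.comap (ξ i)] (ξ n) :=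
  Measurable.mono (comap_measurable (ξ n)) (le_iSup₂_of_le n hn le_rfl) le_rfl

namespace IsIIDInput

variable {Ω E : Type*} [MeasurableSpace Ω] [mE : MeasurableSpace E] {P : Measure Ω}
  {π : Measure E} {ξ : ℕ → Ω → E}

/-- The index set is arbitrary because the forward chain needs independence from the past, and the
backward construction independence from the future. -/
lemma map_prodMk [IsProbabilityMeasure P] (h : IsIIDInput P π ξ) {F : Type*} [mF : MeasurableSpace F]
    {A : Set ℕ} {n : ℕ} (hn : n ∉ A) {Y : Ω → F} (hY : Measurable[⨆ i ∈ A, mE.comap (ξ i)] Y) :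
    P.map (fun ω => (Y ω, ξ n ω)) = (P.map Y).prod π := by
  have hle : (⨆ i ∈ A, mE.comap (ξ i)) ≤ ‹MeasurableSpace Ω› :=
    iSup₂_le fun i _ => (h.measurable i).comap_le
  have hind : IndepFun Y (ξ n) P := by
    rw [IndepFun_iff_Indep]
    exact indep_of_indep_of_le_left (h.indep A n hn) hY.comap_le
  rw [← h.map_eq n]
  exact (indepFun_iff_map_prod_eq_prod_map_map (hY.mono hle le_rfl).aemeasurable
    (h.measurable n).aemeasurable).1 hind

end IsIIDInput

/-! ### The Lindley chain of an i.i.d. input -/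

/-- The inputs of a stable queue: `π` is the joint law of an interarrival time and a service
time. -/
structure IsStableInput (π : Measure (ℝ × ℝ)) : Prop where
  isProbabilityMeasure : IsProbabilityMeasure π
  nonneg : ∀ᵐ p ∂π, 0 ≤ p.1 ∧ 0 ≤ p.2
  integrable_fst : Integrable (fun p => p.1) π
  integrable_snd : Integrable (fun p => p.2) π
  lt : ∫ p, p.2 ∂π < ∫ p, p.1 ∂π

/-- The transition operator of the delay chain. -/
noncomputable def lindleyOp (π : Measure (ℝ × ℝ)) (f : ℝ → ℝ) (d : ℝ) : ℝ :=
  ∫ p, f (lindleyStep d p) ∂π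

/-- `ν` is a stationary law of the delay chain. -/
def IsStationaryDelay (π : Measure (ℝ × ℝ)) (ν : Measure ℝ) : Prop :=
  (ν.prod π).map (fun q => lindleyStep q.1 q.2) = ν

/-- The Cesàro means of a sequence. -/
noncomputable def cesaro (u : ℕ → ℝ) (N : ℕ) : ℝ := (∑ n ∈ Finset.range N, u n) / N

lemma cesaro_sub (u v : ℕ → ℝ) (N : ℕ) :
    cesaro (fun n => u n - v n) N = cesaro u N - cesaro v N := by
  simp only [cesaro, Finset.sum_sub_distrib, sub_div]

lemma cesaro_add (u v : ℕ → ℝ) (N : ℕ) :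
    cesaro (fun n => u n + v n) N = cesaro u N + cesaro v N := by
  simp only [cesaro, Finset.sum_add_distrib, add_div]

lemma cesaro_const_mul (c : ℝ) (u : ℕ → ℝ) (N : ℕ) :
    cesaro (fun n => c * u n) N = c * cesaro u N := by
  simp only [cesaro, ← Finset.mul_sum, mul_div_assoc]

lemma cesaro_const (c : ℝ) {N : ℕ} (hN : 0 < N) : cesaro (fun _ => c) N = c := by
  have : (N : ℝ) ≠ 0 := by positivity
  simp [cesaro, this]

lemma cesaro_mono {u v : ℕ → ℝ} (h : ∀ n, u n ≤ v n) (N : ℕ) : cesaro u N ≤ cesaro v N := by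
  simp only [cesaro]
  gcongr with n
  exact h n

lemma cesaro_nonneg {u : ℕ → ℝ} (h : ∀ n, 0 ≤ u n) (N : ℕ) : 0 ≤ cesaro u N :=
  div_nonneg (Finset.sum_nonneg fun n _ => h n) N.cast_nonneg

/-- The difference telescopes to (u_N - u_0)/N. -/
lemma tendsto_cesaro_shift {u : ℕ → ℝ} {C : ℝ} (hu : ∀ n, |u n| ≤ C) :
    Tendsto (fun N => cesaro (fun n => u (n + 1)) N - cesaro u N) atTop (𝓝 0) := by
  have h : Tendsto (fun N : ℕ => 2 * C / N) atTop (𝓝 0) := tendsto_const_div_atTop_nhds_zero_nat _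
  refine squeeze_zero_norm (fun N => ?_) h
  rw [← cesaro_sub, cesaro, Finset.sum_range_sub, Real.norm_eq_abs, abs_div, Nat.abs_cast]
  gcongr
  linarith [abs_sub (u N) (u 0), hu N, hu 0]

/-- Only the inputs before `n` enter the delay of packet `n`; this makes it independent of `ξ n`,
and the delays a Markov chain. -/
lemma measurable_lindley_past {Ω : Type*} (ξ : ℕ → Ω → ℝ × ℝ) (d : ℝ) (n : ℕ) :
    Measurable[⨆ i ∈ Set.Iio n, MeasurableSpace.comap (ξ i) inferInstance]
      (fun ω => lindley (fun i => ξ i ω) d n) := by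
  induction n with
  | zero => exact measurable_const
  | succ n ih =>
    have h1 : (⨆ i ∈ Set.Iio n, MeasurableSpace.comap (ξ i) inferInstance)
        ≤ ⨆ i ∈ Set.Iio (n + 1), MeasurableSpace.comap (ξ i) inferInstance :=
      biSup_mono fun i hi => Set.mem_Iio.2 (Nat.lt_succ_of_lt hi)
    exact measurable_lindleyStep.comp ((ih.mono h1 le_rfl).prodMk
      (measurable_iSup_comap_of_mem (Set.mem_Iio.2 n.lt_succ_self)))

namespace IsIIDInput

variable {Ω : Type*} [MeasurableSpace Ω] {P : Measure Ω}
  {π : Measure (ℝ × ℝ)} {ξ : ℕ → Ω → ℝ × ℝ}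

lemma past_le (h : IsIIDInput P π ξ) (A : Set ℕ) :
    (⨆ i ∈ A, MeasurableSpace.comap (ξ i) inferInstance) ≤ ‹MeasurableSpace Ω› :=
  iSup₂_le fun i _ => (h.measurable i).comap_le

lemma measurable_lindley (h : IsIIDInput P π ξ) (d : ℝ) (n : ℕ) :
    Measurable (fun ω => lindley (fun i => ξ i ω) d n) :=
  (measurable_lindley_past ξ d n).mono (h.past_le _) le_rfl

lemma isProbabilityMeasure [IsProbabilityMeasure P] (h : IsIIDInput P π ξ) : IsProbabilityMeasure π := by
  rw [← h.map_eq 0]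
  exact Measure.isProbabilityMeasure_map (h.measurable 0).aemeasurable

lemma ae_forall (h : IsIIDInput P π ξ) {p : ℝ × ℝ → Prop} (hp : ∀ᵐ x ∂π, p x) :
    ∀ᵐ ω ∂P, ∀ n, p (ξ n ω) := by
  rw [ae_all_iff]
  intro n
  rw [← h.map_eq n] at hp
  exact ae_of_ae_map (h.measurable n).aemeasurable hp

/-- The strong law of large numbers for functionals of the input. -/
lemma tendsto_cesaro_input (h : IsIIDInput P π ξ) {f : ℝ × ℝ → ℝ} (hf : Measurable f)
    (hint : Integrable f π) :
    ∀ᵐ ω ∂P, Tendsto (cesaro fun n => f (ξ n ω)) atTop (𝓝 (∫ p, f p ∂π)) := by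
  have hmap : ∫ p, f p ∂π = ∫ ω, f (ξ 0 ω) ∂P := by
    rw [← h.map_eq 0, integral_map (h.measurable 0).aemeasurable hf.aestronglyMeasurable]
  rw [hmap]
  refine strong_law_ae_real (fun n ω => f (ξ n ω)) ?_ ?_ ?_
  · rw [← h.map_eq 0] at hint
    exact hint.comp_measurable (h.measurable 0)
  · intro m n hmn
    have hind : IndepFun (ξ m) (ξ n) P := by
      rw [IndepFun_iff_Indep]
      exact indep_of_indep_of_le_left (h.indep {m} n (by simpa using hmn.symm))
        (le_iSup₂_of_le m rfl le_rfl)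
    exact hind.comp hf hf
  · intro n
    exact (⟨(h.measurable n).aemeasurable, (h.measurable 0).aemeasurable,
      (h.map_eq n).trans (h.map_eq 0).symm⟩ : IdentDistrib (ξ n) (ξ 0) P P).comp hf

/-- The averages of a bounded functional of the delay and of the next input are asymptotic to
the averages of its conditional means. -/
lemma tendsto_cesaro_sub [IsProbabilityMeasure P] (h : IsIIDInput P π ξ) (d : ℝ) {F : ℝ × (ℝ × ℝ) → ℝ} (hF : Measurable F)
    {C : ℝ} (hC : ∀ q, |F q| ≤ C) :
    ∀ᵐ ω ∂P, Tendsto (fun N =>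
      cesaro (fun n => F (lindley (fun i => ξ i ω) d n, ξ n ω)) N
        - cesaro (fun n => ∫ p, F (lindley (fun i => ξ i ω) d n, p) ∂π) N) atTop (𝓝 0) := by
  have := h.isProbabilityMeasure
  have hFbar : Measurable fun x => ∫ p, F (x, p) ∂π :=
    (hF.stronglyMeasurable.integral_prod_right' (ν := π)).measurable
  have hFbarC : ∀ x, |∫ p, F (x, p) ∂π| ≤ C := fun x => by
    have := norm_integral_le_of_norm_le_const (μ := π) (f := fun p => F (x, p))
      (ae_of_all _ fun p => hC (x, p))
    simpa using this
  set W : ℝ × (ℝ × ℝ) → ℝ := fun q => F q - ∫ p, F (q.1, p) ∂π with hW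
  have hWm : Measurable W := hF.sub (hFbar.comp measurable_fst)
  have hWC : ∀ q, |W q| ≤ 2 * C := fun q => by
    have := abs_sub (F q) (∫ p, F (q.1, p) ∂π)
    simp only [hW]
    linarith [hC q, hFbarC q.1]
  -- `W` is centred given the current delay, so the variables to be averaged are bounded martingale
  -- differences.
  have hWint : ∀ x, ∫ p, W (x, p) ∂π = 0 := fun x => by
    simp only [hW]
    rw [integral_sub (f := fun p => F (x, p)) (Integrable.of_bound
      (hF.comp measurable_prodMk_left).aestronglyMeasurable C (ae_of_all _ fun p => hC (x, p)))
      (integrable_const _)]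
    simp
  set X : ℕ → Ω → ℝ := fun n ω => lindley (fun i => ξ i ω) d n with hX
  have key := tendsto_average_of_orthogonal (P := P) (Z := fun n ω => W (X n ω, ξ n ω))
    (fun n => hWm.comp ((h.measurable_lindley d n).prodMk (h.measurable n))) (fun n ω => hWC _) ?_
  · filter_upwards [key] with ω hω
    refine hω.congr fun N => ?_
    rw [← cesaro_sub]
    rfl
  · intro n m hnm
    have hle : ∀ {k}, k ≤ m → (⨆ i ∈ Set.Iio k, MeasurableSpace.comap (ξ i) inferInstance)
        ≤ ⨆ i ∈ Set.Iio m, MeasurableSpace.comap (ξ i) inferInstance := fun hk =>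
      biSup_mono fun i hi => Set.mem_Iio.2 (lt_of_lt_of_le hi hk)
    -- The earlier factor and the delay at time `m` are both functions of the inputs before `m`,
    -- hence jointly independent of `ξ m`.
    have hY : Measurable[⨆ i ∈ Set.Iio m, MeasurableSpace.comap (ξ i) inferInstance]
        (fun ω => (W (X n ω, ξ n ω), X m ω)) := by
      refine Measurable.prodMk ?_ (measurable_lindley_past ξ d m)
      exact hWm.comp (((measurable_lindley_past ξ d n).mono (hle hnm.le) le_rfl).prodMk
        (measurable_iSup_comap_of_mem (Set.mem_Iio.2 hnm)))
    have hlaw := h.map_prodMk (A := Set.Iio m) (n := m) (by simp) hY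
    have hYm : Measurable (fun ω => (W (X n ω, ξ n ω), X m ω)) := hY.mono (h.past_le _) le_rfl
    have hYlaw : IsProbabilityMeasure (P.map fun ω => (W (X n ω, ξ n ω), X m ω)) :=
      Measure.isProbabilityMeasure_map hYm.aemeasurable
    -- Clamping the first factor makes the integrand bounded on the whole product space, as Fubini
    -- requires. On the actual values of `W` the clamp does nothing.
    set Φ : (ℝ × ℝ) × (ℝ × ℝ) → ℝ := fun q => max (-(2 * C)) (min q.1.1 (2 * C)) * W (q.1.2, q.2)
      with hΦ
    have hΦm : Measurable Φ := by
      simp only [hΦ]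
      fun_prop
    have hC0 : 0 ≤ 2 * C := (abs_nonneg _).trans (hWC (0, (0, 0)))
    have hΦC : ∀ q, |Φ q| ≤ 2 * C * (2 * C) := fun q => by
      simp only [hΦ]
      rw [abs_mul]
      refine mul_le_mul ?_ (hWC _) (abs_nonneg _) hC0
      exact abs_le.2 ⟨le_max_left _ _, max_le (by linarith) (min_le_right _ _)⟩
    have h1 : ∀ ω, W (X n ω, ξ n ω) * W (X m ω, ξ m ω)
        = Φ ((W (X n ω, ξ n ω), X m ω), ξ m ω) := fun ω => by
      have := abs_le.1 (hWC (X n ω, ξ n ω))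
      simp only [hΦ]
      rw [min_eq_left this.2, max_eq_right this.1]
    simp_rw [h1]
    rw [← integral_map (φ := fun ω => ((W (X n ω, ξ n ω), X m ω), ξ m ω)) (f := Φ)
      (hYm.prodMk (h.measurable m)).aemeasurable hΦm.aestronglyMeasurable, hlaw,
      integral_prod _ (Integrable.of_bound hΦm.aestronglyMeasurable _ (ae_of_all _ hΦC))]
    simp only [hΦ, integral_const_mul, hWint, mul_zero, integral_zero]

/-- The induction writes T^(k+1) f as T^k (T f) and averages over the last input, which is
independent of the delay before it; hence `f` has to vary. -/
lemma iterate_lindleyOp_eq [IsProbabilityMeasure P] (h : IsIIDInput P π ξ) (d : ℝ) (k : ℕ) {f : ℝ → ℝ}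
    (hf : Measurable f) {C : ℝ} (hC : ∀ x, |f x| ≤ C) :
    (lindleyOp π)^[k] f d = ∫ ω, f (lindley (fun i => ξ i ω) d k) ∂P := by
  have := h.isProbabilityMeasure
  induction k generalizing f with
  | zero => simp [lindley]
  | succ k ih =>
    have hfs : Measurable fun q : ℝ × (ℝ × ℝ) => f (lindleyStep q.1 q.2) :=
      hf.comp measurable_lindleyStep
    have hTm : Measurable (lindleyOp π f) :=
      (hfs.stronglyMeasurable.integral_prod_right' (ν := π)).measurable
    have hTC : ∀ x, |lindleyOp π f x| ≤ C := fun x => by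
      have := norm_integral_le_of_norm_le_const (μ := π) (f := fun p => f (lindleyStep x p))
        (ae_of_all _ fun p => hC _)
      simpa [lindleyOp] using this
    rw [Function.iterate_succ_apply, ih hTm hTC]
    have hX := measurable_lindley_past ξ d k
    have hXm := h.measurable_lindley d k
    have hlaw := h.map_prodMk (A := Set.Iio k) (n := k) (by simp) hX
    have : IsProbabilityMeasure (P.map fun ω => lindley (fun i => ξ i ω) d k) :=
      Measure.isProbabilityMeasure_map hXm.aemeasurable
    simp only [lindley]
    rw [← integral_map (φ := fun ω => (lindley (fun i => ξ i ω) d k, ξ k ω))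
      (f := fun q => f (lindleyStep q.1 q.2)) (hXm.prodMk (h.measurable k)).aemeasurable
      hfs.aestronglyMeasurable, hlaw, integral_prod _
        (Integrable.of_bound hfs.aestronglyMeasurable C (ae_of_all _ fun q => hC _)),
      integral_map hXm.aemeasurable hfs.stronglyMeasurable.integral_prod_right'.aestronglyMeasurable]
    rfl

end IsIIDInput

/-! ### The ergodic theorem for the delay chain -/

/-- Bounded nonincreasing functions that vanish at infinity. -/
structure IsDecay (f : ℝ → ℝ) (C : ℝ) : Prop where
  antitone : Antitone f
  nonneg : ∀ x, 0 ≤ f x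
  le : ∀ x, f x ≤ C
  tendsto : Tendsto f atTop (𝓝 0)

lemma IsDecay.measurable {f : ℝ → ℝ} {C : ℝ} (hf : IsDecay f C) : Measurable f :=
  hf.antitone.measurable

lemma IsDecay.abs_le {f : ℝ → ℝ} {C : ℝ} (hf : IsDecay f C) (x : ℝ) : |f x| ≤ C :=
  (abs_of_nonneg (hf.nonneg x)).trans_le (hf.le x)

/-- This class is the one carried through the ergodic argument. It is stable under the operator
because a step is monotone in the delay and tends to infinity with it, and a single value then
controls a whole half-line. -/
lemma isDecay_lindleyOp {π : Measure (ℝ × ℝ)} (hπ : IsStableInput π) {f : ℝ → ℝ} {C : ℝ}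
    (hf : IsDecay f C) : IsDecay (lindleyOp π f) C := by
  have := hπ.isProbabilityMeasure
  have hstep : ∀ d, Measurable fun p => f (lindleyStep d p) := fun d =>
    hf.measurable.comp (measurable_lindleyStep.comp measurable_prodMk_left)
  have hint : ∀ d, Integrable (fun p => f (lindleyStep d p)) π := fun d =>
    Integrable.of_bound (hstep d).aestronglyMeasurable C (ae_of_all _ fun p => hf.abs_le _)
  refine ⟨fun a b hab => ?_, fun d => integral_nonneg fun p => hf.nonneg _, fun d => ?_, ?_⟩
  · exact integral_mono (hint b) (hint a) fun p => hf.antitone (lindleyStep_mono p hab)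
  · calc lindleyOp π f d ≤ ∫ _, C ∂π := integral_mono (hint d) (integrable_const _)
          fun p => hf.le _
      _ = C := by simp
  · have h := tendsto_integral_filter_of_dominated_convergence (μ := π) (l := atTop)
      (F := fun (d : ℝ) p => f (lindleyStep d p)) (f := fun _ => 0) (fun _ => C)
      (Eventually.of_forall fun d => (hstep d).aestronglyMeasurable)
      (Eventually.of_forall fun d => ae_of_all _ fun p => hf.abs_le _) (integrable_const _)
      (ae_of_all _ fun p => ?_)
    · rw [integral_zero] at h
      exact h
    · refine hf.tendsto.comp ?_
      refine tendsto_atTop_mono (f := fun d => d - p.1 + p.2) (fun d => ?_) ?_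
      · simp only [lindleyStep]
        linarith [le_max_right 0 (d - p.1)]
      · exact tendsto_atTop_add_const_right _ _
          (tendsto_atTop_add_const_right _ (-p.1) tendsto_id)

lemma isDecay_iterate_lindleyOp {π : Measure (ℝ × ℝ)} (hπ : IsStableInput π) {f : ℝ → ℝ} {C : ℝ}
    (hf : IsDecay f C) (k : ℕ) : IsDecay ((lindleyOp π)^[k] f) C := by
  induction k generalizing f with
  | zero => exact hf
  | succ k ih => exact ih (isDecay_lindleyOp hπ hf)

/-- A stationary delay has the law of the output of a step, and an output is at least its service
time. -/
lemma IsStationaryDelay.ae_nonneg {π : Measure (ℝ × ℝ)} (hπ : IsStableInput π) {ν : Measure ℝ}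
    [IsProbabilityMeasure ν] (hν : IsStationaryDelay π ν) : ∀ᵐ x ∂ν, 0 ≤ x := by
  have := hπ.isProbabilityMeasure
  rw [← hν, ae_map_iff measurable_lindleyStep.aemeasurable measurableSet_Ici]
  have h : ∀ᵐ q ∂(ν.prod π), 0 ≤ q.2.1 ∧ 0 ≤ q.2.2 :=
    Measure.quasiMeasurePreserving_snd.ae hπ.nonneg
  filter_upwards [h] with q hq using lindleyStep_nonneg _ hq.2

lemma IsStationaryDelay.integral_lindleyOp {π : Measure (ℝ × ℝ)} (hπ : IsStableInput π)
    {ν : Measure ℝ} [IsProbabilityMeasure ν] (hν : IsStationaryDelay π ν) {f : ℝ → ℝ}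
    (hf : Measurable f) {C : ℝ} (hC : ∀ x, |f x| ≤ C) : ∫ x, lindleyOp π f x ∂ν = ∫ x, f x ∂ν := by
  have := hπ.isProbabilityMeasure
  have hfs : Measurable fun q : ℝ × (ℝ × ℝ) => f (lindleyStep q.1 q.2) :=
    hf.comp measurable_lindleyStep
  nth_rw 2 [← hν]
  rw [integral_map measurable_lindleyStep.aemeasurable hf.aestronglyMeasurable,
    integral_prod _ (Integrable.of_bound hfs.aestronglyMeasurable C (ae_of_all _ fun q => hC _))]
  rfl

namespace IsIIDInput

variable {Ω : Type*} [MeasurableSpace Ω] {P : Measure Ω}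
  {π : Measure (ℝ × ℝ)} {ξ : ℕ → Ω → ℝ × ℝ}

lemma ae_coalesce (h : IsIIDInput P π ξ) (hπ : IsStableInput π) :
    ∀ᵐ ω ∂P, ∀ x y, ∀ᶠ n in atTop,
      lindley (fun i => ξ i ω) x n = lindley (fun i => ξ i ω) y n := by
  have hd : Measurable fun p : ℝ × ℝ => p.2 - p.1 := by fun_prop
  filter_upwards [h.ae_forall hπ.nonneg,
    h.tendsto_cesaro_input hd (hπ.integrable_snd.sub hπ.integrable_fst)] with ω hω hlim
  rw [integral_sub hπ.integrable_snd hπ.integrable_fst] at hlim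
  exact lindley_coalesce (fun n => (hω n).2)
    (tendsto_sum_atBot_of_average (sub_neg.2 hπ.lt) hlim)

/-- Coalescence makes the influence of the starting point vanish. Integrating the second starting
point against `ν`, whose integrals the operator preserves, identifies the limit. -/
lemma tendsto_iterate_lindleyOp [IsProbabilityMeasure P] (h : IsIIDInput P π ξ) (hπ : IsStableInput π) {ν : Measure ℝ}
    [IsProbabilityMeasure ν] (hν : IsStationaryDelay π ν) {f : ℝ → ℝ} {C : ℝ}
    (hf : IsDecay f C) (d : ℝ) :
    Tendsto (fun k => (lindleyOp π)^[k] f d) atTop (𝓝 (∫ x, f x ∂ν)) := by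
  have hdiff : ∀ x, Tendsto (fun k => (lindleyOp π)^[k] f d - (lindleyOp π)^[k] f x) atTop
      (𝓝 0) := by
    intro x
    have hm : ∀ y k, Measurable fun ω => f (lindley (fun i => ξ i ω) y k) := fun y k =>
      hf.measurable.comp (h.measurable_lindley y k)
    have hi : ∀ y k, Integrable (fun ω => f (lindley (fun i => ξ i ω) y k)) P := fun y k =>
      Integrable.of_bound (hm y k).aestronglyMeasurable C (ae_of_all _ fun ω => hf.abs_le _)
    have hlim := tendsto_integral_of_dominated_convergence (μ := P)
      (F := fun k ω => f (lindley (fun i => ξ i ω) d k) - f (lindley (fun i => ξ i ω) x k))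
      (f := fun _ => 0) (fun _ => C + C) (fun k => ((hm d k).sub (hm x k)).aestronglyMeasurable)
      (integrable_const _) (fun k => ae_of_all _ fun ω =>
        (abs_sub _ _).trans (add_le_add (hf.abs_le _) (hf.abs_le _))) ?_
    · rw [integral_zero] at hlim
      refine hlim.congr fun k => ?_
      rw [integral_sub (hi d k) (hi x k), h.iterate_lindleyOp_eq d k hf.measurable hf.abs_le,
        h.iterate_lindleyOp_eq x k hf.measurable hf.abs_le]
    · filter_upwards [h.ae_coalesce hπ] with ω hω
      refine tendsto_const_nhds.congr' ?_
      filter_upwards [hω d x] with n hn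
      rw [hn, sub_self]
  have hk := isDecay_iterate_lindleyOp hπ hf
  have hinv : ∀ k, ∫ x, (lindleyOp π)^[k] f x ∂ν = ∫ x, f x ∂ν := by
    intro k
    induction k with
    | zero => rfl
    | succ k ih =>
      rw [← ih]
      simp only [Function.iterate_succ_apply']
      exact hν.integral_lindleyOp hπ (hk k).measurable (hk k).abs_le
  have hlim := tendsto_integral_of_dominated_convergence (μ := ν)
    (F := fun k x => (lindleyOp π)^[k] f d - (lindleyOp π)^[k] f x)
    (f := fun _ => 0) (fun _ => C + C)
    (fun k => (measurable_const.sub (hk k).measurable).aestronglyMeasurable)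
    (integrable_const _) (fun k => ae_of_all _ fun x =>
      (abs_sub _ _).trans (add_le_add ((hk k).abs_le _) ((hk k).abs_le _)))
    (ae_of_all _ fun x => hdiff x)
  rw [integral_zero] at hlim
  have := hlim.add_const (∫ x, f x ∂ν)
  rw [zero_add] at this
  refine this.congr fun k => ?_
  rw [integral_sub (integrable_const _) (Integrable.of_bound (hk k).measurable.aestronglyMeasurable
    C (ae_of_all _ (hk k).abs_le)), hinv k]
  simp

/-- The value T g(D_n) is the conditional mean of g(D_{n+1}), so replacing g by T g costs a
martingale average and a shift by one index, both negligible. -/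
lemma tendsto_cesaro_iterate [IsProbabilityMeasure P] (h : IsIIDInput P π ξ) (hπ : IsStableInput π) {f : ℝ → ℝ} {C : ℝ}
    (hf : IsDecay f C) (d : ℝ) :
    ∀ᵐ ω ∂P, ∀ k, Tendsto (fun N => cesaro (fun n => f (lindley (fun i => ξ i ω) d n)) N
      - cesaro (fun n => (lindleyOp π)^[k] f (lindley (fun i => ξ i ω) d n)) N) atTop (𝓝 0) := by
  rw [ae_all_iff]
  intro k
  induction k with
  | zero => simp
  | succ k ih =>
    have hk := isDecay_iterate_lindleyOp hπ hf k
    filter_upwards [ih, h.tendsto_cesaro_sub d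
      (F := fun q => (lindleyOp π)^[k] f (lindleyStep q.1 q.2))
      (hk.measurable.comp measurable_lindleyStep) (fun q => hk.abs_le _)] with ω h1 h2
    have h3 := tendsto_cesaro_shift
      (u := fun n => (lindleyOp π)^[k] f (lindley (fun i => ξ i ω) d n)) fun n => hk.abs_le _
    have := (h1.sub h3).add h2
    rw [sub_zero, add_zero] at this
    refine this.congr fun N => ?_
    simp only [Function.iterate_succ_apply', lindley, lindleyOp]
    ring

end IsIIDInput

/-- Tightness of the averages, from a lower bound on the averages of functions that decrease. -/
lemma exists_cesaro_indicator_ge {x : ℕ → ℝ} {g : ℕ → ℝ → ℝ} {C m : ℝ} (hm : 0 < m)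
    (hx : ∀ n, 0 ≤ x n) (hg : ∀ k, IsDecay (g k) C) (hg0 : Tendsto (fun k => g k 0) atTop (𝓝 m))
    (havg : ∀ k, ∀ ε > 0, ∀ᶠ N in atTop, m - ε ≤ cesaro (fun n => g k (x n)) N) {ε : ℝ}
    (hε : 0 < ε) : ∃ K : ℝ, ∀ᶠ N in atTop,
      1 - ε ≤ cesaro (fun n => (Set.Iic K).indicator (fun _ => 1) (x n)) N := by
  set δ := ε * m / 3 with hδ
  have hδ0 : 0 < δ := by positivity
  obtain ⟨k, hk⟩ := (hg0.eventually_lt_const (show m < m + δ by linarith)).exists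
  obtain ⟨K, hK⟩ := ((hg k).tendsto.eventually_lt_const hδ0).exists
  refine ⟨K, ?_⟩
  filter_upwards [havg k δ hδ0, eventually_gt_atTop 0] with N hN hN0
  -- Below `K` the function is at most its value at 0, hence less than m + δ; above `K` it is less
  -- than δ.
  have hle : cesaro (fun n => g k (x n)) N
      ≤ (m + δ) * cesaro (fun n => (Set.Iic K).indicator (fun _ => 1) (x n)) N + δ := by
    rw [← cesaro_const_mul, ← cesaro_const δ hN0, ← cesaro_add]
    refine cesaro_mono (fun n => ?_) N
    rw [cesaro_const δ hN0]
    by_cases h : x n ≤ K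
    · rw [Set.indicator_of_mem (Set.mem_Iic.2 h)]
      linarith [(hg k).antitone (hx n)]
    · rw [Set.indicator_of_notMem (by simpa using h)]
      linarith [(hg k).antitone (not_le.1 h).le]
  have h3 : m - 2 * δ ≤ (m + δ) * cesaro (fun n => (Set.Iic K).indicator (fun _ => 1) (x n)) N := by
    linarith
  have h4 : (m + δ) * (1 - ε) ≤ m - 2 * δ := by
    have : δ * 3 = ε * m := by
      rw [hδ]
      ring
    nlinarith [mul_pos hδ0 hε]
  exact le_of_mul_le_mul_left (h4.trans h3) (by positivity)

/-- Monotonicity replaces uniform convergence. The upper bound uses only the value at 0, and the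
lower bound only the value at a point `K` below which almost all the `x n` lie. -/
lemma tendsto_cesaro_of_iterates {x : ℕ → ℝ} {f : ℕ → ℝ → ℝ} {C L : ℝ} (hL : 0 ≤ L)
    (hx : ∀ n, 0 ≤ x n) (hf : ∀ k, IsDecay (f k) C)
    (hlim : ∀ d, Tendsto (fun k => f k d) atTop (𝓝 L))
    (hsub : ∀ k, Tendsto (fun N => cesaro (fun n => f 0 (x n)) N
      - cesaro (fun n => f k (x n)) N) atTop (𝓝 0))
    (htight : ∀ ε > 0, ∃ K : ℝ, ∀ᶠ N in atTop,
      1 - ε ≤ cesaro (fun n => (Set.Iic K).indicator (fun _ => 1) (x n)) N) :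
    Tendsto (cesaro fun n => f 0 (x n)) atTop (𝓝 L) := by
  rw [tendsto_order]
  constructor
  · intro a ha
    -- The loss is ε L for the points beyond `K`, ε for the value at `K`, and ε for replacing `f 0`
    -- by `f k`.
    obtain ⟨ε, hε, hε'⟩ : ∃ ε > 0, a + ε * (L + 2) < L := by
      refine ⟨(L - a) / (2 * (L + 2)), div_pos (by linarith) (by linarith), ?_⟩
      have : (L - a) / (2 * (L + 2)) * (L + 2) = (L - a) / 2 := by
        field_simp
      linarith
    obtain ⟨K, hK⟩ := htight ε hε
    obtain ⟨k, hk⟩ := ((hlim K).eventually_const_lt (show L - ε < L by linarith)).exists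
    filter_upwards [hK, (hsub k).eventually_const_lt (show -ε < 0 by linarith)] with N h1 h2
    have h3 : (L - ε) * cesaro (fun n => (Set.Iic K).indicator (fun _ => 1) (x n)) N
        ≤ cesaro (fun n => f k (x n)) N := by
      rw [← cesaro_const_mul]
      refine cesaro_mono (fun n => ?_) N
      by_cases h : x n ≤ K
      · rw [Set.indicator_of_mem (Set.mem_Iic.2 h), mul_one]
        exact hk.le.trans ((hf k).antitone h)
      · rw [Set.indicator_of_notMem (by simpa using h), mul_zero]
        exact (hf k).nonneg _
    have h4 : L - ε - ε * L ≤ cesaro (fun n => f k (x n)) N := by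
      rcases le_total (L - ε) 0 with h | h
      · have := cesaro_nonneg (fun n => (hf k).nonneg (x n)) N
        nlinarith
      · nlinarith [mul_le_mul_of_nonneg_left h1 h, mul_pos hε hε]
    linarith
  · intro a ha
    obtain ⟨k, hk⟩ := ((hlim 0).eventually_lt_const
      (show L < L + (a - L) / 2 by linarith)).exists
    filter_upwards [(hsub k).eventually_lt_const (show 0 < (a - L) / 2 by linarith),
      eventually_gt_atTop 0] with N h1 hN
    have h2 : cesaro (fun n => f k (x n)) N ≤ L + (a - L) / 2 := by
      rw [← cesaro_const (L + (a - L) / 2) hN]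
      refine cesaro_mono (fun n => ?_) N
      exact ((hf k).antitone (hx n)).trans hk.le
    linarith

/-! ### Mean idle time, balance of work, and tightness. -/

/-- The mean residual interarrival time after a delay `d`. -/
noncomputable def meanResidual (π : Measure (ℝ × ℝ)) (d : ℝ) : ℝ :=
  ∫ p, max 0 (p.1 - max 0 d) ∂π

lemma IsStableInput.integrable_residual {π : Measure (ℝ × ℝ)} (hπ : IsStableInput π) (d : ℝ) :
    Integrable (fun p : ℝ × ℝ => max 0 (p.1 - max 0 d)) π := by
  refine hπ.integrable_fst.mono' (by fun_prop) ?_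
  filter_upwards [hπ.nonneg] with p hp
  rw [Real.norm_eq_abs, abs_of_nonneg (le_max_left _ _)]
  exact max_le hp.1 (by linarith [le_max_left 0 d])

/-- This is the test function that detects escape of mass. The truncation `max 0 d` in its
definition keeps it bounded by the mean interarrival time at negative arguments too. -/
lemma IsStableInput.isDecay_meanResidual {π : Measure (ℝ × ℝ)} (hπ : IsStableInput π) :
    IsDecay (meanResidual π) (∫ p, p.1 ∂π) := by
  refine ⟨fun a b hab => ?_, fun x => integral_nonneg fun p => le_max_left _ _, fun x => ?_, ?_⟩
  · refine integral_mono (hπ.integrable_residual b) (hπ.integrable_residual a) fun p => ?_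
    simp only
    gcongr
  · refine integral_mono_ae (hπ.integrable_residual x) hπ.integrable_fst ?_
    filter_upwards [hπ.nonneg] with p hp
    exact max_le hp.1 (by linarith [le_max_left 0 x])
  · have h := tendsto_integral_filter_of_dominated_convergence (μ := π) (l := atTop)
      (F := fun (d : ℝ) p => max 0 (p.1 - max 0 d)) (f := fun _ => 0) (fun p => p.1)
      (Eventually.of_forall fun d => (hπ.integrable_residual d).aestronglyMeasurable)
      (Eventually.of_forall fun d => ?_) hπ.integrable_fst (ae_of_all _ fun p => ?_)
    · rw [integral_zero] at h
      exact h
    · filter_upwards [hπ.nonneg] with p hp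
      rw [Real.norm_eq_abs, abs_of_nonneg (le_max_left _ _)]
      exact max_le hp.1 (by linarith [le_max_left 0 d])
    · refine tendsto_const_nhds.congr' ?_
      filter_upwards [eventually_ge_atTop p.1] with d hd
      rw [max_eq_left]
      linarith [le_max_right 0 d]

lemma IsStableInput.integrable_min {π : Measure (ℝ × ℝ)} (hπ : IsStableInput π) (d : ℝ) :
    Integrable (fun p : ℝ × ℝ => min d p.1) π := by
  have := hπ.isProbabilityMeasure
  exact (integrable_const d).inf hπ.integrable_fst

lemma IsStableInput.meanResidual_eq {π : Measure (ℝ × ℝ)} (hπ : IsStableInput π) {d : ℝ}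
    (hd : 0 ≤ d) : meanResidual π d = ∫ p, p.1 ∂π - ∫ p, min d p.1 ∂π := by
  rw [← integral_sub hπ.integrable_fst (hπ.integrable_min d)]
  refine integral_congr_ae (ae_of_all _ fun p => ?_)
  simp only
  rw [max_eq_right hd]
  rcases le_total d p.1 with h | h
  · rw [min_eq_left h, max_eq_right (by linarith)]
  · rw [min_eq_right h, max_eq_left (by linarith)]
    ring

/-- A stationary law of the delay chain under which the work that arrives and the work that is
done between two arrivals have the same mean. -/
structure IsBalancedDelay (π : Measure (ℝ × ℝ)) (ν : Measure ℝ) : Prop where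
  isProbabilityMeasure : IsProbabilityMeasure ν
  stationary : IsStationaryDelay π ν
  integral_min : ∫ x, ∫ p, min x p.1 ∂π ∂ν = ∫ p, p.2 ∂π

/-- The pointwise identity (G - D)^+ = G - min(D, G) turns the balance of work into the mean idle
time E[G] - E[H], without any moment of the delay. -/
lemma IsBalancedDelay.integral_meanResidual {π : Measure (ℝ × ℝ)} (hπ : IsStableInput π)
    {ν : Measure ℝ} (hν : IsBalancedDelay π ν) :
    ∫ x, meanResidual π x ∂ν = ∫ p, p.1 ∂π - ∫ p, p.2 ∂π := by
  have := hν.isProbabilityMeasure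
  have hθ := hπ.isDecay_meanResidual
  have hae : ∀ᵐ x ∂ν, ∫ p, min x p.1 ∂π = ∫ p, p.1 ∂π - meanResidual π x := by
    filter_upwards [hν.stationary.ae_nonneg hπ] with x hx
    rw [hπ.meanResidual_eq hx]
    ring
  have h := hν.integral_min
  rw [integral_congr_ae hae, integral_sub (integrable_const _)
    (Integrable.of_bound hθ.measurable.aestronglyMeasurable _ (ae_of_all _ hθ.abs_le))] at h
  simp only [integral_const, probReal_univ, smul_eq_mul, one_mul] at h
  linarith

/-- Capping the interarrival time at `K` loses at most its mean excess over `K`, uniformly in `x`.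
The capped functional is bounded, as the martingale law requires. -/
lemma exists_integral_min_le {π : Measure (ℝ × ℝ)} (hπ : IsStableInput π) {ε : ℝ} (hε : 0 < ε) :
    ∃ K : ℕ, ∀ x, 0 ≤ x →
      ∫ p, min x p.1 ∂π ≤ ∫ p, min (max 0 x) (min (max 0 p.1) K) ∂π + ε := by
  have := hπ.isProbabilityMeasure
  obtain ⟨K, hK⟩ := ((hπ.isDecay_meanResidual.tendsto.comp
    tendsto_natCast_atTop_atTop).eventually_lt_const hε).exists
  refine ⟨K, fun x hx => ?_⟩
  have hi : Integrable (fun p : ℝ × ℝ => min (max 0 x) (min (max 0 p.1) K)) π := by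
    refine Integrable.of_bound (by fun_prop) K (ae_of_all _ fun p => ?_)
    rw [Real.norm_eq_abs, abs_of_nonneg (by positivity)]
    exact (min_le_right _ _).trans (min_le_right _ _)
  have h : ∫ p, min x p.1 ∂π
      ≤ ∫ p, (min (max 0 x) (min (max 0 p.1) K) + max 0 (p.1 - max 0 (K : ℝ))) ∂π := by
    refine integral_mono (hπ.integrable_min x) (hi.add (hπ.integrable_residual K)) fun p => ?_
    simp only
    rw [max_eq_right hx, max_eq_right (Nat.cast_nonneg K)]
    have h1 := le_max_left 0 (p.1 - (K : ℝ))
    have h2 := le_max_right 0 (p.1 - (K : ℝ))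
    have h3 := le_max_right 0 p.1
    rcases le_total (max 0 p.1) K with h | h
    · rw [min_eq_left h]
      linarith [min_le_min_left x h3]
    · rw [min_eq_right h]
      rcases le_total x K with h' | h'
      · rw [min_eq_left h']
        linarith [min_le_left x p.1]
      · rw [min_eq_right h']
        linarith [min_le_right x p.1]
  rw [integral_add hi (hπ.integrable_residual K)] at h
  simp only [Function.comp_apply, meanResidual] at hK
  linarith

namespace IsIIDInput

variable {Ω : Type*} [MeasurableSpace Ω] {P : Measure Ω} [IsProbabilityMeasure P]
  {π : Measure (ℝ × ℝ)} {ξ : ℕ → Ω → ℝ × ℝ}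

/-- The step identity min(D_n, G) = H - (D_{n+1} - D_n) telescopes. As the delay starts at 0 and
stays nonnegative, the work done averages at most E[H], which leaves at least E[G] - E[H] of
residual time. -/
lemma eventually_le_cesaro_meanResidual (h : IsIIDInput P π ξ) (hπ : IsStableInput π) :
    ∀ᵐ ω ∂P, ∀ ε > 0, ∀ᶠ N in atTop, (∫ p, p.1 ∂π - ∫ p, p.2 ∂π) - ε
      ≤ cesaro (fun n => meanResidual π (lindley (fun i => ξ i ω) 0 n)) N := by
  have hK : ∀ᵐ ω ∂P, ∀ K : ℕ, Tendsto (fun N =>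
      cesaro (fun n => min (max 0 (lindley (fun i => ξ i ω) 0 n)) (min (max 0 (ξ n ω).1) K)) N
        - cesaro (fun n => ∫ p, min (max 0 (lindley (fun i => ξ i ω) 0 n))
            (min (max 0 p.1) K) ∂π) N) atTop (𝓝 0) := by
    rw [ae_all_iff]
    intro K
    refine h.tendsto_cesaro_sub 0
      (F := fun q => min (max 0 q.1) (min (max 0 q.2.1) K)) (by fun_prop) (C := K) fun q => ?_
    rw [abs_of_nonneg (by positivity)]
    exact (min_le_right _ _).trans (min_le_right _ _)
  filter_upwards [hK, h.ae_forall hπ.nonneg, h.tendsto_cesaro_input measurable_snd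
    hπ.integrable_snd] with ω hK hnn hH ε hε
  obtain ⟨K, hKε⟩ := exists_integral_min_le hπ (show 0 < ε / 3 by linarith)
  set X : ℕ → ℝ := lindley (fun i => ξ i ω) 0 with hX
  have hX0 : ∀ n, 0 ≤ X n := lindley_nonneg (fun n => (hnn n).2) le_rfl
  filter_upwards [(hK K).eventually_const_lt (show -(ε / 3) < 0 by linarith),
    hH.eventually_lt_const (show ∫ p, p.2 ∂π < ∫ p, p.2 ∂π + ε / 3 by linarith),
    eventually_gt_atTop 0] with N h1 h2 hN
  have h3 : cesaro (fun n => min (max 0 (X n)) (min (max 0 (ξ n ω).1) K)) N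
      ≤ cesaro (fun n => (ξ n ω).2) N := by
    have hstep : ∀ n, min (max 0 (X n)) (min (max 0 (ξ n ω).1) K)
        ≤ (ξ n ω).2 - (X (n + 1) - X n) := by
      intro n
      simp only [hX, lindley, lindleyStep]
      rw [max_eq_right (hX0 n), max_eq_right (hnn n).1]
      refine (min_le_min_left _ (min_le_left _ _)).trans ?_
      rcases le_total 0 (lindley (fun i => ξ i ω) 0 n - (ξ n ω).1) with h | h
      · rw [max_eq_right h]
        linarith [min_le_right (X n) (ξ n ω).1]
      · rw [max_eq_left h]
        linarith [min_le_left (X n) (ξ n ω).1]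
    refine (cesaro_mono hstep N).trans ?_
    rw [cesaro_sub]
    have : 0 ≤ cesaro (fun n => X (n + 1) - X n) N := by
      rw [cesaro, Finset.sum_range_sub]
      have h0 : X 0 = 0 := rfl
      rw [h0, sub_zero]
      exact div_nonneg (hX0 N) N.cast_nonneg
    linarith
  have h4 : ∫ p, p.1 ∂π - ε / 3 - cesaro (fun n => ∫ p, min (max 0 (X n))
      (min (max 0 p.1) K) ∂π) N ≤ cesaro (fun n => meanResidual π (X n)) N := by
    rw [← cesaro_const (∫ p, p.1 ∂π - ε / 3) hN, ← cesaro_sub]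
    refine cesaro_mono (fun n => ?_) N
    rw [hπ.meanResidual_eq (hX0 n)]
    linarith [hKε (X n) (hX0 n)]
  linarith

/-- The ergodic theorem for bounded nonincreasing functions of the delay. -/
theorem tendsto_cesaro_lindley (h : IsIIDInput P π ξ) (hπ : IsStableInput π) {ν : Measure ℝ}
    (hν : IsBalancedDelay π ν) {f : ℝ → ℝ} {C : ℝ} (hf : IsDecay f C) :
    ∀ᵐ ω ∂P, Tendsto (cesaro fun n => f (lindley (fun i => ξ i ω) 0 n)) atTop
      (𝓝 (∫ x, f x ∂ν)) := by
  have := hν.isProbabilityMeasure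
  have hθ := hπ.isDecay_meanResidual
  have hm : 0 < ∫ p, p.1 ∂π - ∫ p, p.2 ∂π := sub_pos.2 hπ.lt
  filter_upwards [h.eventually_le_cesaro_meanResidual hπ, h.tendsto_cesaro_iterate hπ hf 0,
    h.tendsto_cesaro_iterate hπ hθ 0, h.ae_forall hπ.nonneg] with ω h1 h2 h3 hnn
  have hX0 : ∀ n, 0 ≤ lindley (fun i => ξ i ω) 0 n := lindley_nonneg (fun n => (hnn n).2) le_rfl
  refine tendsto_cesaro_of_iterates (f := fun k => (lindleyOp π)^[k] f)
    (integral_nonneg hf.nonneg) hX0 (isDecay_iterate_lindleyOp hπ hf)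
    (h.tendsto_iterate_lindleyOp hπ hν.stationary hf) h2 fun ε hε => ?_
  -- The balance of `ν` makes the limit of the iterates at 0 equal to the lower bound for the
  -- averages, so no mass can escape.
  refine exists_cesaro_indicator_ge hm hX0 (isDecay_iterate_lindleyOp hπ hθ) ?_ ?_ hε
  · have := h.tendsto_iterate_lindleyOp hπ hν.stationary hθ 0
    rwa [hν.integral_meanResidual hπ] at this
  · intro k η hη
    filter_upwards [h1 (η / 2) (by linarith),
      (h3 k).eventually_lt_const (show 0 < η / 2 by linarith)] with N h4 h5
    linarith

end IsIIDInput

/-! ### Existence of a stationary law -/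

/-- The delay of a packet served just before `ξ n`, …, `ξ (n + k - 1)` are read backwards in
time, from an empty queue. -/
def lindleyBack (ξ : ℕ → ℝ × ℝ) : ℕ → ℕ → ℝ
  | 0, _ => 0
  | k + 1, n => lindleyStep (lindleyBack ξ k (n + 1)) (ξ n)

/-- Starting one packet further in the past replaces the empty queue by a nonnegative delay. This is
the monotonicity in Loynes' construction. -/
lemma lindleyBack_le_succ {ξ : ℕ → ℝ × ℝ} (hξ : ∀ n, 0 ≤ (ξ n).2) (k n : ℕ) :
    lindleyBack ξ k n ≤ lindleyBack ξ (k + 1) n := by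
  induction k generalizing n with
  | zero => exact lindleyStep_nonneg _ (hξ n)
  | succ k ih => exact lindleyStep_mono (ξ n) (ih (n + 1))

/-- A busy step passes the bound from `n + 1` to `n`, because the partial sum absorbs the step; an
idle step leaves the service time, which the second hypothesis covers. -/
lemma lindleyBack_add_sum_le {ξ : ℕ → ℝ × ℝ} {C : ℝ}
    (hC : ∀ n, ∑ i ∈ Finset.range n, ((ξ i).2 - (ξ i).1) ≤ C)
    (hC' : ∀ n, ∑ i ∈ Finset.range n, ((ξ i).2 - (ξ i).1) + (ξ n).2 ≤ C) (k n : ℕ) :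
    lindleyBack ξ k n + ∑ i ∈ Finset.range n, ((ξ i).2 - (ξ i).1) ≤ C := by
  induction k generalizing n with
  | zero => simpa [lindleyBack] using hC n
  | succ k ih =>
    have h1 := ih (n + 1)
    have h2 := hC' n
    rw [Finset.sum_range_succ] at h1
    simp only [lindleyBack, lindleyStep]
    rcases le_total 0 (lindleyBack ξ k (n + 1) - (ξ n).1) with h | h
    · rw [max_eq_right h]
      linarith
    · rw [max_eq_left h]
      linarith

lemma bddAbove_lindleyBack {ξ : ℕ → ℝ × ℝ} {a b : ℝ} (hba : b < a)
    (ha : Tendsto (cesaro fun n => (ξ n).1) atTop (𝓝 a))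
    (hb : Tendsto (cesaro fun n => (ξ n).2) atTop (𝓝 b)) (n : ℕ) :
    BddAbove (Set.range fun k => lindleyBack ξ k n) := by
  have hS : Tendsto (fun n : ℕ => (∑ i ∈ Finset.range n, ((ξ i).2 - (ξ i).1)) / n) atTop
      (𝓝 (b - a)) := by
    refine (hb.sub ha).congr fun n => ?_
    rw [← cesaro_sub]
    rfl
  have hS' : Tendsto (fun n : ℕ => (∑ i ∈ Finset.range n, ((ξ i).2 - (ξ i).1) + (ξ n).2) / n) atTop
      (𝓝 (b - a)) := by
    have := hS.add (tendsto_div_natCast_of_average hb)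
    rw [add_zero] at this
    exact this.congr fun n => (add_div _ _ _).symm
  -- Spending the whole margin a - b makes the slope zero, so the affine bound is a constant.
  obtain ⟨C, hC⟩ := exists_le_affine_of_tendsto_div (show 0 < a - b by linarith) hS
  obtain ⟨C', hC'⟩ := exists_le_affine_of_tendsto_div (show 0 < a - b by linarith) hS'
  simp only [show b - a + (a - b) = 0 by ring, zero_mul, zero_add] at hC hC'
  refine ⟨max C C' - ∑ i ∈ Finset.range n, ((ξ i).2 - (ξ i).1), ?_⟩
  rintro _ ⟨k, rfl⟩
  have := lindleyBack_add_sum_le (C := max C C') (fun n => (hC n).trans (le_max_left _ _))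
    (fun n => (hC' n).trans (le_max_right _ _)) k n
  simp only
  linarith

/-- Read backwards, the delay at `n + 1` uses only inputs of index at least `n + 1` and is therefore
independent of `ξ n`, the input applied next. -/
lemma measurable_lindleyBack_future {Ω : Type*} (ξ : ℕ → Ω → ℝ × ℝ) (k n : ℕ) :
    Measurable[⨆ i ∈ Set.Ici n, MeasurableSpace.comap (ξ i) inferInstance]
      (fun ω => lindleyBack (fun i => ξ i ω) k n) := by
  induction k generalizing n with
  | zero => exact measurable_const
  | succ k ih =>
    have h1 : (⨆ i ∈ Set.Ici (n + 1), MeasurableSpace.comap (ξ i) inferInstance)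
        ≤ ⨆ i ∈ Set.Ici n, MeasurableSpace.comap (ξ i) inferInstance :=
      biSup_mono fun i hi => Set.mem_Ici.2 ((Nat.le_succ n).trans hi)
    exact measurable_lindleyStep.comp (((ih (n + 1)).mono h1 le_rfl).prodMk
      (measurable_iSup_comap_of_mem (Set.mem_Ici.2 le_rfl)))

namespace IsIIDInput

variable {Ω : Type*} [MeasurableSpace Ω] {P : Measure Ω} {π : Measure (ℝ × ℝ)}
  {ξ : ℕ → Ω → ℝ × ℝ}

lemma measurable_lindleyBack (h : IsIIDInput P π ξ) (k n : ℕ) :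
    Measurable (fun ω => lindleyBack (fun i => ξ i ω) k n) :=
  (measurable_lindleyBack_future ξ k n).mono (h.past_le _) le_rfl

lemma map_lindleyBack_succ [IsProbabilityMeasure P] (h : IsIIDInput P π ξ) (k n : ℕ) :
    P.map (fun ω => lindleyBack (fun i => ξ i ω) (k + 1) n)
      = ((P.map fun ω => lindleyBack (fun i => ξ i ω) k (n + 1)).prod π).map
          (fun q => lindleyStep q.1 q.2) := by
  rw [← h.map_prodMk (A := Set.Ici (n + 1)) (n := n) (by simp)
    (measurable_lindleyBack_future ξ k (n + 1)), Measure.map_map measurable_lindleyStep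
      ((h.measurable_lindleyBack k (n + 1)).prodMk (h.measurable n))]
  rfl

lemma map_lindleyBack_eq [IsProbabilityMeasure P] (h : IsIIDInput P π ξ) (k m n : ℕ) :
    P.map (fun ω => lindleyBack (fun i => ξ i ω) k m)
      = P.map (fun ω => lindleyBack (fun i => ξ i ω) k n) := by
  induction k generalizing m n with
  | zero => rfl
  | succ k ih => rw [h.map_lindleyBack_succ, h.map_lindleyBack_succ, ih (m + 1) (n + 1)]

/-- The delay chain of a stable input has a stationary law. -/
theorem exists_isStationaryDelay [IsProbabilityMeasure P] (h : IsIIDInput P π ξ)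
    (hπ : IsStableInput π) : ∃ ν : Measure ℝ, IsProbabilityMeasure ν ∧ IsStationaryDelay π ν := by
  have := hπ.isProbabilityMeasure
  -- Loynes' variable: the delay in a queue that has been running forever, the increasing limit of
  -- those started empty in the remote past.
  set V : Ω → ℝ := fun ω => ⨆ k, lindleyBack (fun i => ξ i ω) k 0 with hV
  have hVm : Measurable V := Measurable.iSup fun k => h.measurable_lindleyBack k 0
  have hVlim : ∀ᵐ ω ∂P, Tendsto (fun k => lindleyBack (fun i => ξ i ω) k 0) atTop (𝓝 (V ω)) := by
    filter_upwards [h.ae_forall hπ.nonneg, h.tendsto_cesaro_input measurable_fst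
      hπ.integrable_fst, h.tendsto_cesaro_input measurable_snd hπ.integrable_snd] with ω h0 h1 h2
    exact tendsto_atTop_ciSup (monotone_nat_of_le_succ fun k =>
      lindleyBack_le_succ (fun n => (h0 n).2) k 0) (bddAbove_lindleyBack hπ.lt h1 h2 0)
  have hprob : IsProbabilityMeasure (P.map V) := Measure.isProbabilityMeasure_map hVm.aemeasurable
  refine ⟨P.map V, hprob, ?_⟩
  have hlim : ∀ g : ℝ → ℝ, Continuous g → ∀ C, (∀ x, |g x| ≤ C) →
      Tendsto (fun k => ∫ ω, g (lindleyBack (fun i => ξ i ω) k 0) ∂P) atTop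
        (𝓝 (∫ ω, g (V ω) ∂P)) := by
    intro g hg C hC
    refine tendsto_integral_of_dominated_convergence (fun _ => C)
      (fun k => (hg.measurable.comp (h.measurable_lindleyBack k 0)).aestronglyMeasurable)
      (integrable_const _) (fun k => ae_of_all _ fun ω => hC _) ?_
    filter_upwards [hVlim] with ω hω
    exact (hg.tendsto _).comp hω
  have : IsProbabilityMeasure (((P.map V).prod π).map fun q => lindleyStep q.1 q.2) :=
    Measure.isProbabilityMeasure_map measurable_lindleyStep.aemeasurable
  refine ext_of_forall_integral_eq_of_IsFiniteMeasure fun f => ?_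
  have hfC : ∀ x, |f x| ≤ ‖f‖ := fun x => f.norm_coe_le_norm x
  have hfs : Measurable fun q : ℝ × (ℝ × ℝ) => f (lindleyStep q.1 q.2) :=
    f.continuous.measurable.comp measurable_lindleyStep
  -- Continuity of the step in the delay makes the operator preserve bounded continuous functions,
  -- so the limit passes through it.
  have hTc : Continuous (lindleyOp π f) := by
    refine continuous_of_dominated (bound := fun _ => ‖f‖)
      (fun x => (hfs.comp measurable_prodMk_left).aestronglyMeasurable)
      (fun x => ae_of_all _ fun p => hfC _) (integrable_const _)
      (ae_of_all _ fun p => f.continuous.comp (continuous_lindleyStep p))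
  have hTC : ∀ x, |lindleyOp π f x| ≤ ‖f‖ := fun x => by
    have := norm_integral_le_of_norm_le_const (μ := π) (f := fun p => f (lindleyStep x p))
      (ae_of_all _ fun p => hfC _)
    simpa [lindleyOp] using this
  have hpush : ∀ ρ : Measure ℝ, IsProbabilityMeasure ρ →
      ∫ x, f x ∂((ρ.prod π).map fun q => lindleyStep q.1 q.2) = ∫ x, lindleyOp π f x ∂ρ := by
    intro ρ _
    rw [integral_map measurable_lindleyStep.aemeasurable
      f.continuous.measurable.aestronglyMeasurable,
      integral_prod _ (Integrable.of_bound hfs.aestronglyMeasurable _ (ae_of_all _ fun q => hfC _))]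
    rfl
  rw [hpush _ hprob, integral_map hVm.aemeasurable hTc.measurable.aestronglyMeasurable,
    integral_map hVm.aemeasurable f.continuous.measurable.aestronglyMeasurable]
  -- The mean of T f at depth k is the mean of f at depth k + 1, since the law at a given depth does
  -- not depend on the index. The two limits express stationarity of `V`.
  refine tendsto_nhds_unique (hlim _ hTc _ hTC) ?_
  have h1 := (hlim f f.continuous _ hfC).comp (tendsto_add_atTop_nat 1)
  refine h1.congr fun k => ?_
  have hBm := h.measurable_lindleyBack
  simp only [Function.comp_apply]
  rw [← integral_map (φ := fun ω => lindleyBack (fun i => ξ i ω) (k + 1) 0)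
      (hBm _ _).aemeasurable f.continuous.measurable.aestronglyMeasurable,
    ← integral_map (φ := fun ω => lindleyBack (fun i => ξ i ω) k 0) (hBm _ _).aemeasurable
      hTc.measurable.aestronglyMeasurable, h.map_lindleyBack_succ, h.map_lindleyBack_eq k 0 (0 + 1),
    hpush _ (Measure.isProbabilityMeasure_map (hBm _ _).aemeasurable)]

end IsIIDInput

/-! ### Convergence of empirical distribution functions -/

/-- Monotone random functions that converge to a distribution function almost surely at each
point almost surely do so at all points. -/
lemma ae_forall_tendsto_of_monotone {Ω ι : Type*} [MeasurableSpace Ω] {P : Measure Ω}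
    {l : Filter ι} {Φ : ι → Ω → ℝ → ℝ} {ν : Measure ℝ} [IsProbabilityMeasure ν]
    (hmono : ∀ᵐ ω ∂P, ∀ᶠ i in l, Monotone (Φ i ω))
    (h : ∀ x, ∀ᵐ ω ∂P, Tendsto (fun i => Φ i ω x) l (𝓝 (ν.real (Set.Iic x)))) :
    ∀ᵐ ω ∂P, ∀ x, Tendsto (fun i => Φ i ω x) l (𝓝 (ν.real (Set.Iic x))) := by
  simp only [← cdf_eq_real] at h ⊢
  have hS : Set.Countable {x | ¬ ContinuousAt (cdf ν) x} :=
    (monotone_cdf ν).countable_not_continuousAt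
  -- Only countably many points are jumps of the limit, and these are treated individually. At any
  -- other point monotonicity squeezes the values between rational points.
  have hae := (ae_ball_iff hS).2 fun x _ => h x
  filter_upwards [hmono, hae, ae_all_iff.2 fun q : ℚ => h q] with ω hm hat hrat x
  by_cases hx : ContinuousAt (cdf ν) x
  · rw [tendsto_order]
    constructor
    · intro a ha
      obtain ⟨c, hc, hca⟩ := (mem_nhdsLE_iff_exists_Ioc_subset).1
        (mem_nhdsWithin_of_mem_nhds (hx.eventually_const_lt ha))
      obtain ⟨q, hq1, hq2⟩ := exists_rat_btwn (Set.mem_Iio.1 hc)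
      filter_upwards [hm, (hrat q).eventually_const_lt (hca ⟨hq1, hq2.le⟩)] with i h1 h2
      exact h2.trans_le (h1 hq2.le)
    · intro a ha
      obtain ⟨c, hc, hca⟩ := (mem_nhdsGE_iff_exists_Ico_subset).1
        (mem_nhdsWithin_of_mem_nhds (hx.eventually_lt_const ha))
      obtain ⟨q, hq1, hq2⟩ := exists_rat_btwn (Set.mem_Ioi.1 hc)
      filter_upwards [hm, (hrat q).eventually_lt_const (hca ⟨hq1.le, hq2⟩)] with i h1 h2
      exact (h1 hq1.le).trans_lt h2
  · exact hat x hx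

/-- A random variable has the law `ν` when the probabilities of its half-lines are the limits of
the expectations of converging frequencies. -/
lemma hasLaw_of_tendsto_frequency {Ω ι : Type*} [MeasurableSpace Ω] {P : Measure Ω}
    [IsProbabilityMeasure P] {l : Filter ι} [l.IsCountablyGenerated] [l.NeBot]
    {Φ : ι → Ω → ℝ → ℝ} {ν : Measure ℝ} [IsProbabilityMeasure ν] {Y : Ω → ℝ}
    (hY : AEMeasurable Y P)
    (hΦ : ∀ x, ∀ᶠ i in l, AEStronglyMeasurable (fun ω => Φ i ω x) P)
    (hbound : ∀ x, ∀ᶠ i in l, ∀ ω, |Φ i ω x| ≤ 1)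
    (hexp : ∀ x, ∀ᶠ i in l, ∫ ω, Φ i ω x ∂P = P.real {ω | Y ω ≤ x})
    (h : ∀ᵐ ω ∂P, ∀ x, Tendsto (fun i => Φ i ω x) l (𝓝 (ν.real (Set.Iic x)))) :
    HasLaw Y ν P := by
  refine ⟨hY, ?_⟩
  have := Measure.isProbabilityMeasure_map hY
  refine Measure.ext_of_Iic _ _ fun x => ?_
  have hlim := tendsto_integral_filter_of_dominated_convergence (μ := P) (l := l)
    (F := fun i ω => Φ i ω x) (f := fun _ => ν.real (Set.Iic x)) (fun _ => 1) (hΦ x)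
    ((hbound x).mono fun i hi => ae_of_all _ hi) (integrable_const _)
    (h.mono fun ω hω => hω x)
  rw [integral_const, probReal_univ, one_smul] at hlim
  have heq : P.real {ω | Y ω ≤ x} = ν.real (Set.Iic x) :=
    -- The expected frequency is eventually the constant probability, and by bounded convergence it
    -- tends to the limiting distribution function.
    tendsto_nhds_unique (tendsto_const_nhds.congr' ((hexp x).mono fun i hi => hi.symm)) hlim
  rw [Measure.map_apply_of_aemeasurable hY measurableSet_Iic]
  exact (measureReal_eq_measureReal_iff).1 heq

/-! ### The input of the queue -/

lemma isDecay_indicator_Iic (x : ℝ) : IsDecay ((Set.Iic x).indicator fun _ => 1) 1 := by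
  refine ⟨fun a b hab => ?_, fun y => Set.indicator_nonneg (fun _ _ => zero_le_one) y,
    fun y => Set.indicator_le_self' (fun _ _ => zero_le_one) y, ?_⟩
  · by_cases hb : b ≤ x
    · rw [Set.indicator_of_mem (Set.mem_Iic.2 hb), Set.indicator_of_mem (Set.mem_Iic.2 (hab.trans hb))]
    · rw [Set.indicator_of_notMem (by simpa using hb)]
      exact Set.indicator_nonneg (fun _ _ => zero_le_one) a
  · refine tendsto_const_nhds.congr' ?_
    filter_upwards [eventually_gt_atTop x] with y hy
    rw [Set.indicator_of_notMem (by simpa using hy)]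

namespace FCFSQueue

variable {Ω : Type*} [MeasurableSpace Ω] {P : Measure Ω} {νG νH : Measure ℝ}

/-- The pairs of interarrival and service times. -/
def input (Q : FCFSQueue P νG νH) (n : ℕ) (ω : Ω) : ℝ × ℝ := (Q.interarrival n ω, Q.service n ω)

/-- The independence of the single interleaved family is regrouped: a set of packet numbers
corresponds to the block of both kinds of times with those numbers, and disjoint sets give
independent blocks. -/
lemma isIIDInput [IsProbabilityMeasure P] (Q : FCFSQueue P νG νH) :
    IsIIDInput P (νG.prod νH) Q.input := by
  have hm : ∀ i, Measurable (Sum.elim Q.interarrival Q.service i) := by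
    rintro (i | i)
    · exact Q.measurable_interarrival i
    · exact Q.measurable_service i
  refine ⟨fun n => (Q.measurable_interarrival n).prodMk (Q.measurable_service n), fun n => ?_,
    fun A n hn => ?_⟩
  · have h : IndepFun (Q.interarrival n) (Q.service n) P :=
      Q.indep.indepFun (i := Sum.inl n) (j := Sum.inr n) (by simp)
    have h' := (indepFun_iff_map_prod_eq_prod_map_map
      (Q.measurable_interarrival n).aemeasurable (Q.measurable_service n).aemeasurable).1 h
    rwa [(Q.hasLaw_interarrival n).map_eq, (Q.hasLaw_service n).map_eq] at h'
  · set S : Set ℕ → Set (ℕ ⊕ ℕ) := fun B => {i | Sum.elim id id i ∈ B} with hS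
    have hdisj : Disjoint (S A) (S {n}) := by
      rw [Set.disjoint_left]
      intro i hi hi'
      simp only [hS, Set.mem_ofPred_eq, Set.mem_singleton_iff] at hi hi'
      exact hn (hi' ▸ hi)
    have hind := indep_iSup_of_disjoint (fun i => (hm i).comap_le) Q.indep.iIndep hdisj
    have hle : ∀ (B : Set ℕ) (i : ℕ), i ∈ B →
        MeasurableSpace.comap (Q.input i) inferInstance
          ≤ ⨆ j ∈ S B, MeasurableSpace.comap (Sum.elim Q.interarrival Q.service j)
              inferInstance := by
      intro B i hi
      refine Measurable.comap_le ?_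
      refine Measurable.prodMk ?_ ?_
      · exact measurable_iSup_comap_of_mem (ξ := Q.interarrival) (A := {i}) (n := i) rfl |>.mono
          (iSup₂_le fun j hj => by
            rw [Set.mem_singleton_iff] at hj
            subst hj
            exact le_iSup₂_of_le (Sum.inl j) hi le_rfl) le_rfl
      · exact measurable_iSup_comap_of_mem (ξ := Q.service) (A := {i}) (n := i) rfl |>.mono
          (iSup₂_le fun j hj => by
            rw [Set.mem_singleton_iff] at hj
            subst hj
            exact le_iSup₂_of_le (Sum.inr j) hi le_rfl) le_rfl
    exact indep_of_indep_of_le_left (indep_of_indep_of_le_right hind (hle {n} n rfl))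
      (iSup₂_le fun i hi => hle A i hi)

lemma isProbabilityMeasure_interarrival [IsProbabilityMeasure P] (Q : FCFSQueue P νG νH) :
    IsProbabilityMeasure νG := by
  rw [← (Q.hasLaw_interarrival 0).map_eq]
  exact Measure.isProbabilityMeasure_map (Q.measurable_interarrival 0).aemeasurable

lemma isProbabilityMeasure_service [IsProbabilityMeasure P] (Q : FCFSQueue P νG νH) :
    IsProbabilityMeasure νH := by
  rw [← (Q.hasLaw_service 0).map_eq]
  exact Measure.isProbabilityMeasure_map (Q.measurable_service 0).aemeasurable

lemma ae_nonneg_interarrival (Q : FCFSQueue P νG νH) : ∀ᵐ x ∂νG, 0 ≤ x := by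
  rw [← (Q.hasLaw_interarrival 0).map_eq,
    ae_map_iff (Q.measurable_interarrival 0).aemeasurable measurableSet_Ici]
  exact Q.interarrival_nonneg 0

lemma ae_nonneg_service (Q : FCFSQueue P νG νH) : ∀ᵐ x ∂νH, 0 ≤ x := by
  rw [← (Q.hasLaw_service 0).map_eq,
    ae_map_iff (Q.measurable_service 0).aemeasurable measurableSet_Ici]
  exact Q.service_nonneg 0

lemma isStableInput [IsProbabilityMeasure P] (Q : FCFSQueue P νG νH)
    (hG : Integrable (fun x : ℝ => x) νG) (hH : Integrable (fun x : ℝ => x) νH)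
    (hlt : ∫ x, x ∂νH < ∫ x, x ∂νG) : IsStableInput (νG.prod νH) := by
  have := Q.isProbabilityMeasure_interarrival
  have := Q.isProbabilityMeasure_service
  refine ⟨inferInstance, ?_, hG.comp_fst νH, hH.comp_snd νG, ?_⟩
  · filter_upwards [Measure.quasiMeasurePreserving_fst.ae Q.ae_nonneg_interarrival,
      Measure.quasiMeasurePreserving_snd.ae Q.ae_nonneg_service] with p h1 h2 using ⟨h1, h2⟩
  · rw [integral_fun_fst (fun x : ℝ => x), integral_fun_snd (fun x : ℝ => x)]
    simpa using hlt

lemma delay_succ (Q : FCFSQueue P νG νH) (n : ℕ) (ω : Ω) :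
    Q.delay (n + 1) ω = lindleyStep (Q.delay n ω) (Q.input n ω) := by
  simp only [lindleyStep, input, delay, departure, arrival]
  rcases le_total (Q.arrival n ω + Q.interarrival n ω) (Q.departure n ω) with h | h
  · rw [max_eq_right h, max_eq_right (by linarith)]
    ring
  · rw [max_eq_left h, max_eq_left (by linarith)]
    ring

lemma delay_eq (Q : FCFSQueue P νG νH) (n : ℕ) (ω : Ω) :
    Q.delay n ω = lindley (fun i => Q.input i ω) (Q.delay 0 ω) n := by
  induction n with
  | zero => rfl
  | succ n ih => rw [delay_succ, ih, lindley]

lemma measurable_arrival (Q : FCFSQueue P νG νH) (n : ℕ) : Measurable (Q.arrival n) := by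
  induction n with
  | zero => exact Q.measurable_arrival₀
  | succ n ih => exact ih.add (Q.measurable_interarrival n)

lemma measurable_departure (Q : FCFSQueue P νG νH) (n : ℕ) : Measurable (Q.departure n) := by
  induction n with
  | zero => exact Q.measurable_departure₀
  | succ n ih => exact ((Q.measurable_arrival (n + 1)).max ih).add (Q.measurable_service n)

lemma measurable_delay (Q : FCFSQueue P νG νH) (n : ℕ) : Measurable (Q.delay n) :=
  (Q.measurable_departure n).sub (Q.measurable_arrival n)

/-- The averages of a functional of the delay and of the next input do not depend on the initial
delay. -/
lemma ae_cesaro_congr [IsProbabilityMeasure P] (Q : FCFSQueue P νG νH)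
    (hπ : IsStableInput (νG.prod νH)) {F : ℝ → ℝ × ℝ → ℝ} {L : ℝ}
    (h : ∀ᵐ ω ∂P, Tendsto (cesaro fun n =>
      F (lindley (fun i => Q.input i ω) 0 n) (Q.input n ω)) atTop (𝓝 L)) :
    ∀ᵐ ω ∂P, Tendsto (cesaro fun n => F (Q.delay n ω) (Q.input n ω)) atTop (𝓝 L) := by
  filter_upwards [h, Q.isIIDInput.ae_coalesce hπ] with ω h1 h2
  refine tendsto_average_congr ?_ h1
  filter_upwards [h2 0 (Q.delay 0 ω)] with n hn
  rw [hn, ← Q.delay_eq]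

lemma tendsto_cesaro_delay [IsProbabilityMeasure P] (Q : FCFSQueue P νG νH)
    (hπ : IsStableInput (νG.prod νH)) {ν : Measure ℝ} (hν : IsBalancedDelay (νG.prod νH) ν)
    {f : ℝ → ℝ} {C : ℝ} (hf : IsDecay f C) :
    ∀ᵐ ω ∂P, Tendsto (cesaro fun n => f (Q.delay n ω)) atTop (𝓝 (∫ x, f x ∂ν)) :=
  Q.ae_cesaro_congr hπ (F := fun d _ => f d) (Q.isIIDInput.tendsto_cesaro_lindley hπ hν hf)

/-- The balanced stationary law is the law of the stationary delay. -/
theorem isDelayLaw [IsProbabilityMeasure P] (Q : FCFSQueue P νG νH)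
    (hπ : IsStableInput (νG.prod νH)) {ν : Measure ℝ} (hν : IsBalancedDelay (νG.prod νH) ν) :
    Q.IsDelayLaw ν := by
  have hprob := hν.isProbabilityMeasure
  have hform : ∀ ω (x : ℝ) (N : ℕ), (1 / (N : ℝ)) * ∑ n ∈ Finset.Icc 1 N,
      Set.indicator {m : ℕ | Q.delay m ω ≤ x} (fun _ => (1 : ℝ)) n
      = cesaro (fun n => (Set.Iic x).indicator (fun _ => 1) (Q.delay (n + 1) ω)) N := by
    intro ω x N
    rw [cesaro, one_div, inv_mul_eq_div, Finset.range_eq_Ico, ← Finset.Ico_add_one_right_eq_Icc,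
      ← Finset.sum_Ico_add' (fun n => Set.indicator {m : ℕ | Q.delay m ω ≤ x}
        (fun _ => (1 : ℝ)) n) 0 N 1]
    rfl
  have hfreq : ∀ᵐ ω ∂P, ∀ x : ℝ, Tendsto (fun N : ℕ =>
      cesaro (fun n => (Set.Iic x).indicator (fun _ => 1) (Q.delay (n + 1) ω)) N)
      atTop (𝓝 (ν.real (Set.Iic x))) := by
    refine ae_forall_tendsto_of_monotone (Φ := fun N ω x =>
      cesaro (fun n => (Set.Iic x).indicator (fun _ => 1) (Q.delay (n + 1) ω)) N)
      (ae_of_all _ fun ω => Eventually.of_forall fun N x y hxy => ?_) fun x => ?_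
    · exact cesaro_mono (fun n => Set.indicator_le_indicator_of_subset
        (Set.Iic_subset_Iic.2 hxy) (fun _ => zero_le_one) _) N
    · have hx := isDecay_indicator_Iic x
      filter_upwards [Q.tendsto_cesaro_delay hπ hν hx] with ω hω
      rw [integral_indicator_const _ measurableSet_Iic, smul_eq_mul, mul_one] at hω
      -- The frequencies count the packets from 1 on, the ergodic theorem from 0 on.
      have := hω.add (tendsto_cesaro_shift
        (u := fun n => (Set.Iic x).indicator (fun _ => 1) (Q.delay n ω)) fun n => hx.abs_le _)
      rw [add_zero] at this
      exact this.congr fun N => by ring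
  refine ⟨hprob, hν.stationary.ae_nonneg hπ, ?_, fun hid n => ?_⟩
  · filter_upwards [hfreq] with ω hω x
    simp_rw [hform]
    exact hω x
  · have hm : ∀ x n, Measurable fun ω =>
        (Set.Iic x).indicator (fun _ => (1 : ℝ)) (Q.delay n ω) := fun x n =>
      (isDecay_indicator_Iic x).measurable.comp (Q.measurable_delay n)
    refine hasLaw_of_tendsto_frequency (l := atTop) (Q.measurable_delay n).aemeasurable
      (fun x => Eventually.of_forall fun N => ?_) (fun x => ?_) (fun x => ?_) hfreq
    · simp only [cesaro]
      exact ((Finset.measurable_fun_sum _ fun m _ => hm x (m + 1)).div_const _).aestronglyMeasurable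
    · filter_upwards [eventually_gt_atTop 0] with N hN ω
      have hx := isDecay_indicator_Iic x
      rw [abs_of_nonneg (cesaro_nonneg (fun n => hx.nonneg _) N)]
      exact (cesaro_mono (fun n => hx.le _) N).trans (cesaro_const 1 hN).le
    · filter_upwards [eventually_gt_atTop 0] with N hN
      have hi : ∀ m, Integrable (fun ω =>
          (Set.Iic x).indicator (fun _ => (1 : ℝ)) (Q.delay m ω)) P := fun m =>
        Integrable.of_bound (hm x m).aestronglyMeasurable 1
          (ae_of_all _ fun ω => (isDecay_indicator_Iic x).abs_le _)
      have heq : ∀ m, ∫ ω, (Set.Iic x).indicator (fun _ => (1 : ℝ)) (Q.delay m ω) ∂P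
          = P.real {ω | Q.delay n ω ≤ x} := by
        intro m
        have h1 : (fun ω => (Set.Iic x).indicator (fun _ => (1 : ℝ)) (Q.delay m ω))
            = (Q.delay m ⁻¹' Set.Iic x).indicator fun _ => 1 := rfl
        rw [h1, integral_indicator_const _ (Q.measurable_delay m measurableSet_Iic), smul_eq_mul,
          mul_one]
        have := ((hid m).trans (hid n).symm).measure_mem_eq (measurableSet_Iic (a := x))
        simp only [measureReal_def, this]
        rfl
      simp only [cesaro]
      rw [integral_div, integral_finsetSum _ fun m _ => hi (m + 1)]
      simp_rw [heq]
      exact cesaro_const _ hN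

end FCFSQueue

/-! ### The law of the stationary age of information -/

/-- The peak age before a departure, given the delay `d` of the preceding packet and the pair `p`
of the interarrival time and the service time of the departing packet. -/
def peakAge (d : ℝ) (p : ℝ × ℝ) : ℝ := max d p.1 + p.2

lemma measurable_peakAge : Measurable fun q : ℝ × (ℝ × ℝ) => peakAge q.1 q.2 := by
  simp only [peakAge]
  fun_prop

lemma le_peakAge (d : ℝ) {p : ℝ × ℝ} (hp : 0 ≤ p.2) : d ≤ peakAge d p := by
  simp only [peakAge]
  linarith [le_max_left d p.1]

/-- The law of the stationary age of information, given the law `π` of the input and the law `ν`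
of the stationary delay: the age runs from a delay to the next peak age. -/
noncomputable def aoiLaw (π : Measure (ℝ × ℝ)) (ν : Measure ℝ) : Measure ℝ :=
  volume.withDensity fun y => ENNReal.ofReal (∫ p, p.1 ∂π)⁻¹ *
    (ν.prod π) {q | q.1 < y ∧ y ≤ peakAge q.1 q.2}

/-- By Tonelli the density formula becomes a cycle formula: the mean integral over one departure
interval, divided by the mean interarrival time. -/
lemma lintegral_aoiLaw (π : Measure (ℝ × ℝ)) (ν : Measure ℝ) [SFinite π] [SFinite ν]
    {g : ℝ → ENNReal} (hg : Measurable g) :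
    ∫⁻ y, g y ∂(aoiLaw π ν) = ENNReal.ofReal (∫ p, p.1 ∂π)⁻¹ *
      ∫⁻ q, (∫⁻ y in Set.Ioc q.1 (peakAge q.1 q.2), g y) ∂(ν.prod π) := by
  set S : Set (ℝ × (ℝ × (ℝ × ℝ))) := {r | r.2.1 < r.1} ∩ {r | r.1 ≤ peakAge r.2.1 r.2.2} with hS
  have hSm : MeasurableSet S := (measurableSet_lt (by fun_prop) (by fun_prop)).inter
    (measurableSet_le (by fun_prop) (measurable_peakAge.comp measurable_snd))
  have hd : Measurable fun y : ℝ => (ν.prod π) {q | q.1 < y ∧ y ≤ peakAge q.1 q.2} :=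
    measurable_measure_prodMk_left hSm
  rw [aoiLaw, lintegral_withDensity_eq_lintegral_mul _ (hd.const_mul _) hg]
  simp only [Pi.mul_apply, mul_assoc]
  rw [lintegral_const_mul _ (by exact hd.mul hg)]
  congr 1
  have h1 : ∀ y, (ν.prod π) {q | q.1 < y ∧ y ≤ peakAge q.1 q.2} * g y
      = ∫⁻ q, S.indicator (fun r => g r.1) (y, q) ∂(ν.prod π) := by
    intro y
    have hm : MeasurableSet {q : ℝ × (ℝ × ℝ) | q.1 < y ∧ y ≤ peakAge q.1 q.2} :=
      measurable_prodMk_left hSm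
    rw [mul_comm, ← lintegral_indicator_const hm]
    rfl
  simp_rw [h1]
  rw [lintegral_lintegral_swap]
  · refine lintegral_congr fun q => ?_
    rw [← lintegral_indicator measurableSet_Ioc]
    rfl
  · exact ((hg.comp measurable_fst).indicator hSm).aemeasurable

lemma integral_Ioc_inter_Iic {a b : ℝ} (hab : a ≤ b) (c : ℝ) :
    max (min b c - a) 0 = max 0 (c - a) - max 0 (c - b) := by
  rcases le_total b c with h | h
  · rw [min_eq_left h, max_eq_left (by linarith), max_eq_right (by linarith),
      max_eq_right (by linarith)]
    ring
  · rw [min_eq_right h, max_eq_left (by linarith : c - b ≤ 0), max_comm, sub_zero]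

lemma intervalIntegral_indicator_Iic {a b : ℝ} (hab : a ≤ b) (c : ℝ) :
    ∫ t in a..b, (Set.Iic c).indicator (fun _ => (1 : ℝ)) t = max 0 (c - a) - max 0 (c - b) := by
  rw [intervalIntegral.integral_of_le hab, setIntegral_indicator measurableSet_Iic,
    Set.Ioc_inter_Iic, setIntegral_const, Real.volume_real_Ioc, smul_eq_mul, mul_one,
    integral_Ioc_inter_Iic hab]

section

variable {π : Measure (ℝ × ℝ)} {ν : Measure ℝ}

/-- The time during which the age does not exceed `x` between two departures. -/
def timeBelow (x d : ℝ) (p : ℝ × ℝ) : ℝ := max 0 (x - d) - max 0 (x - peakAge d p)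

lemma measurable_timeBelow (x : ℝ) :
    Measurable fun q : ℝ × (ℝ × ℝ) => timeBelow x q.1 q.2 := by
  simp only [timeBelow, peakAge]
  fun_prop

lemma timeBelow_nonneg (x d : ℝ) {p : ℝ × ℝ} (hp : 0 ≤ p.2) : 0 ≤ timeBelow x d p := by
  simp only [timeBelow]
  have := le_peakAge d hp
  rw [sub_nonneg]
  gcongr

lemma timeBelow_le (x : ℝ) {d : ℝ} (p : ℝ × ℝ) (hd : 0 ≤ d) : timeBelow x d p ≤ max 0 x := by
  simp only [timeBelow]
  have h1 : max 0 (x - d) ≤ max 0 x := max_le_max_left _ (by linarith)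
  linarith [le_max_left 0 (x - peakAge d p)]

lemma ae_prod_nonneg (hπ : IsStableInput π) (hν : IsBalancedDelay π ν) :
    ∀ᵐ q ∂(ν.prod π), 0 ≤ q.1 ∧ 0 ≤ q.2.1 ∧ 0 ≤ q.2.2 := by
  have := hπ.isProbabilityMeasure
  have := hν.isProbabilityMeasure
  filter_upwards [Measure.quasiMeasurePreserving_fst.ae (hν.stationary.ae_nonneg hπ),
    Measure.quasiMeasurePreserving_snd.ae hπ.nonneg] with q h1 h2 using ⟨h1, h2⟩

lemma aoiLaw_Iic (hπ : IsStableInput π) (hν : IsBalancedDelay π ν) (x : ℝ) :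
    aoiLaw π ν (Set.Iic x) = ENNReal.ofReal
      ((∫ p, p.1 ∂π)⁻¹ * ∫ q, timeBelow x q.1 q.2 ∂(ν.prod π)) := by
  have := hπ.isProbabilityMeasure
  have := hν.isProbabilityMeasure
  have hnn := ae_prod_nonneg hπ hν
  rw [← lintegral_indicator_one measurableSet_Iic,
    lintegral_aoiLaw _ _ (measurable_one.indicator measurableSet_Iic),
    ENNReal.ofReal_mul (inv_nonneg.2 (integral_nonneg_of_ae (hπ.nonneg.mono fun p hp => hp.1)))]
  congr 1
  rw [ofReal_integral_eq_lintegral_ofReal]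
  · refine lintegral_congr_ae ?_
    filter_upwards [hnn] with q hq
    rw [lintegral_indicator_one measurableSet_Iic, Measure.restrict_apply measurableSet_Iic,
      Set.inter_comm, Set.Ioc_inter_Iic, Real.volume_Ioc, timeBelow,
      ← integral_Ioc_inter_Iic (le_peakAge q.1 hq.2.2), ENNReal.ofReal_max, ENNReal.ofReal_zero]
    simp
  · refine Integrable.of_bound (measurable_timeBelow x).aestronglyMeasurable (max 0 x) ?_
    filter_upwards [hnn] with q hq
    rw [Real.norm_eq_abs, abs_of_nonneg (timeBelow_nonneg x q.1 hq.2.2)]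
    exact timeBelow_le x q.2 hq.1
  · filter_upwards [hnn] with q hq using timeBelow_nonneg x q.1 hq.2.2

/-- The interval length is at most G + H, hence integrable even when the delay is not. -/
lemma integrable_peakAge_sub (hπ : IsStableInput π) (hν : IsBalancedDelay π ν) :
    Integrable (fun q : ℝ × (ℝ × ℝ) => peakAge q.1 q.2 - q.1) (ν.prod π) := by
  have := hπ.isProbabilityMeasure
  have := hν.isProbabilityMeasure
  have h : Integrable (fun q : ℝ × (ℝ × ℝ) => q.2.1 + q.2.2) (ν.prod π) :=
    (hπ.integrable_fst.add hπ.integrable_snd).comp_snd ν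
  refine h.mono' (measurable_peakAge.sub measurable_fst).aestronglyMeasurable ?_
  filter_upwards [ae_prod_nonneg hπ hν] with q hq
  rw [Real.norm_eq_abs, abs_of_nonneg (sub_nonneg.2 (le_peakAge q.1 hq.2.2)), peakAge]
  have : max q.1 q.2.1 ≤ q.1 + q.2.1 := max_le (by linarith) (by linarith)
  linarith

/-- The interval length is (G - D)^+ + H, and the balance gives its first term mean E[G] - E[H].
This is why `aoiLaw` has total mass one. -/
lemma integral_peakAge_sub (hπ : IsStableInput π) (hν : IsBalancedDelay π ν) :
    ∫ q, (peakAge q.1 q.2 - q.1) ∂(ν.prod π) = ∫ p, p.1 ∂π := by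
  have := hπ.isProbabilityMeasure
  have := hν.isProbabilityMeasure
  have hθ := hπ.isDecay_meanResidual
  rw [integral_prod _ (integrable_peakAge_sub hπ hν)]
  have h : ∀ᵐ x ∂ν, ∫ p, (peakAge x p - x) ∂π = meanResidual π x + ∫ p, p.2 ∂π := by
    filter_upwards [hν.stationary.ae_nonneg hπ] with x hx
    rw [meanResidual, ← integral_add (hπ.integrable_residual x) hπ.integrable_snd]
    refine integral_congr_ae (ae_of_all _ fun p => ?_)
    simp only [peakAge]
    rw [max_eq_right hx]
    rcases le_total x p.1 with h | h
    · rw [max_eq_right h, max_eq_right (by linarith)]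
      ring
    · rw [max_eq_left h, max_eq_left (by linarith)]
      ring
  rw [integral_congr_ae h, integral_add (Integrable.of_bound hθ.measurable.aestronglyMeasurable _
    (ae_of_all _ hθ.abs_le)) (integrable_const _), hν.integral_meanResidual hπ]
  simp

lemma mean_interarrival_pos (hπ : IsStableInput π) : 0 < ∫ p, p.1 ∂π :=
  (integral_nonneg_of_ae (hπ.nonneg.mono fun _ hp => hp.2)).trans_lt hπ.lt

lemma isProbabilityMeasure_aoiLaw (hπ : IsStableInput π) (hν : IsBalancedDelay π ν) :
    IsProbabilityMeasure (aoiLaw π ν) := by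
  have := hπ.isProbabilityMeasure
  have := hν.isProbabilityMeasure
  have hpos := mean_interarrival_pos hπ
  refine ⟨?_⟩
  rw [← lintegral_one, lintegral_aoiLaw _ _ measurable_const]
  simp only [lintegral_one, Measure.restrict_apply_univ, Real.volume_Ioc]
  rw [← ofReal_integral_eq_lintegral_ofReal (integrable_peakAge_sub hπ hν), integral_peakAge_sub hπ hν,
    ← ENNReal.ofReal_mul (by positivity), inv_mul_cancel₀ hpos.ne', ENNReal.ofReal_one]
  filter_upwards [ae_prod_nonneg hπ hν] with q hq using sub_nonneg.2 (le_peakAge q.1 hq.2.2)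

lemma ae_nonneg_aoiLaw (hπ : IsStableInput π) (hν : IsBalancedDelay π ν) :
    ∀ᵐ x ∂(aoiLaw π ν), 0 ≤ x := by
  have := hπ.isProbabilityMeasure
  have := hν.isProbabilityMeasure
  have h0 : ∫ q, timeBelow 0 q.1 q.2 ∂(ν.prod π) = 0 := by
    refine integral_eq_zero_of_ae ?_
    filter_upwards [ae_prod_nonneg hπ hν] with q hq
    exact le_antisymm ((timeBelow_le 0 q.2 hq.1).trans_eq (max_self 0))
      (timeBelow_nonneg 0 q.1 hq.2.2)
  have h := aoiLaw_Iic hπ hν 0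
  rw [h0, mul_zero, ENNReal.ofReal_zero] at h
  rw [ae_iff]
  exact measure_mono_null (fun x hx => (not_le.1 hx).le) h

/-- The Laplace-Stieltjes transform of the stationary age of information. -/
lemma lst_aoiLaw (hπ : IsStableInput π) (hν : IsBalancedDelay π ν) {s : ℝ} (hs : 0 < s) :
    lst (aoiLaw π ν) s = (∫ p, p.1 ∂π)⁻¹ / s *
      (lst ν s - ∫ q, Real.exp (-(s * peakAge q.1 q.2)) ∂(ν.prod π)) := by
  have := hπ.isProbabilityMeasure
  have := hν.isProbabilityMeasure
  have hnn := ae_prod_nonneg hπ hν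
  have hpos := mean_interarrival_pos hπ
  have hexp : ∀ {y : ℝ}, 0 ≤ y → ‖Real.exp (-(s * y))‖ ≤ 1 := fun hy => by
    rw [Real.norm_eq_abs, Real.abs_exp, Real.exp_le_one_iff]
    nlinarith
  have hi1 : Integrable (fun q : ℝ × (ℝ × ℝ) => Real.exp (-(s * q.1))) (ν.prod π) := by
    refine Integrable.of_bound (by fun_prop) 1 ?_
    filter_upwards [hnn] with q hq using hexp hq.1
  have hi2 : Integrable (fun q : ℝ × (ℝ × ℝ) => Real.exp (-(s * peakAge q.1 q.2))) (ν.prod π) := by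
    refine Integrable.of_bound (measurable_peakAge.const_mul s).neg.exp.aestronglyMeasurable 1 ?_
    filter_upwards [hnn] with q hq using hexp (hq.1.trans (le_peakAge q.1 hq.2.2))
  have hd : lst ν s = ∫ q, Real.exp (-(s * q.1)) ∂(ν.prod π) := by
    rw [lst, integral_fun_fst (fun x => Real.exp (-(s * x)))]
    simp
  rw [hd, ← integral_sub hi1 hi2, div_mul_eq_mul_div, mul_div_assoc, ← integral_div]
  have hi3 : Integrable (fun q : ℝ × (ℝ × ℝ) =>
      (Real.exp (-(s * q.1)) - Real.exp (-(s * peakAge q.1 q.2))) / s) (ν.prod π) :=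
    (hi1.sub hi2).div_const s
  have hge : ∀ᵐ q ∂(ν.prod π),
      0 ≤ (Real.exp (-(s * q.1)) - Real.exp (-(s * peakAge q.1 q.2))) / s := by
    filter_upwards [hnn] with q hq
    refine div_nonneg (sub_nonneg.2 (Real.exp_le_exp.2 ?_)) hs.le
    nlinarith [le_peakAge q.1 hq.2.2]
  have hlin : ∫⁻ y, ENNReal.ofReal (Real.exp (-(s * y))) ∂(aoiLaw π ν)
      = ENNReal.ofReal ((∫ p, p.1 ∂π)⁻¹ *
        ∫ q, (Real.exp (-(s * q.1)) - Real.exp (-(s * peakAge q.1 q.2))) / s ∂(ν.prod π)) := by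
    rw [lintegral_aoiLaw _ _ (by fun_prop), ENNReal.ofReal_mul (by positivity),
      ofReal_integral_eq_lintegral_ofReal hi3 hge]
    congr 1
    refine lintegral_congr_ae ?_
    filter_upwards [hnn] with q hq
    have hle := le_peakAge q.1 hq.2.2
    rw [← ofReal_integral_eq_lintegral_ofReal ((by fun_prop : Continuous fun y : ℝ =>
      Real.exp (-(s * y))).integrableOn_Ioc) (ae_of_all _ fun y => (Real.exp_pos _).le)]
    congr 1
    -- The exponential is integrated explicitly from the delay to the peak age.
    rw [← intervalIntegral.integral_of_le hle]
    have hder : ∀ y ∈ Set.uIcc q.1 (peakAge q.1 q.2),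
        HasDerivAt (fun y => -Real.exp (-(s * y)) / s) (Real.exp (-(s * y))) y := by
      intro y _
      have h1 : HasDerivAt (fun y : ℝ => -(s * y)) (-(s * 1)) y :=
        ((hasDerivAt_id y).const_mul s).neg
      have h2 := (h1.exp.neg).div_const s
      convert! h2 using 1
      field_simp
    rw [intervalIntegral.integral_eq_sub_of_hasDerivAt hder
      ((by fun_prop : Continuous fun y : ℝ => Real.exp (-(s * y))).intervalIntegrable _ _)]
    ring
  rw [lst, integral_eq_lintegral_of_nonneg_ae (ae_of_all _ fun y => (Real.exp_pos _).le)
    (by fun_prop), hlin, ENNReal.toReal_ofReal]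
  exact mul_nonneg (by positivity) (integral_nonneg_of_ae hge)

end

namespace FCFSQueue

variable {Ω : Type*} [MeasurableSpace Ω] {P : Measure Ω} {νG νH : Measure ℝ}

/-! ### The age along a path -/

lemma measurable_lastDeparted (Q : FCFSQueue P νG νH) :
    Measurable fun q : ℝ × Ω => Q.lastDeparted q.1 q.2 := by
  have hdep : ∀ m, MeasurableSet {q : ℝ × Ω | Q.departure m q.2 ≤ q.1} := fun m =>
    measurableSet_le ((Q.measurable_departure m).comp measurable_snd) measurable_fst
  -- A supremum of naturals defaults to 0 on empty and on unbounded sets, so a nonzero value is a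
  -- true maximum. The fibre over 0 is then the complement of all the others.
  have hpos : ∀ n, n ≠ 0 → MeasurableSet ((fun q : ℝ × Ω => Q.lastDeparted q.1 q.2) ⁻¹' {n}) := by
    intro n hn
    have heq : (fun q : ℝ × Ω => Q.lastDeparted q.1 q.2) ⁻¹' {n}
        = {q | Q.departure n q.2 ≤ q.1} ∩ ⋂ m > n, {q | Q.departure m q.2 ≤ q.1}ᶜ := by
      ext q
      simp only [Set.mem_preimage, Set.mem_singleton_iff, Set.mem_inter_iff, Set.mem_ofPred_eq,
        Set.mem_iInter, Set.mem_compl_iff, lastDeparted]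
      constructor
      · intro h
        have hne : {m | Q.departure m q.2 ≤ q.1}.Nonempty := by
          rw [Set.nonempty_iff_ne_empty]
          intro h0
          rw [h0, csSup_empty] at h
          exact hn h.symm
        have hbdd : BddAbove {m | Q.departure m q.2 ≤ q.1} := by
          by_contra hb
          rw [Nat.sSup_of_not_bddAbove hb] at h
          exact hn h.symm
        refine ⟨?_, fun m hm hm' => ?_⟩
        · have := Nat.sSup_mem hne hbdd
          rwa [h] at this
        · have := le_csSup hbdd hm'
          omega
      · rintro ⟨h1, h2⟩
        exact IsGreatest.csSup_eq ⟨h1, fun m hm => not_lt.1 fun hlt => h2 m hlt hm⟩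
    rw [heq]
    exact (hdep n).inter (MeasurableSet.iInter fun m => MeasurableSet.iInter fun _ => (hdep m).compl)
  refine measurable_to_countable' fun n => ?_
  rcases eq_or_ne n 0 with rfl | hn
  · have heq : (fun q : ℝ × Ω => Q.lastDeparted q.1 q.2) ⁻¹' {0}
        = (⋃ n : ℕ, ⋃ _ : n ≠ 0, (fun q : ℝ × Ω => Q.lastDeparted q.1 q.2) ⁻¹' {n})ᶜ := by
      ext q
      simp only [Set.mem_preimage, Set.mem_singleton_iff, Set.mem_compl_iff, Set.mem_iUnion,
        not_exists]
      exact ⟨fun h i hi h' => hi (h'.symm.trans h), fun h => by_contra fun hne => h _ hne rfl⟩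
    rw [heq]
    exact (MeasurableSet.iUnion fun n => MeasurableSet.iUnion fun hn => hpos n hn).compl
  · exact hpos n hn

lemma measurable_aoi (Q : FCFSQueue P νG νH) :
    Measurable fun q : ℝ × Ω => Q.aoi q.1 q.2 := by
  have harr : Measurable fun r : ℕ × Ω => Q.arrival r.1 r.2 :=
    measurable_from_prod_countable_right fun n => Q.measurable_arrival n
  have h1 : Measurable fun q : ℝ × Ω => q.1 - Q.arrival (Q.lastDeparted q.1 q.2) q.2 :=
    measurable_fst.sub (harr.comp (Q.measurable_lastDeparted.prodMk measurable_snd))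
  unfold aoi
  exact Measurable.ite (measurableSet_le ((Q.measurable_departure 0).comp measurable_snd)
    measurable_fst) h1 Q.measurable_initialAge

lemma measurable_aoi_indicator (Q : FCFSQueue P νG νH) (x : ℝ) :
    Measurable fun q : ℝ × Ω =>
      Set.indicator {u : ℝ | Q.aoi u q.2 ≤ x} (fun _ => (1 : ℝ)) q.1 :=
  (isDecay_indicator_Iic x).measurable.comp Q.measurable_aoi

lemma intervalIntegrable_aoi_indicator (Q : FCFSQueue P νG νH) (x : ℝ) (ω : Ω) (a b : ℝ) :
    IntervalIntegrable (Set.indicator {u : ℝ | Q.aoi u ω ≤ x} fun _ => (1 : ℝ)) volume a b := by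
  refine (intervalIntegrable_const (c := (1 : ℝ))).mono_fun
    ((Q.measurable_aoi_indicator x).comp measurable_prodMk_right).aestronglyMeasurable
    (ae_of_all _ fun t => ?_)
  simp only [Real.norm_eq_abs, abs_one]
  exact (isDecay_indicator_Iic x).abs_le _

/-- The properties of a path of the queue that determine the frequencies of the age. -/
structure IsRegularPath (Q : FCFSQueue P νG νH) (ω : Ω) : Prop where
  delay_nonneg : ∀ n, 0 ≤ Q.delay n ω
  monotone_departure : Monotone fun n => Q.departure n ω
  tendsto_departure : Tendsto (fun n => Q.departure n ω) atTop atTop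

namespace IsRegularPath

variable {Q : FCFSQueue P νG νH} {ω : Ω}

lemma lastDeparted_eq (h : Q.IsRegularPath ω) {t : ℝ} {n : ℕ} (h1 : Q.departure n ω ≤ t)
    (h2 : t < Q.departure (n + 1) ω) : Q.lastDeparted t ω = n := by
  refine IsGreatest.csSup_eq ⟨h1, fun m hm => ?_⟩
  by_contra hlt
  have := h.monotone_departure (show n + 1 ≤ m by omega)
  simp only [Set.mem_ofPred_eq] at hm
  linarith

lemma aoi_eq (h : Q.IsRegularPath ω) {t : ℝ} {n : ℕ} (h1 : Q.departure n ω ≤ t)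
    (h2 : t < Q.departure (n + 1) ω) : Q.aoi t ω = t - Q.arrival n ω := by
  rw [aoi, if_pos ((h.monotone_departure n.zero_le).trans h1), h.lastDeparted_eq h1 h2]

lemma lastDeparted_spec (h : Q.IsRegularPath ω) {t : ℝ} (ht : Q.departure 0 ω ≤ t) :
    Q.departure (Q.lastDeparted t ω) ω ≤ t ∧ t < Q.departure (Q.lastDeparted t ω + 1) ω := by
  have hbdd : BddAbove {m | Q.departure m ω ≤ t} := by
    obtain ⟨N, hN⟩ := eventually_atTop.1 (h.tendsto_departure.eventually_gt_atTop t)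
    refine ⟨N, fun m hm => ?_⟩
    by_contra hlt
    exact absurd (hN m (not_le.1 hlt).le) (not_lt.2 hm)
  refine ⟨Nat.sSup_mem ⟨0, ht⟩ hbdd, ?_⟩
  by_contra hle
  have := le_csSup hbdd (not_lt.1 hle)
  rw [lastDeparted] at this
  omega

lemma tendsto_lastDeparted (h : Q.IsRegularPath ω) :
    Tendsto (fun t => Q.lastDeparted t ω) atTop atTop := by
  rw [tendsto_atTop]
  intro M
  filter_upwards [eventually_ge_atTop (Q.departure M ω)] with t ht
  have hs := h.lastDeparted_spec ((h.monotone_departure M.zero_le).trans ht)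
  by_contra hlt
  have := h.monotone_departure (show Q.lastDeparted t ω + 1 ≤ M by omega)
  simp only at this
  linarith

lemma integral_aoi_indicator_cell (h : Q.IsRegularPath ω) (x : ℝ) {n : ℕ} {T : ℝ}
    (h1 : Q.departure n ω ≤ T) (h2 : T ≤ Q.departure (n + 1) ω) :
    ∫ t in Q.departure n ω..T, Set.indicator {u : ℝ | Q.aoi u ω ≤ x} (fun _ => (1 : ℝ)) t
      = max 0 (x - Q.delay n ω) - max 0 (x - (T - Q.arrival n ω)) := by
  have hcongr : ∫ t in Q.departure n ω..T,
      Set.indicator {u : ℝ | Q.aoi u ω ≤ x} (fun _ => (1 : ℝ)) t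
      = ∫ t in Q.departure n ω..T, (Set.Iic (Q.arrival n ω + x)).indicator (fun _ => (1 : ℝ)) t := by
    refine intervalIntegral.integral_congr_ae ?_
    -- The right endpoint may be the next departure, where the age has already dropped; it is a null
    -- set.
    have hne : ∀ᵐ t : ℝ, t ≠ T := by simp [ae_iff]
    filter_upwards [hne] with t hne ht
    rw [Set.uIoc_of_le h1] at ht
    have heq := h.aoi_eq ht.1.le ((lt_of_le_of_ne ht.2 hne).trans_le h2)
    simp only [Set.indicator_apply, Set.mem_ofPred_eq, Set.mem_Iic, heq, sub_le_iff_le_add']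
  rw [hcongr, intervalIntegral_indicator_Iic h1]
  have e1 : Q.arrival n ω + x - Q.departure n ω = x - Q.delay n ω := by
    rw [delay]
    ring
  have e2 : Q.arrival n ω + x - T = x - (T - Q.arrival n ω) := by ring
  rw [e1, e2]

lemma departure_succ_sub (n : ℕ) :
    Q.departure (n + 1) ω - Q.arrival n ω = peakAge (Q.delay n ω) (Q.input n ω) := by
  simp only [departure, arrival, peakAge, delay, input]
  rw [max_comm, show Q.departure n ω = Q.arrival n ω + (Q.departure n ω - Q.arrival n ω) by ring,
    max_add_add_left]
  ring_nf

lemma integral_aoi_indicator (h : Q.IsRegularPath ω) (x : ℝ) (N : ℕ) :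
    ∫ t in Q.departure 0 ω..Q.departure N ω,
      Set.indicator {u : ℝ | Q.aoi u ω ≤ x} (fun _ => (1 : ℝ)) t
      = ∑ n ∈ Finset.range N, timeBelow x (Q.delay n ω) (Q.input n ω) := by
  induction N with
  | zero => simp
  | succ N ih =>
    rw [Finset.sum_range_succ, ← ih, ← intervalIntegral.integral_add_adjacent_intervals
      (Q.intervalIntegrable_aoi_indicator x ω _ (Q.departure N ω))
      (Q.intervalIntegrable_aoi_indicator x ω _ _),
      h.integral_aoi_indicator_cell x (h.monotone_departure N.le_succ) le_rfl, departure_succ_sub]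
    rfl

/-- The frequency of the ages that do not exceed `x` is determined by the averages over the
packets. -/
lemma tendsto_frequency (h : Q.IsRegularPath ω) {x L m : ℝ} (hm : 0 < m)
    (hdep : Tendsto (fun n : ℕ => Q.departure n ω / n) atTop (𝓝 m))
    (hL : Tendsto (cesaro fun n => timeBelow x (Q.delay n ω) (Q.input n ω)) atTop (𝓝 L)) :
    Tendsto (fun T : ℝ => (1 / T) *
      ∫ t in (0 : ℝ)..T, Set.indicator {u : ℝ | Q.aoi u ω ≤ x} (fun _ => (1 : ℝ)) t)
      atTop (𝓝 (m⁻¹ * L)) := by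
  set J : ℝ → ℝ → ℝ := fun a b =>
    ∫ t in a..b, Set.indicator {u : ℝ | Q.aoi u ω ≤ x} (fun _ => (1 : ℝ)) t with hJ
  set M : ℝ → ℕ := fun T => Q.lastDeparted T ω with hM
  have hMlim : Tendsto M atTop atTop := h.tendsto_lastDeparted
  have hdep' : Tendsto (fun n : ℕ => Q.departure (n + 1) ω / n) atTop (𝓝 m) := by
    have h1 : Tendsto (fun n : ℕ => Q.departure (n + 1) ω / ((n + 1 : ℕ) : ℝ)) atTop (𝓝 m) :=
      hdep.comp (tendsto_add_atTop_nat 1)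
    have h2 : Tendsto (fun n : ℕ => 1 + 1 / (n : ℝ)) atTop (𝓝 (1 + 0)) :=
      tendsto_const_nhds.add (tendsto_one_div_atTop_nhds_zero_nat)
    have h3 := h1.mul h2
    rw [add_zero, mul_one] at h3
    refine h3.congr' ?_
    filter_upwards [eventually_gt_atTop 0] with n hn
    have : (n : ℝ) ≠ 0 := by positivity
    push_cast
    field_simp
  -- Squeeze `T` between the last departure up to `T` and the next one.
  have hT : Tendsto (fun T : ℝ => T / M T) atTop (𝓝 m) := by
    refine tendsto_of_tendsto_of_tendsto_of_le_of_le' (hdep.comp hMlim) (hdep'.comp hMlim) ?_ ?_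
    · filter_upwards [eventually_ge_atTop (Q.departure 0 ω)] with T hT
      simp only [Function.comp_apply]
      gcongr
      exact (h.lastDeparted_spec hT).1
    · filter_upwards [eventually_ge_atTop (Q.departure 0 ω)] with T hT
      simp only [Function.comp_apply]
      gcongr
      exact (h.lastDeparted_spec hT).2.le
  have hT' : Tendsto (fun T : ℝ => (M T : ℝ) / T) atTop (𝓝 m⁻¹) :=
    (hT.inv₀ hm.ne').congr fun T => inv_div _ _
  have hmain := hT'.mul (hL.comp hMlim)
  -- The complete intervals give the sum. The remainder is a fixed initial piece and one incomplete
  -- interval, which contributes at most `max 0 x`.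
  have hrest : Tendsto (fun T : ℝ => (1 / T) * (J 0 T
      - ∑ n ∈ Finset.range (M T), timeBelow x (Q.delay n ω) (Q.input n ω))) atTop (𝓝 0) := by
    have hC : Tendsto (fun T : ℝ => (|J 0 (Q.departure 0 ω)| + max 0 x) / T) atTop (𝓝 0) :=
      tendsto_const_nhds.div_atTop tendsto_id
    refine squeeze_zero_norm' ?_ hC
    filter_upwards [eventually_ge_atTop (Q.departure 0 ω), eventually_gt_atTop 0] with T hT hT0
    obtain ⟨hs1, hs2⟩ := h.lastDeparted_spec hT
    have hint := Q.intervalIntegrable_aoi_indicator x ω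
    have hsplit : J 0 T = J 0 (Q.departure 0 ω) + J (Q.departure 0 ω) (Q.departure (M T) ω)
        + J (Q.departure (M T) ω) T := by
      simp only [hJ]
      rw [intervalIntegral.integral_add_adjacent_intervals (hint _ _) (hint _ _),
        intervalIntegral.integral_add_adjacent_intervals (hint _ _) (hint _ _)]
    have hcell : J (Q.departure (M T) ω) T = max 0 (x - Q.delay (M T) ω)
        - max 0 (x - (T - Q.arrival (M T) ω)) := h.integral_aoi_indicator_cell x hs1 hs2.le
    have hb : |J (Q.departure (M T) ω) T| ≤ max 0 x := by
      have hd := h.delay_nonneg (M T)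
      have hle : Q.delay (M T) ω ≤ T - Q.arrival (M T) ω := by
        rw [delay]
        linarith
      have k1 : max 0 (x - Q.delay (M T) ω) ≤ max 0 x := max_le_max_left _ (by linarith)
      have k2 : max 0 (x - (T - Q.arrival (M T) ω)) ≤ max 0 (x - Q.delay (M T) ω) :=
        max_le_max_left _ (by linarith)
      rw [hcell, abs_of_nonneg (by linarith)]
      linarith [le_max_left 0 (x - (T - Q.arrival (M T) ω))]
    have hsum : J (Q.departure 0 ω) (Q.departure (M T) ω)
        = ∑ n ∈ Finset.range (M T), timeBelow x (Q.delay n ω) (Q.input n ω) :=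
      h.integral_aoi_indicator x (M T)
    rw [hsplit, hsum, Real.norm_eq_abs, one_div, inv_mul_eq_div, abs_div, abs_of_pos hT0]
    gcongr
    calc _ = |J 0 (Q.departure 0 ω) + J (Q.departure (M T) ω) T| := by ring_nf
      _ ≤ _ := (abs_add_le _ _).trans (by gcongr)
  have := hmain.add hrest
  rw [add_zero] at this
  refine this.congr' ?_
  filter_upwards [hMlim.eventually_gt_atTop 0] with T hMT
  have : (M T : ℝ) ≠ 0 := by positivity
  simp only [Function.comp_apply, cesaro]
  field_simp
  ring

end IsRegularPath

/-! ### The frequencies of the age -/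

/-- The departure time is the arrival time plus the delay. The former grows like n E[G] by the law
of large numbers, and the latter is sublinear. -/
lemma ae_isRegularPath [IsProbabilityMeasure P] (Q : FCFSQueue P νG νH)
    (hπ : IsStableInput (νG.prod νH)) :
    ∀ᵐ ω ∂P, Q.IsRegularPath ω ∧
      Tendsto (fun n : ℕ => Q.departure n ω / n) atTop (𝓝 (∫ p, p.1 ∂(νG.prod νH))) := by
  have hin := Q.isIIDInput
  have hpos := mean_interarrival_pos hπ
  filter_upwards [hin.ae_forall hπ.nonneg, hin.tendsto_cesaro_input measurable_fst
    hπ.integrable_fst, hin.tendsto_cesaro_input measurable_snd hπ.integrable_snd,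
    Q.arrival₀_le_departure₀] with ω h0 h1 h2 h3
  have hd0 : 0 ≤ Q.delay 0 ω := sub_nonneg.2 h3
  have hlim : Tendsto (fun n : ℕ => Q.departure n ω / n) atTop (𝓝 (∫ p, p.1 ∂(νG.prod νH))) := by
    have hd := tendsto_lindley_div hd0 (fun n => (h0 n).2) hπ.lt h1 h2
    have ha : ∀ n, Q.arrival n ω = Q.arrival₀ ω + ∑ i ∈ Finset.range n, (Q.input i ω).1 := by
      intro n
      induction n with
      | zero => simp [arrival]
      | succ n ih => rw [Finset.sum_range_succ, ← add_assoc, ← ih, arrival, input]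
    have hsum := (hd.add h1).add (tendsto_const_div_atTop_nhds_zero_nat (Q.arrival₀ ω))
    rw [zero_add, add_zero] at hsum
    refine hsum.congr fun n => ?_
    have hdn : Q.departure n ω = Q.delay n ω + Q.arrival n ω := by
      rw [delay]
      ring
    rw [← Q.delay_eq, hdn, ha, cesaro]
    ring
  refine ⟨⟨fun n => ?_, monotone_nat_of_le_succ fun n => ?_, ?_⟩, hlim⟩
  · rw [Q.delay_eq]
    exact lindley_nonneg (fun n => (h0 n).2) hd0 n
  · have := (h0 n).2
    simp only [input] at this
    rw [departure]
    linarith [le_max_right (Q.arrival (n + 1) ω) (Q.departure n ω)]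
  · refine (tendsto_natCast_atTop_atTop.atTop_mul_pos hpos hlim).congr' ?_
    filter_upwards [eventually_gt_atTop 0] with n hn
    have : (n : ℝ) ≠ 0 := by positivity
    field_simp

/-- The time below x is the difference of one decaying function at the delay and at the peak age.
Averaging the second over the next input gives a decaying function of the delay again, so the
ergodic theorem covers both. -/
lemma tendsto_cesaro_timeBelow [IsProbabilityMeasure P] (Q : FCFSQueue P νG νH)
    (hπ : IsStableInput (νG.prod νH)) {ν : Measure ℝ} (hν : IsBalancedDelay (νG.prod νH) ν)
    (x : ℝ) :
    ∀ᵐ ω ∂P, Tendsto (cesaro fun n => timeBelow x (Q.delay n ω) (Q.input n ω)) atTop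
      (𝓝 (∫ q, timeBelow x q.1 q.2 ∂(ν.prod (νG.prod νH)))) := by
  have := hπ.isProbabilityMeasure
  have := hν.isProbabilityMeasure
  have hin := Q.isIIDInput
  -- The inner `max 0 d` bounds the function on the whole line and changes nothing on actual delays.
  set f : ℝ → ℝ := fun d => max 0 (x - max 0 d) with hf
  have hle : ∀ y, f y ≤ max 0 x := fun y =>
    max_le_max_left _ (by linarith [le_max_left 0 y])
  have hfanti : Antitone f := fun a b hab => by
    simp only [hf]
    gcongr
  have hfd : IsDecay f (max 0 x) := by
    refine ⟨hfanti, fun y => le_max_left _ _, hle, ?_⟩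
    refine tendsto_const_nhds.congr' ?_
    filter_upwards [eventually_ge_atTop x] with y hy
    simp only [hf]
    rw [max_eq_left]
    linarith [le_max_right 0 y]
  set g : ℝ × (ℝ × ℝ) → ℝ := fun q => f (peakAge q.1 q.2) with hg
  have hgm : Measurable g := hfd.measurable.comp measurable_peakAge
  have hgi : ∀ d, Integrable (fun p => g (d, p)) (νG.prod νH) := fun d =>
    Integrable.of_bound (hgm.comp measurable_prodMk_left).aestronglyMeasurable (max 0 x)
      (ae_of_all _ fun p => hfd.abs_le _)
  have hgd : IsDecay (fun d => ∫ p, g (d, p) ∂(νG.prod νH)) (max 0 x) := by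
    refine ⟨fun a b hab => ?_, fun d => integral_nonneg fun p => hfd.nonneg _, fun d => ?_, ?_⟩
    · refine integral_mono (hgi b) (hgi a) fun p => hfanti ?_
      simp only [peakAge]
      gcongr
    · calc ∫ p, g (d, p) ∂(νG.prod νH) ≤ ∫ _, max 0 x ∂(νG.prod νH) :=
            integral_mono (hgi d) (integrable_const _) fun p => hle _
        _ = max 0 x := by simp
    · have h := tendsto_integral_filter_of_dominated_convergence (μ := νG.prod νH) (l := atTop)
        (F := fun (d : ℝ) p => g (d, p)) (f := fun _ => 0) (fun _ => max 0 x)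
        (Eventually.of_forall fun d => (hgi d).aestronglyMeasurable)
        (Eventually.of_forall fun d => ae_of_all _ fun p => hfd.abs_le _) (integrable_const _)
        (ae_of_all _ fun p => ?_)
      · rwa [integral_zero] at h
      · refine hfd.tendsto.comp (tendsto_atTop_mono (fun d => ?_)
          (tendsto_atTop_add_const_right _ p.2 tendsto_id))
        simp only [peakAge, id_eq]
        linarith [le_max_left d p.1]
  have hlim : ∀ᵐ ω ∂P, Tendsto (cesaro fun n =>
      f (lindley (fun i => Q.input i ω) 0 n) - g (lindley (fun i => Q.input i ω) 0 n, Q.input n ω))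
      atTop (𝓝 (∫ d, f d ∂ν - ∫ d, ∫ p, g (d, p) ∂(νG.prod νH) ∂ν)) := by
    filter_upwards [hin.tendsto_cesaro_lindley hπ hν hfd, hin.tendsto_cesaro_lindley hπ hν hgd,
      hin.tendsto_cesaro_sub 0 hgm (fun q => hfd.abs_le _)] with ω h1 h2 h3
    have := h1.sub (h2.add h3)
    rw [add_zero] at this
    refine this.congr fun N => ?_
    rw [cesaro_sub]
    ring
  have hval : ∫ q, timeBelow x q.1 q.2 ∂(ν.prod (νG.prod νH))
      = ∫ d, f d ∂ν - ∫ d, ∫ p, g (d, p) ∂(νG.prod νH) ∂ν := by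
    have hfi : Integrable (fun q : ℝ × (ℝ × ℝ) => f q.1) (ν.prod (νG.prod νH)) :=
      Integrable.of_bound (hfd.measurable.comp measurable_fst).aestronglyMeasurable (max 0 x)
        (ae_of_all _ fun q => hfd.abs_le _)
    have hgi' : Integrable g (ν.prod (νG.prod νH)) :=
      Integrable.of_bound hgm.aestronglyMeasurable (max 0 x) (ae_of_all _ fun q => hfd.abs_le _)
    rw [← integral_prod _ hgi', ← one_smul ℝ (∫ d, f d ∂ν),
      ← probReal_univ (μ := νG.prod νH), ← integral_fun_fst f, ← integral_sub hfi hgi']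
    refine integral_congr_ae ?_
    filter_upwards [ae_prod_nonneg hπ hν] with q hq
    simp only [timeBelow, hf, hg]
    rw [max_eq_right hq.1, max_eq_right (hq.1.trans (le_peakAge q.1 hq.2.2))]
  rw [hval]
  filter_upwards [Q.ae_cesaro_congr hπ (F := fun d p => f d - g (d, p)) hlim,
    Q.ae_isRegularPath hπ, hin.ae_forall hπ.nonneg] with ω h1 h2 h3
  refine h1.congr fun N => ?_
  congr 1
  funext n
  have hd := h2.1.delay_nonneg n
  simp only [timeBelow, hf, hg]
  rw [max_eq_right hd, max_eq_right (hd.trans (le_peakAge _ (h3 n).2))]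

/-- The law of the stationary age of information. -/
theorem isAoILaw [IsProbabilityMeasure P] (Q : FCFSQueue P νG νH)
    (hπ : IsStableInput (νG.prod νH)) {ν : Measure ℝ} (hν : IsBalancedDelay (νG.prod νH) ν) :
    Q.IsAoILaw (aoiLaw (νG.prod νH) ν) := by
  have hprob := isProbabilityMeasure_aoiLaw hπ hν
  have hpos := mean_interarrival_pos hπ
  have hfreq : ∀ᵐ ω ∂P, ∀ x : ℝ, Tendsto (fun T : ℝ => (1 / T) *
      ∫ t in (0 : ℝ)..T, Set.indicator {u : ℝ | Q.aoi u ω ≤ x} (fun _ => (1 : ℝ)) t)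
      atTop (𝓝 ((aoiLaw (νG.prod νH) ν).real (Set.Iic x))) := by
    refine ae_forall_tendsto_of_monotone (Φ := fun (T : ℝ) ω x => (1 / T) *
      ∫ t in (0 : ℝ)..T, Set.indicator {u : ℝ | Q.aoi u ω ≤ x} (fun _ => (1 : ℝ)) t)
      (ae_of_all _ fun ω => ?_) fun x => ?_
    · filter_upwards [eventually_gt_atTop 0] with T hT x y hxy
      simp only
      gcongr
      refine intervalIntegral.integral_mono_on hT.le (Q.intervalIntegrable_aoi_indicator x ω _ _)
        (Q.intervalIntegrable_aoi_indicator y ω _ _) fun t _ => ?_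
      exact Set.indicator_le_indicator_of_subset (fun u hu => le_trans hu hxy)
        (fun _ => zero_le_one) _
    · filter_upwards [Q.ae_isRegularPath hπ, Q.tendsto_cesaro_timeBelow hπ hν x] with ω h1 h2
      have hnn : 0 ≤ ∫ q, timeBelow x q.1 q.2 ∂(ν.prod (νG.prod νH)) :=
        integral_nonneg_of_ae ((ae_prod_nonneg hπ hν).mono fun q hq =>
          timeBelow_nonneg x q.1 hq.2.2)
      rw [measureReal_def, aoiLaw_Iic hπ hν, ENNReal.toReal_ofReal (by positivity)]
      exact h1.1.tendsto_frequency hpos h1.2 h2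
  refine ⟨hprob, ae_nonneg_aoiLaw hπ hν, hfreq, fun hid t ht => ?_⟩
  refine hasLaw_of_tendsto_frequency (l := (atTop : Filter ℝ))
    (hid t ht).aemeasurable_fst
    (fun x => ?_) (fun x => ?_) (fun x => ?_) hfreq
  · filter_upwards [eventually_gt_atTop 0] with T hT
    simp_rw [intervalIntegral.integral_of_le hT.le]
    refine (StronglyMeasurable.aestronglyMeasurable ?_).const_mul (1 / T)
    exact (Q.measurable_aoi_indicator x).stronglyMeasurable.integral_prod_left'
  · filter_upwards [eventually_gt_atTop 0] with T hT ω
    have h := intervalIntegral.norm_integral_le_of_norm_le_const (a := 0) (b := T) (C := 1)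
      (f := Set.indicator {u : ℝ | Q.aoi u ω ≤ x} fun _ => (1 : ℝ))
      fun t _ => (isDecay_indicator_Iic x).abs_le _
    rw [sub_zero, one_mul, abs_of_pos hT, Real.norm_eq_abs] at h
    rw [abs_mul, abs_of_pos (by positivity), one_div, inv_mul_eq_div, div_le_one hT]
    exact h
  · filter_upwards [eventually_gt_atTop 0] with T hT
    simp_rw [intervalIntegral.integral_of_le hT.le]
    rw [integral_const_mul]
    have hi : Integrable (fun q : Ω × ℝ =>
        Set.indicator {u : ℝ | Q.aoi u q.1 ≤ x} (fun _ => (1 : ℝ)) q.2)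
        (P.prod (volume.restrict (Set.Ioc 0 T))) :=
      Integrable.of_bound ((Q.measurable_aoi_indicator x).comp measurable_swap).aestronglyMeasurable
        1 (ae_of_all _ fun q => (isDecay_indicator_Iic x).abs_le _)
    -- Fubini turns the expected frequency into an average over time of probabilities, all equal by
    -- the assumption of identical laws.
    rw [integral_integral_swap hi]
    have heq : ∀ u ∈ Set.Ioc 0 T,
        ∫ ω, Set.indicator {u : ℝ | Q.aoi u ω ≤ x} (fun _ => (1 : ℝ)) u ∂P
          = P.real {ω | Q.aoi t ω ≤ x} := by
      intro u hu
      have h1 : (fun ω => Set.indicator {u : ℝ | Q.aoi u ω ≤ x} (fun _ => (1 : ℝ)) u)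
          = (Q.aoi u ⁻¹' Set.Iic x).indicator fun _ => 1 := rfl
      have hm : Measurable (Q.aoi u) := Q.measurable_aoi.comp measurable_prodMk_left
      rw [h1, integral_indicator_const _ (hm measurableSet_Iic), smul_eq_mul, mul_one]
      have := ((hid u hu.1.le).trans (hid t ht).symm).measure_mem_eq (measurableSet_Iic (a := x))
      simp only [measureReal_def, this]
      rfl
    rw [setIntegral_congr_fun measurableSet_Ioc heq, setIntegral_const, Real.volume_real_Ioc_of_le
      hT.le, smul_eq_mul, sub_zero]
    field_simp

end FCFSQueue

/-! ### Laplace-Stieltjes transforms -/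

lemma lst_eq_mgf (ν : Measure ℝ) (s : ℝ) : lst ν s = mgf id ν (-s) := by
  simp [lst, mgf]

section

variable {ν : Measure ℝ} [IsProbabilityMeasure ν]

lemma integrable_exp_neg_mul (hν : ∀ᵐ x ∂ν, 0 ≤ x) {s : ℝ} (hs : 0 ≤ s) :
    Integrable (fun x => Real.exp (-(s * x))) ν := by
  refine Integrable.of_bound (by fun_prop) 1 ?_
  filter_upwards [hν] with x hx
  rw [Real.norm_eq_abs, Real.abs_exp, Real.exp_le_one_iff]
  nlinarith [mul_nonneg hs hx]

lemma lst_pos (hν : ∀ᵐ x ∂ν, 0 ≤ x) {s : ℝ} (hs : 0 ≤ s) : 0 < lst ν s :=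
  integral_exp_pos (integrable_exp_neg_mul hν hs)

lemma tendsto_lst_zero (hν : ∀ᵐ x ∂ν, 0 ≤ x) : Tendsto (lst ν) (𝓝[>] 0) (𝓝 1) := by
  have h := tendsto_integral_filter_of_dominated_convergence (μ := ν) (l := 𝓝[>] (0 : ℝ))
    (F := fun s x => Real.exp (-(s * x))) (f := fun _ => 1) (fun _ => 1)
    (Eventually.of_forall fun s => by fun_prop) ?_ (integrable_const _) (ae_of_all _ fun x => ?_)
  · simp only [integral_const, probReal_univ, smul_eq_mul, mul_one] at h
    exact h
  · filter_upwards [self_mem_nhdsWithin] with s hs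
    filter_upwards [hν] with x hx
    rw [Real.norm_eq_abs, Real.abs_exp, Real.exp_le_one_iff]
    nlinarith [mul_nonneg (Set.mem_Ioi.1 hs).le hx]
  · have : Tendsto (fun s : ℝ => Real.exp (-(s * x))) (𝓝 0) (𝓝 (Real.exp (-(0 * x)))) :=
      Continuous.tendsto (by fun_prop) 0
    simp only [zero_mul, neg_zero, Real.exp_zero] at this
    exact this.mono_left nhdsWithin_le_nhds

/-- For a law on the half-line every negative argument of the moment generating function is
admissible, which gives access to all derivatives of the transform. -/
lemma mem_interior_integrableExpSet (hν : ∀ᵐ x ∂ν, 0 ≤ x) {s : ℝ} (hs : 0 < s) :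
    -s ∈ interior (integrableExpSet id ν) := by
  refine mem_interior.2 ⟨Set.Iio 0, fun t ht => ?_, isOpen_Iio, by simpa using hs⟩
  have := integrable_exp_neg_mul hν (s := -t) (by linarith [Set.mem_Iio.1 ht])
  simpa [integrableExpSet] using this

lemma iteratedDeriv_lst (hν : ∀ᵐ x ∂ν, 0 ≤ x) {s : ℝ} (hs : 0 < s) (n : ℕ) :
    iteratedDeriv n (lst ν) s = (-1) ^ n * ∫ x, x ^ n * Real.exp (-(s * x)) ∂ν := by
  have h1 : lst ν = fun s => mgf id ν (-s) := funext (lst_eq_mgf ν)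
  rw [h1, iteratedDeriv_comp_neg, iteratedDeriv_mgf (mem_interior_integrableExpSet hν hs)]
  simp

lemma hasDerivAt_lst (hν : ∀ᵐ x ∂ν, 0 ≤ x) {s : ℝ} (hs : 0 < s) :
    HasDerivAt (lst ν) (iteratedDeriv 1 (lst ν) s) s := by
  have h1 : lst ν = fun s => mgf id ν (-s) := funext (lst_eq_mgf ν)
  have h2 := (hasDerivAt_mgf (mem_interior_integrableExpSet hν hs)).scomp s (hasDerivAt_neg s)
  rw [iteratedDeriv_one]
  have h3 : DifferentiableAt ℝ (lst ν) s := by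
    rw [h1]
    exact h2.differentiableAt
  exact h3.hasDerivAt

lemma integrable_pow_mul_exp_neg (hν : ∀ᵐ x ∂ν, 0 ≤ x) {s : ℝ} (hs : 0 < s) (n : ℕ) :
    Integrable (fun x => x ^ n * Real.exp (-(s * x))) ν := by
  have := integrable_pow_mul_exp_of_mem_interior_integrableExpSet
    (mem_interior_integrableExpSet hν hs) n
  simpa using this

end

/-- A probability law on the half-line is determined by its Laplace-Stieltjes transform. -/
theorem ext_of_lst_eq {ν₁ ν₂ : Measure ℝ} [IsProbabilityMeasure ν₁] [IsProbabilityMeasure ν₂]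
    (h₁ : ∀ᵐ x ∂ν₁, 0 ≤ x) (h₂ : ∀ᵐ x ∂ν₂, 0 ≤ x) (h : ∀ s, 0 < s → lst ν₁ s = lst ν₂ s) :
    ν₁ = ν₂ := by
  have hu : Measurable fun x : ℝ => Real.exp (-x) := by fun_prop
  have hpoly : ∀ (ν : Measure ℝ) [IsProbabilityMeasure ν], (∀ᵐ x ∂ν, 0 ≤ x) →
      ∀ p : Polynomial ℝ, ∫ x, p.eval (Real.exp (-x)) ∂ν
        = ∑ i ∈ p.support, p.coeff i * lst ν i := by
    intro ν _ hν p
    simp_rw [Polynomial.eval_eq_sum, Polynomial.sum_def]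
    have he : ∀ (i : ℕ) (x : ℝ), Real.exp (-x) ^ i = Real.exp (-(i * x)) := fun i x => by
      rw [← Real.exp_nat_mul]
      ring_nf
    simp_rw [he]
    rw [integral_finsetSum _ fun i _ =>
      (integrable_exp_neg_mul hν i.cast_nonneg).const_mul _]
    simp_rw [integral_const_mul]
    rfl
  have hlst : ∀ i : ℕ, lst ν₁ i = lst ν₂ i := fun i => by
    rcases Nat.eq_zero_or_pos i with rfl | hi
    · simp [lst]
    · exact h i (by exact_mod_cast hi)
  -- Transported to [0, 1] by x ↦ e^{-x}, the transform at the naturals gives the moments.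
  -- Weierstrass approximation then determines all integrals of continuous functions.
  have hmap : ν₁.map (fun x => Real.exp (-x)) = ν₂.map (fun x => Real.exp (-x)) := by
    have := Measure.isProbabilityMeasure_map (μ := ν₁) hu.aemeasurable
    have := Measure.isProbabilityMeasure_map (μ := ν₂) hu.aemeasurable
    refine ext_of_forall_integral_eq_of_IsFiniteMeasure fun f => ?_
    have hfm := f.continuous.measurable
    rw [integral_map hu.aemeasurable hfm.aestronglyMeasurable,
      integral_map hu.aemeasurable hfm.aestronglyMeasurable]
    have hfi : ∀ (ν : Measure ℝ) [IsProbabilityMeasure ν],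
        Integrable (fun x => f (Real.exp (-x))) ν := fun ν _ =>
      Integrable.of_bound (hfm.comp hu).aestronglyMeasurable ‖f‖
        (ae_of_all _ fun x => f.norm_coe_le_norm _)
    refine eq_of_forall_dist_le fun ε hε => ?_
    obtain ⟨p, hp⟩ := exists_polynomial_near_of_continuousOn 0 1 f f.continuous.continuousOn
      (ε / 2) (by linarith)
    have hclose : ∀ (ν : Measure ℝ) [IsProbabilityMeasure ν], (∀ᵐ x ∂ν, 0 ≤ x) →
        |∫ x, f (Real.exp (-x)) ∂ν - ∫ x, p.eval (Real.exp (-x)) ∂ν| ≤ ε / 2 := by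
      intro ν _ hν
      have hae : ∀ᵐ x ∂ν, ‖f (Real.exp (-x)) - p.eval (Real.exp (-x))‖ ≤ ε / 2 := by
        filter_upwards [hν] with x hx
        have := hp (Real.exp (-x)) ⟨(Real.exp_pos _).le, Real.exp_le_one_iff.2 (by linarith)⟩
        rw [Real.norm_eq_abs, abs_sub_comm]
        exact this.le
      have hpi : Integrable (fun x => p.eval (Real.exp (-x))) ν := by
        have hd : Integrable (fun x => f (Real.exp (-x)) - p.eval (Real.exp (-x))) ν :=
          Integrable.of_bound ((hfm.comp hu).sub
            (p.continuous.measurable.comp hu)).aestronglyMeasurable _ hae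
        refine ((hfi ν).sub hd).congr (ae_of_all _ fun x => ?_)
        simp
      rw [← integral_sub (hfi ν) hpi]
      have := norm_integral_le_of_norm_le_const hae
      simpa using this
    have e1 := abs_le.1 (hclose ν₁ h₁)
    have e2 := abs_le.1 (hclose ν₂ h₂)
    rw [hpoly ν₁ h₁] at e1
    rw [hpoly ν₂ h₂] at e2
    simp_rw [hlst] at e1
    rw [Real.dist_eq]
    exact abs_le.2 ⟨by linarith, by linarith⟩
  have hinv : ∀ ν : Measure ℝ, (ν.map fun x => Real.exp (-x)).map (fun y => -Real.log y) = ν := by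
    intro ν
    rw [Measure.map_map (by fun_prop) hu]
    convert! Measure.map_id using 2
    funext x
    simp
  rw [← hinv ν₁, hmap, hinv]

/-! ### Moments and the behaviour of the transform at the origin -/

lemma hasDerivAt_exp_neg (u : ℝ) : HasDerivAt (fun u : ℝ => Real.exp (-u)) (-Real.exp (-u)) u := by
  simpa using (hasDerivAt_neg u).exp

lemma nonneg_of_hasDerivAt_nonneg {f f' : ℝ → ℝ} (hf : ∀ u, HasDerivAt f (f' u) u)
    (hf' : ∀ u, 0 ≤ u → 0 ≤ f' u) (h0 : f 0 = 0) {u : ℝ} (hu : 0 ≤ u) : 0 ≤ f u := by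
  have hmono : MonotoneOn f (Set.Ici 0) := by
    refine monotoneOn_of_deriv_nonneg (convex_Ici 0)
      (fun x _ => (hf x).continuousAt.continuousWithinAt)
      (fun x _ => (hf x).differentiableAt.differentiableWithinAt) fun x hx => ?_
    rw [interior_Ici] at hx
    rw [(hf x).deriv]
    exact hf' x (Set.mem_Ioi.1 hx).le
  rw [← h0]
  exact hmono Set.self_mem_Ici hu hu

lemma exp_neg_taylor_one {u : ℝ} (hu : 0 ≤ u) :
    0 ≤ 1 - Real.exp (-u) ∧ 1 - Real.exp (-u) ≤ u := by
  constructor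
  · rw [sub_nonneg, Real.exp_le_one_iff]
    linarith
  · linarith [Real.add_one_le_exp (-u)]

/-- Each remainder estimate for e^{-u} is the integral of the preceding one, by a sign argument on
the derivative; the next two orders repeat this. -/
lemma exp_neg_taylor_two {u : ℝ} (hu : 0 ≤ u) :
    0 ≤ Real.exp (-u) - 1 + u ∧ Real.exp (-u) - 1 + u ≤ u ^ 2 / 2 := by
  refine ⟨by linarith [Real.add_one_le_exp (-u)], ?_⟩
  have := nonneg_of_hasDerivAt_nonneg (f := fun u => u ^ 2 / 2 - (Real.exp (-u) - 1 + u))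
    (f' := fun u => u - (1 - Real.exp (-u))) (fun u => ?_)
    (fun u hu => by linarith [(exp_neg_taylor_one hu).2]) (by simp) hu
  · linarith
  · have := ((hasDerivAt_pow 2 u).div_const 2).sub
      (((hasDerivAt_exp_neg u).sub_const 1).add (hasDerivAt_id u))
    convert! this using 1
    push_cast
    ring

lemma exp_neg_taylor_three {u : ℝ} (hu : 0 ≤ u) :
    0 ≤ 1 - u + u ^ 2 / 2 - Real.exp (-u) ∧ 1 - u + u ^ 2 / 2 - Real.exp (-u) ≤ u ^ 3 / 6 := by
  refine ⟨by linarith [(exp_neg_taylor_two hu).2], ?_⟩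
  have := nonneg_of_hasDerivAt_nonneg
    (f := fun u => u ^ 3 / 6 - (u ^ 2 / 2 - (Real.exp (-u) - 1 + u)))
    (f' := fun u => u ^ 2 / 2 - (u - (1 - Real.exp (-u)))) (fun u => ?_)
    (fun u hu => by linarith [(exp_neg_taylor_two hu).2]) (by simp) hu
  · linarith
  · have := ((hasDerivAt_pow 3 u).div_const 6).sub (((hasDerivAt_pow 2 u).div_const 2).sub
      (((hasDerivAt_exp_neg u).sub_const 1).add (hasDerivAt_id u)))
    convert! this using 1
    push_cast
    ring

lemma exp_neg_taylor_four {u : ℝ} (hu : 0 ≤ u) :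
    u ^ 3 / 6 - (1 - u + u ^ 2 / 2 - Real.exp (-u)) ≤ u ^ 4 / 24 := by
  have := nonneg_of_hasDerivAt_nonneg
    (f := fun u => u ^ 4 / 24 - (u ^ 3 / 6 - (1 - u + u ^ 2 / 2 - Real.exp (-u))))
    (f' := fun u => u ^ 3 / 6 - (1 - u + u ^ 2 / 2 - Real.exp (-u))) (fun u => ?_)
    (fun u hu => by linarith [(exp_neg_taylor_three hu).2]) (by simp) hu
  · linarith
  · have := ((hasDerivAt_pow 4 u).div_const 24).sub (((hasDerivAt_pow 3 u).div_const 6).sub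
      ((((hasDerivAt_id u).const_sub 1).add ((hasDerivAt_pow 2 u).div_const 2)).sub
        (hasDerivAt_exp_neg u)))
    convert! this using 1
    push_cast
    ring

/-- A function divided by the order of its leading term converges. -/
lemma tendsto_div_pow_of_bound {f : ℝ → ℝ} {a C : ℝ} (n : ℕ)
    (h : ∀ s, 0 < s → |f s - a * s ^ n| ≤ C * s ^ (n + 1)) :
    Tendsto (fun s => f s / s ^ n) (𝓝[>] 0) (𝓝 a) := by
  rw [tendsto_iff_norm_sub_tendsto_zero]
  have hC : Tendsto (fun s : ℝ => C * s) (𝓝[>] 0) (𝓝 0) := by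
    have : Tendsto (fun s : ℝ => C * s) (𝓝 0) (𝓝 (C * 0)) := Continuous.tendsto (by fun_prop) 0
    rw [mul_zero] at this
    exact this.mono_left nhdsWithin_le_nhds
  refine squeeze_zero' (Eventually.of_forall fun s => norm_nonneg _) ?_ hC
  filter_upwards [self_mem_nhdsWithin] with s hs
  have hs0 : (0 : ℝ) < s := hs
  have e : f s / s ^ n - a = (f s - a * s ^ n) / s ^ n := by
    field_simp
  rw [e, Real.norm_eq_abs, abs_div, abs_of_pos (by positivity : 0 < s ^ n),
    div_le_iff₀ (by positivity)]
  exact (h s hs0).trans (le_of_eq (by ring))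

lemma tendsto_exp_neg_taylor_one {x : ℝ} (hx : 0 ≤ x) :
    Tendsto (fun s => (1 - Real.exp (-(s * x))) / s ^ 1) (𝓝[>] 0) (𝓝 x) := by
  refine tendsto_div_pow_of_bound (C := x ^ 2 / 2) 1 fun s hs => ?_
  obtain ⟨h1, h2⟩ := exp_neg_taylor_two (mul_nonneg hs.le hx)
  rw [abs_le]
  constructor <;> nlinarith

lemma tendsto_exp_neg_taylor_two {x : ℝ} (hx : 0 ≤ x) :
    Tendsto (fun s => (Real.exp (-(s * x)) - 1 + s * x) / s ^ 2) (𝓝[>] 0) (𝓝 (x ^ 2 / 2)) := by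
  refine tendsto_div_pow_of_bound (C := x ^ 3 / 6) 2 fun s hs => ?_
  obtain ⟨h1, h2⟩ := exp_neg_taylor_three (mul_nonneg hs.le hx)
  rw [abs_le]
  constructor <;> nlinarith

lemma tendsto_exp_neg_taylor_three {x : ℝ} (hx : 0 ≤ x) :
    Tendsto (fun s => (1 - s * x + (s * x) ^ 2 / 2 - Real.exp (-(s * x))) / s ^ 3) (𝓝[>] 0)
      (𝓝 (x ^ 3 / 6)) := by
  refine tendsto_div_pow_of_bound (C := x ^ 4 / 24) 3 fun s hs => ?_
  have h1 := (exp_neg_taylor_three (mul_nonneg hs.le hx)).2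
  have h2 := exp_neg_taylor_four (mul_nonneg hs.le hx)
  rw [abs_le]
  constructor <;> nlinarith

/-- Functions that increase to a limit function have integrals that determine its integral. -/
lemma integrable_and_integral_eq_of_tendsto {α : Type*} [MeasurableSpace α] {μ : Measure α}
    {F : ℕ → α → ℝ} {f : α → ℝ} {c : ℝ} (hF : ∀ n, Integrable (F n) μ)
    (hf : AEStronglyMeasurable f μ) (h0 : ∀ n, ∀ᵐ x ∂μ, 0 ≤ F n x)
    (hle : ∀ n, ∀ᵐ x ∂μ, F n x ≤ f x)
    (hlim : ∀ᵐ x ∂μ, Tendsto (fun n => F n x) atTop (𝓝 (f x)))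
    (hc : Tendsto (fun n => ∫ x, F n x ∂μ) atTop (𝓝 c)) : Integrable f μ ∧ ∫ x, f x ∂μ = c := by
  have hnn : ∀ᵐ x ∂μ, 0 ≤ f x := by
    filter_upwards [h0 0, hle 0] with x h1 h2 using h1.trans h2
  -- Integrability of the limit is not assumed but derived from the convergent integrals by Fatou.
  -- The limit then dominates the sequence itself.
  have hfatou : ∫⁻ x, ENNReal.ofReal (f x) ∂μ ≤ ENNReal.ofReal c := by
    calc ∫⁻ x, ENNReal.ofReal (f x) ∂μ
        = ∫⁻ x, liminf (fun n => ENNReal.ofReal (F n x)) atTop ∂μ := by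
          refine lintegral_congr_ae ?_
          filter_upwards [hlim] with x hx
          exact ((ENNReal.continuous_ofReal.tendsto _).comp hx).liminf_eq.symm
      _ ≤ liminf (fun n => ∫⁻ x, ENNReal.ofReal (F n x) ∂μ) atTop :=
          lintegral_liminf_le' fun n => (hF n).aestronglyMeasurable.aemeasurable.ennreal_ofReal
      _ = ENNReal.ofReal c := by
          simp_rw [← ofReal_integral_eq_lintegral_ofReal (hF _) (h0 _)]
          exact ((ENNReal.continuous_ofReal.tendsto _).comp hc).liminf_eq
  have hint : Integrable f μ := by
    refine ⟨hf, ?_⟩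
    rw [hasFiniteIntegral_iff_ofReal hnn]
    exact hfatou.trans_lt ENNReal.ofReal_lt_top
  refine ⟨hint, tendsto_nhds_unique ?_ hc⟩
  refine tendsto_integral_of_dominated_convergence f (fun n => (hF n).aestronglyMeasurable) hint
    (fun n => ?_) hlim
  filter_upwards [h0 n, hle n] with x h1 h2
  rwa [Real.norm_eq_abs, abs_of_nonneg h1]

/-- A normalized Taylor kernel: `K s` increases to `f` as `s` decreases to `0`. -/
lemma tendsto_integral_kernel {ν : Measure ℝ} {K : ℝ → ℝ → ℝ} {f : ℝ → ℝ}
    (hK : ∀ s, AEStronglyMeasurable (K s) ν) (hf : Integrable f ν)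
    (h : ∀ᵐ x ∂ν, ∀ s, 0 < s → 0 ≤ K s x ∧ K s x ≤ f x)
    (hlim : ∀ᵐ x ∂ν, Tendsto (fun s => K s x) (𝓝[>] 0) (𝓝 (f x))) :
    Tendsto (fun s => ∫ x, K s x ∂ν) (𝓝[>] 0) (𝓝 (∫ x, f x ∂ν)) := by
  refine tendsto_integral_filter_of_dominated_convergence f (Eventually.of_forall hK) ?_ hf hlim
  filter_upwards [self_mem_nhdsWithin] with s hs
  filter_upwards [h] with x hx
  obtain ⟨h1, h2⟩ := hx s hs
  rwa [Real.norm_eq_abs, abs_of_nonneg h1]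

lemma exists_pos_seq_tendsto_zero :
    ∃ u : ℕ → ℝ, (∀ n, 0 < u n) ∧ Tendsto u atTop (𝓝[>] 0) := by
  refine ⟨fun n => 1 / ((n : ℝ) + 1), fun n => by positivity, ?_⟩
  refine tendsto_nhdsWithin_iff.2 ⟨tendsto_one_div_add_atTop_nhds_zero_nat, ?_⟩
  exact Eventually.of_forall fun n => by
    simp only [Set.mem_Ioi]
    positivity

section

variable {ν : Measure ℝ} [IsProbabilityMeasure ν]

lemma taylor_kernel_one_bounds {s x : ℝ} (hs : 0 < s) (hx : 0 ≤ x) :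
    0 ≤ (1 - Real.exp (-(s * x))) / s ^ 1 ∧ (1 - Real.exp (-(s * x))) / s ^ 1 ≤ x := by
  obtain ⟨h1, h2⟩ := exp_neg_taylor_one (mul_nonneg hs.le hx)
  refine ⟨by positivity, ?_⟩
  rw [div_le_iff₀ (by positivity)]
  linarith

lemma taylor_kernel_two_bounds {s x : ℝ} (hs : 0 < s) (hx : 0 ≤ x) :
    0 ≤ (Real.exp (-(s * x)) - 1 + s * x) / s ^ 2 ∧
      (Real.exp (-(s * x)) - 1 + s * x) / s ^ 2 ≤ x ^ 2 / 2 := by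
  obtain ⟨h1, h2⟩ := exp_neg_taylor_two (mul_nonneg hs.le hx)
  refine ⟨by positivity, ?_⟩
  rw [div_le_iff₀ (by positivity)]
  linarith

lemma taylor_kernel_three_bounds {s x : ℝ} (hs : 0 < s) (hx : 0 ≤ x) :
    0 ≤ (1 - s * x + (s * x) ^ 2 / 2 - Real.exp (-(s * x))) / s ^ 3 ∧
      (1 - s * x + (s * x) ^ 2 / 2 - Real.exp (-(s * x))) / s ^ 3 ≤ x ^ 3 / 6 := by
  obtain ⟨h1, h2⟩ := exp_neg_taylor_three (mul_nonneg hs.le hx)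
  refine ⟨by positivity, ?_⟩
  rw [div_le_iff₀ (by positivity)]
  linarith

lemma integral_kernel_one (hν : ∀ᵐ x ∂ν, 0 ≤ x) {s : ℝ} (hs : 0 < s) :
    Integrable (fun x => (1 - Real.exp (-(s * x))) / s ^ 1) ν ∧
      ∫ x, (1 - Real.exp (-(s * x))) / s ^ 1 ∂ν = (1 - lst ν s) / s := by
  have hi := integrable_exp_neg_mul hν hs.le
  refine ⟨((integrable_const _).sub hi).div_const _, ?_⟩
  rw [integral_div, integral_sub (integrable_const _) hi]
  simp [lst]

/-- The nested quotient is the form in which the queueing identities are divided by `s` repeatedly,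
so their limits can be read off by algebra. -/
lemma integral_kernel_two (hν : ∀ᵐ x ∂ν, 0 ≤ x) (h1 : Integrable (fun x : ℝ => x) ν) {s : ℝ}
    (hs : 0 < s) :
    Integrable (fun x => (Real.exp (-(s * x)) - 1 + s * x) / s ^ 2) ν ∧
      ∫ x, (Real.exp (-(s * x)) - 1 + s * x) / s ^ 2 ∂ν
        = (∫ x, x ∂ν - (1 - lst ν s) / s) / s := by
  have hi := integrable_exp_neg_mul hν hs.le
  have hi' : Integrable (fun x => Real.exp (-(s * x)) - 1) ν := hi.sub (integrable_const _)
  refine ⟨(hi'.add (h1.const_mul s)).div_const _, ?_⟩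
  rw [integral_div, integral_add hi' (h1.const_mul s), integral_sub hi (integrable_const _),
    integral_const_mul]
  simp only [lst, integral_const, probReal_univ, smul_eq_mul, mul_one]
  field_simp
  ring

lemma integral_kernel_three (hν : ∀ᵐ x ∂ν, 0 ≤ x) (h1 : Integrable (fun x : ℝ => x) ν)
    (h2 : Integrable (fun x : ℝ => x ^ 2) ν) {s : ℝ} (hs : 0 < s) :
    ∫ x, (1 - s * x + (s * x) ^ 2 / 2 - Real.exp (-(s * x))) / s ^ 3 ∂ν
      = ((∫ x, x ^ 2 ∂ν) / 2 - (∫ x, x ∂ν - (1 - lst ν s) / s) / s) / s := by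
  have hi := integrable_exp_neg_mul hν hs.le
  have ha : Integrable (fun x => 1 - s * x) ν := (integrable_const _).sub (h1.const_mul s)
  have hb : Integrable (fun x => (s * x) ^ 2 / 2) ν := by
    refine (h2.const_mul (s ^ 2 / 2)).congr (ae_of_all _ fun x => ?_)
    simp only
    ring
  have hbv : ∫ x, (s * x) ^ 2 / 2 ∂ν = s ^ 2 / 2 * ∫ x, x ^ 2 ∂ν := by
    rw [← integral_const_mul]
    congr 1
    funext x
    ring
  have hab : Integrable (fun x => 1 - s * x + (s * x) ^ 2 / 2) ν := ha.add hb
  rw [integral_div, integral_sub hab hi, integral_add ha hb, hbv,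
    integral_sub (integrable_const _) (h1.const_mul s), integral_const_mul]
  simp only [lst, integral_const, probReal_univ, smul_eq_mul, mul_one]
  field_simp
  ring

/-- The first moment is the limit of the difference quotients of the transform. -/
lemma tendsto_first_moment (hν : ∀ᵐ x ∂ν, 0 ≤ x) (h1 : Integrable (fun x : ℝ => x) ν) :
    Tendsto (fun s => (1 - lst ν s) / s) (𝓝[>] 0) (𝓝 (∫ x, x ∂ν)) := by
  have h := tendsto_integral_kernel (ν := ν) (K := fun s x => (1 - Real.exp (-(s * x))) / s ^ 1)
    (fun s => by fun_prop) h1 (hν.mono fun x hx s hs => taylor_kernel_one_bounds hs hx)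
    (hν.mono fun x hx => tendsto_exp_neg_taylor_one hx)
  refine h.congr' ?_
  filter_upwards [self_mem_nhdsWithin] with s hs using (integral_kernel_one hν hs).2

lemma tendsto_second_moment (hν : ∀ᵐ x ∂ν, 0 ≤ x) (h1 : Integrable (fun x : ℝ => x) ν)
    (h2 : Integrable (fun x : ℝ => x ^ 2) ν) :
    Tendsto (fun s => (∫ x, x ∂ν - (1 - lst ν s) / s) / s) (𝓝[>] 0) (𝓝 ((∫ x, x ^ 2 ∂ν) / 2)) := by
  have h := tendsto_integral_kernel (ν := ν)
    (K := fun s x => (Real.exp (-(s * x)) - 1 + s * x) / s ^ 2)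
    (fun s => by fun_prop) (h2.div_const 2)
    (hν.mono fun x hx s hs => taylor_kernel_two_bounds hs hx)
    (hν.mono fun x hx => tendsto_exp_neg_taylor_two hx)
  rw [integral_div] at h
  refine h.congr' ?_
  filter_upwards [self_mem_nhdsWithin] with s hs using (integral_kernel_two hν h1 hs).2

lemma tendsto_third_moment (hν : ∀ᵐ x ∂ν, 0 ≤ x) (h1 : Integrable (fun x : ℝ => x) ν)
    (h2 : Integrable (fun x : ℝ => x ^ 2) ν) (h3 : Integrable (fun x : ℝ => x ^ 3) ν) :
    Tendsto (fun s => ((∫ x, x ^ 2 ∂ν) / 2 - (∫ x, x ∂ν - (1 - lst ν s) / s) / s) / s) (𝓝[>] 0)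
      (𝓝 ((∫ x, x ^ 3 ∂ν) / 6)) := by
  have h := tendsto_integral_kernel (ν := ν)
    (K := fun s x => (1 - s * x + (s * x) ^ 2 / 2 - Real.exp (-(s * x))) / s ^ 3)
    (fun s => by fun_prop) (h3.div_const 6)
    (hν.mono fun x hx s hs => taylor_kernel_three_bounds hs hx)
    (hν.mono fun x hx => tendsto_exp_neg_taylor_three hx)
  rw [integral_div] at h
  refine h.congr' ?_
  filter_upwards [self_mem_nhdsWithin] with s hs using integral_kernel_three hν h1 h2 hs

/-- A limit of the difference quotients of the transform is the first moment. -/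
lemma first_moment_of_tendsto (hν : ∀ᵐ x ∂ν, 0 ≤ x) {c : ℝ}
    (h : Tendsto (fun s => (1 - lst ν s) / s) (𝓝[>] 0) (𝓝 c)) :
    Integrable (fun x : ℝ => x) ν ∧ ∫ x, x ∂ν = c := by
  obtain ⟨u, hu, hulim⟩ := exists_pos_seq_tendsto_zero
  refine integrable_and_integral_eq_of_tendsto
    (F := fun n x => (1 - Real.exp (-(u n * x))) / u n ^ 1)
    (fun n => (integral_kernel_one hν (hu n)).1) (by fun_prop)
    (fun n => hν.mono fun x hx => (taylor_kernel_one_bounds (hu n) hx).1)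
    (fun n => hν.mono fun x hx => (taylor_kernel_one_bounds (hu n) hx).2)
    (hν.mono fun x hx => (tendsto_exp_neg_taylor_one hx).comp hulim) ?_
  exact (h.comp hulim).congr fun n => (integral_kernel_one hν (hu n)).2.symm

/-- Fatou for the second Taylor kernel yields finiteness along with the value; the factor 2 undoes
the x²/2 in the kernel's limit. -/
lemma second_moment_of_tendsto (hν : ∀ᵐ x ∂ν, 0 ≤ x) (h1 : Integrable (fun x : ℝ => x) ν) {c : ℝ}
    (h : Tendsto (fun s => (∫ x, x ∂ν - (1 - lst ν s) / s) / s) (𝓝[>] 0) (𝓝 c)) :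
    Integrable (fun x : ℝ => x ^ 2) ν ∧ ∫ x, x ^ 2 ∂ν = 2 * c := by
  obtain ⟨u, hu, hulim⟩ := exists_pos_seq_tendsto_zero
  have key := integrable_and_integral_eq_of_tendsto
    (F := fun n x => (Real.exp (-(u n * x)) - 1 + u n * x) / u n ^ 2) (f := fun x => x ^ 2 / 2)
    (fun n => (integral_kernel_two hν h1 (hu n)).1) (by fun_prop)
    (fun n => hν.mono fun x hx => (taylor_kernel_two_bounds (hu n) hx).1)
    (fun n => hν.mono fun x hx => (taylor_kernel_two_bounds (hu n) hx).2)
    (hν.mono fun x hx => (tendsto_exp_neg_taylor_two hx).comp hulim)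
    ((h.comp hulim).congr fun n => (integral_kernel_two hν h1 (hu n)).2.symm)
  refine ⟨(key.1.const_mul 2).congr (ae_of_all _ fun x => ?_), ?_⟩
  · simp only
    ring
  · have := key.2
    rw [integral_div] at this
    linarith

/-- The second difference quotients of the transform converge to its second derivative. -/
lemma tendsto_lst_second_order (hν : ∀ᵐ x ∂ν, 0 ≤ x) {k : ℝ} (hk : 0 < k) :
    Tendsto (fun s => ((lst ν (k + s) - lst ν k) / s - iteratedDeriv 1 (lst ν) k) / s) (𝓝[>] 0)
      (𝓝 (iteratedDeriv 2 (lst ν) k / 2)) := by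
  have hi : ∀ n : ℕ, Integrable (fun x => x ^ n * Real.exp (-(k * x))) ν :=
    integrable_pow_mul_exp_neg hν hk
  have h := tendsto_integral_kernel (ν := ν)
    (K := fun s x => Real.exp (-(k * x)) * ((Real.exp (-(s * x)) - 1 + s * x) / s ^ 2))
    (f := fun x => Real.exp (-(k * x)) * (x ^ 2 / 2)) (fun s => by fun_prop)
    (((hi 2).div_const 2).congr (ae_of_all _ fun x => by ring))
    (hν.mono fun x hx s hs => by
      obtain ⟨h1, h2⟩ := taylor_kernel_two_bounds hs hx
      exact ⟨by positivity, by gcongr⟩)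
    (hν.mono fun x hx => (tendsto_exp_neg_taylor_two hx).const_mul _)
  have hv : ∫ x, Real.exp (-(k * x)) * (x ^ 2 / 2) ∂ν = iteratedDeriv 2 (lst ν) k / 2 := by
    rw [iteratedDeriv_lst hν hk, ← integral_const_mul, ← integral_div]
    congr 1
    funext x
    ring
  rw [hv] at h
  refine h.congr' ?_
  filter_upwards [self_mem_nhdsWithin] with s hs
  have hs0 : (0 : ℝ) < s := hs
  have e : ∀ x, Real.exp (-(k * x)) * ((Real.exp (-(s * x)) - 1 + s * x) / s ^ 2)
      = (Real.exp (-((k + s) * x)) - Real.exp (-(k * x))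
        + s * (x ^ 1 * Real.exp (-(k * x)))) / s ^ 2 := fun x => by
    rw [show -((k + s) * x) = -(k * x) + -(s * x) by ring, Real.exp_add]
    ring
  have ha := integrable_exp_neg_mul hν (add_pos hk hs0).le
  have hb := integrable_exp_neg_mul hν hk.le
  have hab : Integrable (fun x => Real.exp (-((k + s) * x)) - Real.exp (-(k * x))) ν := ha.sub hb
  simp_rw [e]
  rw [integral_div, integral_add hab ((hi 1).const_mul s), integral_sub ha hb,
    integral_const_mul, iteratedDeriv_lst hν hk]
  simp only [lst]
  field_simp
  ring

end

/-! ### Integrals against exponential laws -/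

lemma measurable_exponentialPDF (r : ℝ) : Measurable (exponentialPDF r) :=
  (measurable_exponentialPDFReal r).ennreal_ofReal

lemma ae_nonneg_expMeasure (r : ℝ) : ∀ᵐ x ∂(expMeasure r), 0 ≤ x := by
  change ∀ᵐ x ∂(volume.withDensity (exponentialPDF r)), 0 ≤ x
  rw [ae_withDensity_iff (measurable_exponentialPDF r)]
  refine ae_of_all _ fun x hx => ?_
  by_contra h
  exact hx (exponentialPDF_of_neg (not_le.mp h))

lemma integral_expMeasure {r : ℝ} (hr : 0 < r) (f : ℝ → ℝ) :
    ∫ y, f y ∂(expMeasure r) = ∫ y in Set.Ioi 0, r * Real.exp (-(r * y)) * f y := by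
  change ∫ y, f y ∂(volume.withDensity (exponentialPDF r)) = _
  rw [integral_withDensity_eq_integral_toReal_smul
    (measurable_exponentialPDF r) (ae_of_all _ fun _ => ENNReal.ofReal_lt_top),
    ← integral_Ici_eq_integral_Ioi, ← integral_indicator measurableSet_Ici]
  congr 1
  funext y
  by_cases hy : 0 ≤ y
  · rw [Set.indicator_of_mem (Set.mem_Ici.mpr hy), exponentialPDF_of_nonneg hy,
      ENNReal.toReal_ofReal (by positivity), smul_eq_mul]
  · rw [Set.indicator_of_notMem (by simpa using hy), exponentialPDF_of_neg (not_le.mp hy)]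
    simp

/-- The integral of a function with two branches, through antiderivatives of the branches. -/
lemma integral_expMeasure_of_hasDerivAt {r d l : ℝ} (hr : 0 < r) (hd : 0 ≤ d)
    {f a b A B : ℝ → ℝ} (ha : Continuous a) (hb : ∀ y, d < y → 0 ≤ b y)
    (hfa : ∀ y, 0 < y → y ≤ d → f y = a y) (hfb : ∀ y, d < y → f y = b y)
    (hA : ∀ y, HasDerivAt A (r * Real.exp (-(r * y)) * a y) y)
    (hB : ∀ y, HasDerivAt B (r * Real.exp (-(r * y)) * b y) y)
    (hl : Tendsto B atTop (𝓝 l)) :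
    ∫ y, f y ∂(expMeasure r) = (A d - A 0) + (l - B d) := by
  have hpos : ∀ y ∈ Set.Ioi d, 0 ≤ r * Real.exp (-(r * y)) * b y := fun y hy =>
    mul_nonneg (mul_nonneg hr.le (Real.exp_pos _).le) (hb y hy)
  have hac : Continuous fun y => r * Real.exp (-(r * y)) * a y := by fun_prop
  have hi1 : IntegrableOn (fun y => r * Real.exp (-(r * y)) * f y) (Set.Ioc 0 d) := by
    refine IntegrableOn.congr_fun (f := fun y => r * Real.exp (-(r * y)) * a y)
      (hac.integrableOn_Ioc) (fun y hy => ?_) measurableSet_Ioc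
    simp only [hfa y hy.1 hy.2]
  -- On the unbounded branch a nonnegative derivative of a convergent function is integrable, which
  -- is why only `b` needs a sign.
  have hi2 : IntegrableOn (fun y => r * Real.exp (-(r * y)) * f y) (Set.Ioi d) := by
    refine IntegrableOn.congr_fun (f := fun y => r * Real.exp (-(r * y)) * b y)
      (integrableOn_Ioi_deriv_of_nonneg' (fun y _ => hB y) hpos hl) (fun y hy => ?_)
      measurableSet_Ioi
    simp only [hfb y hy]
  rw [integral_expMeasure hr, ← Set.Ioc_union_Ioi_eq_Ioi hd,
    setIntegral_union (Set.Ioc_disjoint_Ioi le_rfl) measurableSet_Ioi hi1 hi2]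
  congr 1
  · rw [← intervalIntegral.integral_eq_sub_of_hasDerivAt (fun y _ => hA y)
      (hac.intervalIntegrable _ _), intervalIntegral.integral_of_le hd]
    exact setIntegral_congr_fun measurableSet_Ioc fun y hy => by simp only [hfa y hy.1 hy.2]
  · rw [← integral_Ioi_of_hasDerivAt_of_nonneg' (fun y _ => hB y) hpos hl]
    exact setIntegral_congr_fun measurableSet_Ioi fun y hy => by simp only [hfb y hy]

lemma hasDerivAt_exp_mul (c y : ℝ) :
    HasDerivAt (fun y => Real.exp (c * y)) (Real.exp (c * y) * c) y := by
  simpa using ((hasDerivAt_id y).const_mul c).exp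

lemma tendsto_exp_neg_mul_atTop {c : ℝ} (hc : 0 < c) :
    Tendsto (fun y => Real.exp (-c * y)) atTop (𝓝 0) :=
  Real.tendsto_exp_atBot.comp (tendsto_id.const_mul_atTop_of_neg (neg_neg_of_pos hc))

lemma integral_exp_neg_max_expMeasure {r s d : ℝ} (hr : 0 < r) (hs : 0 ≤ s) (hd : 0 ≤ d) :
    ∫ y, Real.exp (-(s * max d y)) ∂(expMeasure r)
      = Real.exp (-(s * d)) - s / (r + s) * Real.exp (-((r + s) * d)) := by
  have hrs : 0 < r + s := by linarith
  rw [integral_expMeasure_of_hasDerivAt (l := -(r / (r + s)) * 0) hr hd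
    (a := fun _ => Real.exp (-(s * d))) (b := fun y => Real.exp (-(s * y)))
    (A := fun y => -Real.exp (-(s * d)) * Real.exp (-r * y))
    (B := fun y => -(r / (r + s)) * Real.exp (-(r + s) * y)) (by fun_prop)
    (fun y _ => (Real.exp_pos _).le) (fun y _ hy => by rw [max_eq_left hy])
    (fun y hy => by rw [max_eq_right hy.le])
    (fun y => ((hasDerivAt_exp_mul (-r) y).const_mul _).congr_deriv (by ring_nf))
    (fun y => ((hasDerivAt_exp_mul (-(r + s)) y).const_mul _).congr_deriv ?_)
    ((tendsto_exp_neg_mul_atTop hrs).const_mul _)]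
  · rw [show -((r + s) * d) = -r * d + -(s * d) by ring, show -(r + s) * d = -r * d + -(s * d) by ring,
      Real.exp_add]
    simp only [mul_zero, Real.exp_zero]
    field_simp
    ring
  · rw [show -(r + s) * y = -(r * y) + -(s * y) by ring, Real.exp_add]
    field_simp

/-- At `s = r` the antiderivative of the first branch degenerates; the use in the Poisson case
treats this argument separately. -/
lemma integral_exp_neg_max_sub_expMeasure {r s d : ℝ} (hr : 0 < r) (hrs : s ≠ r) (hd : 0 ≤ d) :
    ∫ y, Real.exp (-(s * max 0 (d - y))) ∂(expMeasure r)
      = (s * Real.exp (-(r * d)) - r * Real.exp (-(s * d))) / (s - r) := by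
  have hrs' : s - r ≠ 0 := sub_ne_zero.mpr hrs
  rw [integral_expMeasure_of_hasDerivAt (l := -1 * 0) hr hd
    (a := fun y => Real.exp (-(s * (d - y)))) (b := fun y => 1)
    (A := fun y => r / (s - r) * Real.exp (-(s * d)) * Real.exp ((s - r) * y))
    (B := fun y => -1 * Real.exp (-r * y)) (by fun_prop)
    (fun y _ => zero_le_one) (fun y _ hy => by rw [max_eq_right (by linarith)])
    (fun y hy => by rw [max_eq_left (by linarith)]; simp)
    (fun y => ((hasDerivAt_exp_mul (s - r) y).const_mul _).congr_deriv ?_)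
    (fun y => ((hasDerivAt_exp_mul (-r) y).const_mul _).congr_deriv (by ring_nf))
    ((tendsto_exp_neg_mul_atTop hr).const_mul _)]
  · rw [show -r * d = -(r * d) by ring, show (s - r) * d = s * d + -(r * d) by ring, Real.exp_add]
    have h : Real.exp (-(s * d)) * Real.exp (s * d) = 1 := by
      rw [← Real.exp_add, neg_add_cancel, Real.exp_zero]
    simp only [mul_zero, Real.exp_zero]
    field_simp
    linear_combination r * Real.exp (-(r * d)) * h
  · rw [show (s - r) * y = -(r * y) + s * y by ring, show -(s * (d - y)) = -(s * d) + s * y by ring,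
      Real.exp_add, Real.exp_add]
    field_simp

lemma integral_min_expMeasure {r d : ℝ} (hr : 0 < r) (hd : 0 ≤ d) :
    ∫ y, min d y ∂(expMeasure r) = (1 - Real.exp (-(r * d))) / r := by
  rw [integral_expMeasure_of_hasDerivAt (l := -d * 0) hr hd
    (a := fun y => y) (b := fun y => d)
    (A := fun y => (-y - 1 / r) * Real.exp (-r * y))
    (B := fun y => -d * Real.exp (-r * y)) (by fun_prop)
    (fun y _ => hd) (fun y _ hy => by rw [min_eq_right hy])
    (fun y hy => by rw [min_eq_left hy.le])
    (fun y => ((((hasDerivAt_id y).neg.sub_const _).mul (hasDerivAt_exp_mul (-r) y))).congr_deriv ?_)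
    (fun y => ((hasDerivAt_exp_mul (-r) y).const_mul _).congr_deriv (by ring_nf))
    ((tendsto_exp_neg_mul_atTop hr).const_mul _)]
  · rw [show -r * d = -(r * d) by ring]
    simp only [mul_zero, Real.exp_zero]
    field_simp
    ring
  · rw [show -r * y = -(r * y) by ring]
    simp
    field_simp
    ring

lemma lst_expMeasure {r s : ℝ} (hr : 0 < r) (hs : 0 ≤ s) : lst (expMeasure r) s = r / (r + s) := by
  have h := integral_exp_neg_max_expMeasure hr hs le_rfl
  have hrs : r + s ≠ 0 := by linarith
  calc lst (expMeasure r) s = ∫ y, Real.exp (-(s * max 0 y)) ∂(expMeasure r) :=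
        integral_congr_ae ((ae_nonneg_expMeasure r).mono fun y hy => by
          simp only [max_eq_right hy])
    _ = _ := by
        rw [h]
        simp only [mul_zero, neg_zero, Real.exp_zero]
        field_simp
        ring

lemma integral_exp_neg_max_sub_expMeasure' {r s g : ℝ} (hr : 0 < r) (hs : 0 ≤ s) (hg : 0 ≤ g) :
    ∫ y, Real.exp (-(s * max 0 (y - g))) ∂(expMeasure r)
      = 1 - s / (r + s) * Real.exp (-(r * g)) := by
  have e : ∀ y, Real.exp (-(s * max 0 (y - g))) = Real.exp (s * g) * Real.exp (-(s * max g y)) := by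
    intro y
    rw [← Real.exp_add, show max 0 (y - g) = max g y - g by rw [← max_sub_sub_right, sub_self]]
    congr 1
    ring
  simp_rw [e]
  rw [integral_const_mul, integral_exp_neg_max_expMeasure hr hs hg,
    show -((r + s) * g) = -(r * g) + -(s * g) by ring, Real.exp_add]
  have h : Real.exp (s * g) * Real.exp (-(s * g)) = 1 := by
    rw [← Real.exp_add, add_neg_cancel, Real.exp_zero]
  linear_combination (1 - s / (r + s) * Real.exp (-(r * g))) * h

lemma integral_id_expMeasure {r : ℝ} (hr : 0 < r) : ∫ x, x ∂(expMeasure r) = 1 / r := by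
  have := isProbabilityMeasure_expMeasure hr
  refine (first_moment_of_tendsto (ae_nonneg_expMeasure r) ?_).2
  have hc : Tendsto (fun s : ℝ => 1 / (r + s)) (𝓝[>] 0) (𝓝 (1 / (r + 0))) :=
    tendsto_nhdsWithin_of_tendsto_nhds (ContinuousAt.tendsto (f := fun s : ℝ => 1 / (r + s))
      (by fun_prop (disch := simp [hr.ne'])))
  rw [add_zero] at hc
  refine hc.congr' ?_
  filter_upwards [self_mem_nhdsWithin] with s hs
  have hs' : 0 < s := hs
  rw [lst_expMeasure hr hs'.le]
  field_simp
  ring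

/-! ### The transforms of the delay and of the peak age -/

section

variable {νG νH ν : Measure ℝ} [IsProbabilityMeasure νG] [IsProbabilityMeasure νH]
  [IsProbabilityMeasure ν]

/-- The service time is independent of the delay and the interarrival time, and it enters the next
delay and the peak age additively; so its transform splits off in both. -/
lemma integral_mul_exp_neg_prod (φ : ℝ × ℝ → ℝ) (s : ℝ) :
    ∫ q : ℝ × (ℝ × ℝ), φ (q.1, q.2.1) * Real.exp (-(s * q.2.2)) ∂(ν.prod (νG.prod νH))
      = (∫ q, φ q ∂(ν.prod νG)) * lst νH s := by
  rw [lst, ← integral_prod_mul φ (fun x => Real.exp (-(s * x))), ← Measure.prodAssoc_prod,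
    integral_map_equiv]
  rfl

lemma lst_map_lindleyStep (s : ℝ) :
    lst ((ν.prod (νG.prod νH)).map fun q => lindleyStep q.1 q.2) s
      = (∫ q, Real.exp (-(s * max 0 (q.1 - q.2))) ∂(ν.prod νG)) * lst νH s := by
  rw [← integral_mul_exp_neg_prod (fun q => Real.exp (-(s * max 0 (q.1 - q.2)))), lst,
    integral_map (by simp only [lindleyStep]; fun_prop) (by fun_prop)]
  refine integral_congr_ae (ae_of_all _ fun q => ?_)
  simp only [lindleyStep]
  rw [← Real.exp_add]
  congr 1
  ring

lemma IsStationaryDelay.lst_eq (hν : IsStationaryDelay (νG.prod νH) ν) (s : ℝ) :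
    lst ν s = (∫ q, Real.exp (-(s * max 0 (q.1 - q.2))) ∂(ν.prod νG)) * lst νH s := by
  rw [← lst_map_lindleyStep, hν]

lemma integral_exp_neg_peakAge (s : ℝ) :
    ∫ q, Real.exp (-(s * peakAge q.1 q.2)) ∂(ν.prod (νG.prod νH))
      = (∫ q, Real.exp (-(s * max q.1 q.2)) ∂(ν.prod νG)) * lst νH s := by
  rw [← integral_mul_exp_neg_prod (fun q => Real.exp (-(s * max q.1 q.2)))]
  refine integral_congr_ae (ae_of_all _ fun q => ?_)
  simp only [peakAge]
  rw [← Real.exp_add]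
  congr 1
  ring

lemma integrable_exp_neg_of_nonneg {α : Type*} [MeasurableSpace α] {π : Measure α}
    [IsProbabilityMeasure π] {φ : α → ℝ} (hφ : Measurable φ) (h0 : ∀ᵐ q ∂π, 0 ≤ φ q) {s : ℝ}
    (hs : 0 ≤ s) : Integrable (fun q => Real.exp (-(s * φ q))) π := by
  refine Integrable.of_bound (by fun_prop) 1 ?_
  filter_upwards [h0] with q hq
  rw [Real.norm_eq_abs, Real.abs_exp, Real.exp_le_one_iff]
  nlinarith [mul_nonneg hs hq]

lemma integrable_exp_neg_max_sub {s : ℝ} (hs : 0 ≤ s) :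
    Integrable (fun q : ℝ × ℝ => Real.exp (-(s * max 0 (q.1 - q.2)))) (ν.prod νG) :=
  integrable_exp_neg_of_nonneg (by fun_prop) (ae_of_all _ fun _ => le_max_left _ _) hs

lemma integrable_exp_neg_max (hν : ∀ᵐ x ∂ν, 0 ≤ x) {s : ℝ} (hs : 0 ≤ s) :
    Integrable (fun q : ℝ × ℝ => Real.exp (-(s * max q.1 q.2))) (ν.prod νG) :=
  integrable_exp_neg_of_nonneg (by fun_prop)
    ((Measure.quasiMeasurePreserving_fst.ae hν).mono fun _ h => le_max_of_le_left h) hs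

end

section

variable {r : ℝ} {ν : Measure ℝ} [IsProbabilityMeasure ν]

lemma integral_exp_neg_max_sub_prod_expMeasure (hr : 0 < r) (hν : ∀ᵐ x ∂ν, 0 ≤ x) {s : ℝ}
    (hs : 0 ≤ s) (hsr : s ≠ r) :
    ∫ q, Real.exp (-(s * max 0 (q.1 - q.2))) ∂(ν.prod (expMeasure r))
      = (s * lst ν r - r * lst ν s) / (s - r) := by
  have := isProbabilityMeasure_expMeasure hr
  rw [integral_prod _ (integrable_exp_neg_max_sub hs), lst, lst, ← integral_const_mul,
    ← integral_const_mul, ← integral_sub ((integrable_exp_neg_mul hν hr.le).const_mul _)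
      ((integrable_exp_neg_mul hν hs).const_mul _), ← integral_div]
  exact integral_congr_ae (hν.mono fun x hx => integral_exp_neg_max_sub_expMeasure hr hsr hx)

lemma integral_exp_neg_max_prod_expMeasure (hr : 0 < r) (hν : ∀ᵐ x ∂ν, 0 ≤ x) {s : ℝ}
    (hs : 0 ≤ s) :
    ∫ q, Real.exp (-(s * max q.1 q.2)) ∂(ν.prod (expMeasure r))
      = lst ν s - s / (r + s) * lst ν (r + s) := by
  have := isProbabilityMeasure_expMeasure hr
  rw [integral_prod _ (integrable_exp_neg_max hν hs), lst, lst, ← integral_const_mul,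
    ← integral_sub (integrable_exp_neg_mul hν hs)
      ((integrable_exp_neg_mul hν (by linarith)).const_mul _)]
  exact integral_congr_ae (hν.mono fun x hx => integral_exp_neg_max_expMeasure hr hs hx)

lemma integral_exp_neg_max_sub_expMeasure_prod (hr : 0 < r) (hν : ∀ᵐ x ∂ν, 0 ≤ x) {s : ℝ}
    (hs : 0 ≤ s) :
    ∫ q, Real.exp (-(s * max 0 (q.1 - q.2))) ∂((expMeasure r).prod ν)
      = 1 - s / (r + s) * lst ν r := by
  have := isProbabilityMeasure_expMeasure hr
  rw [integral_prod_symm _ (integrable_exp_neg_max_sub hs), lst, ← integral_const_mul]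
  calc _ = ∫ x, (1 - s / (r + s) * Real.exp (-(r * x))) ∂ν :=
        integral_congr_ae (hν.mono fun x hx => integral_exp_neg_max_sub_expMeasure' hr hs hx)
    _ = _ := by
        rw [integral_sub (integrable_const _) ((integrable_exp_neg_mul hν hr.le).const_mul _)]
        simp

lemma integral_exp_neg_max_expMeasure_prod (hr : 0 < r) (hν : ∀ᵐ x ∂ν, 0 ≤ x) {s : ℝ}
    (hs : 0 ≤ s) :
    ∫ q, Real.exp (-(s * max q.1 q.2)) ∂((expMeasure r).prod ν)
      = lst ν s - s / (r + s) * lst ν (r + s) := by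
  have := isProbabilityMeasure_expMeasure hr
  rw [← integral_exp_neg_max_prod_expMeasure hr hν hs, ← integral_prod_swap]
  simp only [Prod.fst_swap, Prod.snd_swap, max_comm]

lemma integral_min_prod_expMeasure (hr : 0 < r) (hν : ∀ᵐ x ∂ν, 0 ≤ x) :
    ∫ x, ∫ y, min x y ∂(expMeasure r) ∂ν = (1 - lst ν r) / r := by
  calc _ = ∫ x, (1 - Real.exp (-(r * x))) / r ∂ν :=
        integral_congr_ae (hν.mono fun x hx => integral_min_expMeasure hr hx)
    _ = _ := by
        rw [integral_div, integral_sub (integrable_const _) (integrable_exp_neg_mul hν hr.le)]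
        simp [lst]

end

/-! ### Auxiliary bounds and limits for moments and transforms. -/

lemma integrable_sq_of_integrable_cube {ν : Measure ℝ} (hν : ∀ᵐ x ∂ν, 0 ≤ x)
    (h1 : Integrable (fun x : ℝ => x) ν) (h3 : Integrable (fun x : ℝ => x ^ 3) ν) :
    Integrable (fun x : ℝ => x ^ 2) ν := by
  refine (h1.add h3).mono' (by fun_prop) (hν.mono fun x hx => ?_)
  rw [Real.norm_eq_abs, abs_of_nonneg (sq_nonneg x), Pi.add_apply]
  nlinarith [mul_nonneg hx (sq_nonneg (x - 1)), mul_nonneg hx hx]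

section

variable {ν : Measure ℝ} [IsProbabilityMeasure ν]

lemma tendsto_id_nhdsGT_zero : Tendsto (fun s : ℝ => s) (𝓝[>] 0) (𝓝 0) :=
  tendsto_nhdsWithin_of_tendsto_nhds tendsto_id

lemma tendsto_lst_slope (hν : ∀ᵐ x ∂ν, 0 ≤ x) {k : ℝ} (hk : 0 < k) :
    Tendsto (fun s => (lst ν (k + s) - lst ν k) / s) (𝓝[>] 0)
      (𝓝 (iteratedDeriv 1 (lst ν) k)) := by
  have h := (hasDerivAt_iff_tendsto_slope_zero.mp (hasDerivAt_lst hν hk)).mono_left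
    (nhdsWithin_mono 0 fun s (hs : 0 < s) => hs.ne')
  refine h.congr fun s => ?_
  rw [smul_eq_mul, inv_mul_eq_div]

lemma tendsto_lst_add (hν : ∀ᵐ x ∂ν, 0 ≤ x) {k : ℝ} (hk : 0 < k) :
    Tendsto (fun s => lst ν (k + s)) (𝓝[>] 0) (𝓝 (lst ν k)) := by
  have h := (tendsto_id_nhdsGT_zero.mul (tendsto_lst_slope hν hk)).const_add (lst ν k)
  rw [zero_mul, add_zero] at h
  refine h.congr' ?_
  filter_upwards [self_mem_nhdsWithin] with s hs
  have hs' : s ≠ 0 := (Set.mem_Ioi.mp hs).ne'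
  field_simp
  ring

lemma one_sub_lst_le (hν : ∀ᵐ x ∂ν, 0 ≤ x) (h1 : Integrable (fun x : ℝ => x) ν) {s : ℝ}
    (hs : 0 ≤ s) : 1 - lst ν s ≤ s * ∫ x, x ∂ν := by
  have h : ∫ x, (1 - s * x) ∂ν ≤ lst ν s :=
    integral_mono ((integrable_const _).sub (h1.const_mul s)) (integrable_exp_neg_mul hν hs)
      fun x => Real.one_sub_le_exp_neg (s * x)
  rw [integral_sub (integrable_const _) (h1.const_mul s), integral_const_mul] at h
  simp at h
  linarith

end

/-! ### The queue with Poisson arrivals -/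

section

variable {lam : ℝ} {νH ν : Measure ℝ} [IsProbabilityMeasure νH] [IsProbabilityMeasure ν]

lemma integral_fst_expMeasure_prod (hlam : 0 < lam) :
    ∫ p, p.1 ∂((expMeasure lam).prod νH) = 1 / lam := by
  have := isProbabilityMeasure_expMeasure hlam
  rw [integral_fun_fst (fun x : ℝ => x), integral_id_expMeasure hlam]
  simp

/-- Since 1 - h*(s) ≤ s E[H], the quantity is at least s (1 - ρ). -/
lemma delay_denominator_pos (hlam : 0 < lam) (hH : ∀ᵐ x ∂νH, 0 ≤ x)
    (h1 : Integrable (fun x : ℝ => x) νH) (hlt : lam * ∫ x, x ∂νH < 1) {s : ℝ} (hs : 0 < s) :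
    0 < s - lam + lam * lst νH s := by
  nlinarith [mul_le_mul_of_nonneg_left (one_sub_lst_le hH h1 hs.le) hlam.le,
    mul_lt_mul_of_pos_left hlt hs]

lemma delay_denominator_div_pos (hlam : 0 < lam) (hH : ∀ᵐ x ∂νH, 0 ≤ x)
    (h1 : Integrable (fun x : ℝ => x) νH) (hlt : lam * ∫ x, x ∂νH < 1) {s : ℝ} (hs : 0 < s) :
    0 < 1 - lam * ((1 - lst νH s) / s) := by
  have h : 1 - lam * ((1 - lst νH s) / s) = (s - lam + lam * lst νH s) / s := by
    field_simp
    ring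
  rw [h]
  exact div_pos (delay_denominator_pos hlam hH h1 hlt hs) hs

lemma IsStationaryDelay.lst_mul_eq_of_ne (hlam : 0 < lam)
    (hν : IsStationaryDelay ((expMeasure lam).prod νH) ν) (hν0 : ∀ᵐ x ∂ν, 0 ≤ x)
    {s : ℝ} (hs : 0 < s) (hne : s ≠ lam) :
    lst ν s * (s - lam + lam * lst νH s) = s * lst ν lam * lst νH s := by
  have := isProbabilityMeasure_expMeasure hlam
  have h := hν.lst_eq s
  rw [integral_exp_neg_max_sub_prod_expMeasure hlam hν0 hs.le hne] at h
  have hne' : s - lam ≠ 0 := sub_ne_zero.mpr hne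
  field_simp at h
  linear_combination h

/-- The stationarity equation leaves one constant free, the probability d*(λ) that the delay ends
before the next arrival. Dividing by s and letting s → 0 makes it 1 - ρ. -/
lemma IsStationaryDelay.lst_rate (hlam : 0 < lam) (hH : ∀ᵐ x ∂νH, 0 ≤ x)
    (h1 : Integrable (fun x : ℝ => x) νH)
    (hν : IsStationaryDelay ((expMeasure lam).prod νH) ν) (hν0 : ∀ᵐ x ∂ν, 0 ≤ x) :
    lst ν lam = 1 - lam * ∫ x, x ∂νH := by
  have ha : Tendsto (fun s => lst ν s * (1 - lam * ((1 - lst νH s) / s))) (𝓝[>] 0)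
      (𝓝 (1 * (1 - lam * ∫ x, x ∂νH))) :=
    (tendsto_lst_zero hν0).mul (((tendsto_first_moment hH h1).const_mul lam).const_sub 1)
  have hb : Tendsto (fun s => lst ν lam * lst νH s) (𝓝[>] 0) (𝓝 (lst ν lam * 1)) :=
    (tendsto_lst_zero hH).const_mul _
  rw [one_mul] at ha
  rw [mul_one] at hb
  refine tendsto_nhds_unique (hb.congr' ?_) ha
  filter_upwards [self_mem_nhdsWithin, nhdsWithin_le_nhds (Iio_mem_nhds hlam)] with s hs hsl
  have hs' : 0 < s := hs
  have h := hν.lst_mul_eq_of_ne hlam hν0 hs' (ne_of_lt hsl)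
  field_simp
  linear_combination -h

/-- The Pollaczek-Khinchine formula. -/
lemma IsStationaryDelay.lst_mul_eq (hlam : 0 < lam) (hH : ∀ᵐ x ∂νH, 0 ≤ x)
    (h1 : Integrable (fun x : ℝ => x) νH)
    (hν : IsStationaryDelay ((expMeasure lam).prod νH) ν) (hν0 : ∀ᵐ x ∂ν, 0 ≤ x)
    {s : ℝ} (hs : 0 < s) :
    lst ν s * (s - lam + lam * lst νH s) = (1 - lam * ∫ x, x ∂νH) * s * lst νH s := by
  have hd := hν.lst_rate hlam hH h1 hν0
  rcases eq_or_ne s lam with rfl | hne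
  · rw [hd]
    ring
  · rw [hν.lst_mul_eq_of_ne hlam hν0 hs hne, hd]
    ring

/-- For exponential interarrivals E[min(D, G)] = (1 - d*(λ))/λ, which is ρ/λ = E[H]. -/
lemma IsStationaryDelay.isBalancedDelay_of_expMeasure (hlam : 0 < lam) (hH : ∀ᵐ x ∂νH, 0 ≤ x)
    (h1 : Integrable (fun x : ℝ => x) νH)
    (hν : IsStationaryDelay ((expMeasure lam).prod νH) ν) (hν0 : ∀ᵐ x ∂ν, 0 ≤ x) :
    IsBalancedDelay ((expMeasure lam).prod νH) ν where
  isProbabilityMeasure := inferInstance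
  stationary := hν
  integral_min := by
    have := isProbabilityMeasure_expMeasure hlam
    have e : ∀ x : ℝ, ∫ p, min x p.1 ∂((expMeasure lam).prod νH)
        = ∫ y, min x y ∂(expMeasure lam) := fun x => by
      rw [integral_fun_fst (fun y : ℝ => min x y)]
      simp
    simp_rw [e]
    rw [integral_min_prod_expMeasure hlam hν0, hν.lst_rate hlam hH h1 hν0,
      integral_fun_snd (fun x : ℝ => x)]
    simp
    field_simp

lemma lst_aoiLaw_expMeasure_prod (hlam : 0 < lam)
    (hπ : IsStableInput ((expMeasure lam).prod νH))
    (hν : IsBalancedDelay ((expMeasure lam).prod νH) ν) (hν0 : ∀ᵐ x ∂ν, 0 ≤ x)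
    {s : ℝ} (hs : 0 < s) :
    lst (aoiLaw ((expMeasure lam).prod νH) ν) s
      = lam / s * (1 - lst νH s) * lst ν s
        + lst ν (s + lam) * (lam / (s + lam)) * lst νH s := by
  have := isProbabilityMeasure_expMeasure hlam
  rw [lst_aoiLaw hπ hν hs, integral_fst_expMeasure_prod hlam, integral_exp_neg_peakAge,
    integral_exp_neg_max_prod_expMeasure hlam hν0 hs.le, add_comm lam s]
  have : s + lam ≠ 0 := by positivity
  field_simp
  ring

/-- The Pollaczek-Khinchine formula is used twice, at s and at s + λ, where its denominator becomes
s + λ h*(s + λ). -/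
lemma lst_aoiLaw_expMeasure_prod_eq_sub (hlam : 0 < lam) (hH : ∀ᵐ x ∂νH, 0 ≤ x)
    (h1 : Integrable (fun x : ℝ => x) νH)
    (hπ : IsStableInput ((expMeasure lam).prod νH))
    (hν : IsBalancedDelay ((expMeasure lam).prod νH) ν) (hν0 : ∀ᵐ x ∂ν, 0 ≤ x)
    {s : ℝ} (hs : 0 < s) :
    lst (aoiLaw ((expMeasure lam).prod νH) ν) s = lst ν s
      - (1 - lam * ∫ x, x ∂νH) * s / (s + lam * lst νH (s + lam)) * lst νH s := by
  have hsl : 0 < s + lam := by positivity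
  have hp := lst_pos hH hsl.le
  have hd : s + lam * lst νH (s + lam) ≠ 0 := by positivity
  have ha := hν.stationary.lst_mul_eq hlam hH h1 hν0 hs
  have hb := hν.stationary.lst_mul_eq hlam hH h1 hν0 hsl
  rw [add_sub_cancel_right] at hb
  rw [lst_aoiLaw_expMeasure_prod hlam hπ hν hν0 hs]
  generalize 1 - lam * ∫ x, x ∂νH = c at *
  have hb' : lst ν (s + lam) = c * (s + lam) * lst νH (s + lam) / (s + lam * lst νH (s + lam)) := by
    rw [eq_div_iff hd, hb]
  rw [hb']
  field_simp
  linear_combination (-(s + lam * lst νH (s + lam))) * ha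

/-- The defect of the transform of the delay, divided by the argument. -/
lemma IsStationaryDelay.one_sub_lst_div (hlam : 0 < lam) (hH : ∀ᵐ x ∂νH, 0 ≤ x)
    (h1 : Integrable (fun x : ℝ => x) νH)
    (hν : IsStationaryDelay ((expMeasure lam).prod νH) ν) (hν0 : ∀ᵐ x ∂ν, 0 ≤ x)
    {s : ℝ} (hs : 0 < s) :
    (1 - lst ν s) / s * (1 - lam * ((1 - lst νH s) / s))
      = lam * ((∫ x, x ∂νH - (1 - lst νH s) / s) / s)
        + (1 - lam * ∫ x, x ∂νH) * ((1 - lst νH s) / s) := by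
  have ha := hν.lst_mul_eq hlam hH h1 hν0 hs
  field_simp
  linear_combination -ha

lemma IsStationaryDelay.tendsto_one_sub_lst_div (hlam : 0 < lam) (hH : ∀ᵐ x ∂νH, 0 ≤ x)
    (h1 : Integrable (fun x : ℝ => x) νH) (hlt : lam * ∫ x, x ∂νH < 1)
    (h2 : Integrable (fun x : ℝ => x ^ 2) νH)
    (hν : IsStationaryDelay ((expMeasure lam).prod νH) ν) (hν0 : ∀ᵐ x ∂ν, 0 ≤ x) :
    Tendsto (fun s => (1 - lst ν s) / s) (𝓝[>] 0)
      (𝓝 ((lam * ((∫ x, x ^ 2 ∂νH) / 2) + (1 - lam * ∫ x, x ∂νH) * ∫ x, x ∂νH)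
        / (1 - lam * ∫ x, x ∂νH))) := by
  have hr := tendsto_first_moment hH h1
  have hr2 := tendsto_second_moment hH h1 h2
  refine ((hr2.const_mul lam).add (hr.const_mul _) |>.div ((hr.const_mul lam).const_sub 1)
    (by linarith)).congr' ?_
  filter_upwards [self_mem_nhdsWithin] with s hs
  have hs' : 0 < s := hs
  rw [Pi.div_apply, div_eq_iff (delay_denominator_div_pos hlam hH h1 hlt hs').ne']
  exact (hν.one_sub_lst_div hlam hH h1 hν0 hs').symm

/-- The constant `c` is the limit of the first quotient. Subtracting it from the exact identity and
dividing by s once more leaves only quotients of h* with known limits. -/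
lemma IsStationaryDelay.tendsto_sub_one_sub_lst_div (hlam : 0 < lam) (hH : ∀ᵐ x ∂νH, 0 ≤ x)
    (h1 : Integrable (fun x : ℝ => x) νH) (hlt : lam * ∫ x, x ∂νH < 1)
    (h2 : Integrable (fun x : ℝ => x ^ 2) νH) (h3 : Integrable (fun x : ℝ => x ^ 3) νH)
    (hν : IsStationaryDelay ((expMeasure lam).prod νH) ν) (hν0 : ∀ᵐ x ∂ν, 0 ≤ x) {c : ℝ}
    (hc : c = (lam * ((∫ x, x ^ 2 ∂νH) / 2) + (1 - lam * ∫ x, x ∂νH) * ∫ x, x ∂νH)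
        / (1 - lam * ∫ x, x ∂νH)) :
    Tendsto (fun s => (c - (1 - lst ν s) / s) / s) (𝓝[>] 0)
      (𝓝 ((lam * ((∫ x, x ^ 3 ∂νH) / 6)
          + (∫ x, x ^ 2 ∂νH) / 2 * (lam * c + (1 - lam * ∫ x, x ∂νH)))
        / (1 - lam * ∫ x, x ∂νH))) := by
  have hr := tendsto_first_moment hH h1
  have hr2 := tendsto_second_moment hH h1 h2
  have hr3 := tendsto_third_moment hH h1 h2 h3
  refine ((hr3.const_mul lam).add (hr2.mul_const _) |>.div ((hr.const_mul lam).const_sub 1)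
    (by linarith)).congr' ?_
  filter_upwards [self_mem_nhdsWithin] with s hs
  have hs' : 0 < s := hs
  have hne := (delay_denominator_div_pos hlam hH h1 hlt hs').ne'
  rw [Pi.div_apply, div_eq_iff hne]
  have hd := hν.one_sub_lst_div hlam hH h1 hν0 hs'
  rw [eq_div_iff (by linarith)] at hc
  generalize (1 - lst ν s) / s = D at hd ⊢
  generalize (1 - lst νH s) / s = r at hd ⊢
  field_simp
  field_simp at hd hc
  linear_combination 2 * hd - s * hc

/-- The contribution of the idle periods to the transform of the age of information. -/
noncomputable def idleTransform (lam : ℝ) (νH : Measure ℝ) (s : ℝ) : ℝ :=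
  (1 - lam * ∫ x, x ∂νH) / (s + lam * lst νH (lam + s)) * lst νH s

lemma tendsto_idleTransform (hlam : 0 < lam) (hH : ∀ᵐ x ∂νH, 0 ≤ x) :
    Tendsto (idleTransform lam νH) (𝓝[>] 0)
      (𝓝 ((1 - lam * ∫ x, x ∂νH) / (lam * lst νH lam))) := by
  have hp := lst_pos hH hlam.le
  have h := ((tendsto_const_nhds (x := 1 - lam * ∫ x, x ∂νH)).div
    (tendsto_id_nhdsGT_zero.add ((tendsto_lst_add hH hlam).const_mul lam))
    (by rw [zero_add]; positivity)).mul (tendsto_lst_zero hH)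
  rw [zero_add, mul_one] at h
  exact h

lemma tendsto_sub_idleTransform_div (hlam : 0 < lam) (hH : ∀ᵐ x ∂νH, 0 ≤ x)
    (h1 : Integrable (fun x : ℝ => x) νH) :
    Tendsto (fun s => ((1 - lam * ∫ x, x ∂νH) / (lam * lst νH lam) - idleTransform lam νH s) / s)
      (𝓝[>] 0)
      (𝓝 ((1 - lam * ∫ x, x ∂νH) * (1 + lam * iteratedDeriv 1 (lst νH) lam
        + lam * lst νH lam * ∫ x, x ∂νH) / (lam * lst νH lam * (lam * lst νH lam)))) := by
  have hp := lst_pos hH hlam.le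
  have hq := (((tendsto_lst_slope hH hlam).const_mul lam).const_add 1).add
    ((tendsto_first_moment hH h1).const_mul (lam * lst νH lam))
  have hd := (tendsto_id_nhdsGT_zero.add ((tendsto_lst_add hH hlam).const_mul lam)).const_mul
    (lam * lst νH lam)
  rw [zero_add] at hd
  refine ((hq.const_mul _).div hd (by positivity)).congr' ?_
  filter_upwards [self_mem_nhdsWithin] with s hs
  have hs' : 0 < s := hs
  have hp' := lst_pos hH (add_pos hlam hs').le
  have hne : s + lam * lst νH (lam + s) ≠ 0 := by positivity
  rw [Pi.div_apply, idleTransform]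
  field_simp
  ring

lemma one_sub_lst_aoiLaw_div (hlam : 0 < lam) (hH : ∀ᵐ x ∂νH, 0 ≤ x)
    (h1 : Integrable (fun x : ℝ => x) νH)
    (hπ : IsStableInput ((expMeasure lam).prod νH))
    (hν : IsBalancedDelay ((expMeasure lam).prod νH) ν) (hν0 : ∀ᵐ x ∂ν, 0 ≤ x)
    {s : ℝ} (hs : 0 < s) :
    (1 - lst (aoiLaw ((expMeasure lam).prod νH) ν) s) / s
      = (1 - lst ν s) / s + idleTransform lam νH s := by
  have hp := lst_pos hH (add_pos hlam hs).le
  have hne : s + lam * lst νH (lam + s) ≠ 0 := by positivity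
  rw [lst_aoiLaw_expMeasure_prod_eq_sub hlam hH h1 hπ hν hν0 hs, idleTransform, add_comm s lam]
  field_simp
  ring

lemma mean_aoiLaw_expMeasure_prod (hlam : 0 < lam) (hH : ∀ᵐ x ∂νH, 0 ≤ x)
    (h1 : Integrable (fun x : ℝ => x) νH) (hlt : lam * ∫ x, x ∂νH < 1)
    (h2 : Integrable (fun x : ℝ => x ^ 2) νH)
    (hπ : IsStableInput ((expMeasure lam).prod νH))
    (hν : IsBalancedDelay ((expMeasure lam).prod νH) ν) (hν0 : ∀ᵐ x ∂ν, 0 ≤ x) :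
    Integrable (fun x : ℝ => x) (aoiLaw ((expMeasure lam).prod νH) ν) ∧
      ∫ x, x ∂(aoiLaw ((expMeasure lam).prod νH) ν)
        = (lam * ((∫ x, x ^ 2 ∂νH) / 2) + (1 - lam * ∫ x, x ∂νH) * ∫ x, x ∂νH)
            / (1 - lam * ∫ x, x ∂νH)
          + (1 - lam * ∫ x, x ∂νH) / (lam * lst νH lam) := by
  have := isProbabilityMeasure_aoiLaw hπ hν
  refine first_moment_of_tendsto (ae_nonneg_aoiLaw hπ hν)
    (((hν.stationary.tendsto_one_sub_lst_div hlam hH h1 hlt h2 hν0).add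
      (tendsto_idleTransform hlam hH)).congr' ?_)
  filter_upwards [self_mem_nhdsWithin] with s hs
  exact (one_sub_lst_aoiLaw_div hlam hH h1 hπ hν hν0 hs).symm

lemma second_moment_aoiLaw_expMeasure_prod (hlam : 0 < lam) (hH : ∀ᵐ x ∂νH, 0 ≤ x)
    (h1 : Integrable (fun x : ℝ => x) νH) (hlt : lam * ∫ x, x ∂νH < 1)
    (h2 : Integrable (fun x : ℝ => x ^ 2) νH) (h3 : Integrable (fun x : ℝ => x ^ 3) νH)
    (hπ : IsStableInput ((expMeasure lam).prod νH))
    (hν : IsBalancedDelay ((expMeasure lam).prod νH) ν) (hν0 : ∀ᵐ x ∂ν, 0 ≤ x) {c : ℝ}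
    (hc : c = (lam * ((∫ x, x ^ 2 ∂νH) / 2) + (1 - lam * ∫ x, x ∂νH) * ∫ x, x ∂νH)
        / (1 - lam * ∫ x, x ∂νH)) :
    Integrable (fun x : ℝ => x ^ 2) (aoiLaw ((expMeasure lam).prod νH) ν) ∧
      ∫ x, x ^ 2 ∂(aoiLaw ((expMeasure lam).prod νH) ν)
        = 2 * ((lam * ((∫ x, x ^ 3 ∂νH) / 6)
            + (∫ x, x ^ 2 ∂νH) / 2 * (lam * c + (1 - lam * ∫ x, x ∂νH)))
              / (1 - lam * ∫ x, x ∂νH)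
          + (1 - lam * ∫ x, x ∂νH) * (1 + lam * iteratedDeriv 1 (lst νH) lam
            + lam * lst νH lam * ∫ x, x ∂νH) / (lam * lst νH lam * (lam * lst νH lam))) := by
  have := isProbabilityMeasure_aoiLaw hπ hν
  obtain ⟨hi, hm⟩ := mean_aoiLaw_expMeasure_prod hlam hH h1 hlt h2 hπ hν hν0
  refine second_moment_of_tendsto (ae_nonneg_aoiLaw hπ hν) hi
    (((hν.stationary.tendsto_sub_one_sub_lst_div hlam hH h1 hlt h2 h3 hν0 hc).add
      (tendsto_sub_idleTransform_div hlam hH h1)).congr' ?_)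
  filter_upwards [self_mem_nhdsWithin] with s hs
  rw [hm, one_sub_lst_aoiLaw_div hlam hH h1 hπ hν hν0 hs, ← hc]
  ring

end

/-! ### The queue with exponential service times -/

section

variable {ν : Measure ℝ} [IsProbabilityMeasure ν]

/-- The transform of the residual time is strictly decreasing. -/
lemma one_sub_lst_div_strictAnti (hν : ∀ᵐ x ∂ν, 0 ≤ x) (hm : 0 < ∫ x, x ∂ν) {s t : ℝ}
    (hs : 0 < s) (hst : s < t) : (1 - lst ν t) / t < (1 - lst ν s) / s := by
  have ht : 0 < t := hs.trans hst
  -- The exponent at `s` is a convex combination of 0 and the exponent at `t`, so convexity of exp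
  -- compares the two transforms.
  have e : ∀ x : ℝ, Real.exp (-(s * x)) = Real.exp ((1 - s / t) • 0 + (s / t) • (-(t * x))) :=
    fun x => by
      congr 1
      simp only [smul_eq_mul]
      field_simp
      ring
  have hp : 0 < s / t := div_pos hs ht
  have hp' : 0 < 1 - s / t := by
    rw [sub_pos, div_lt_one ht]
    exact hst
  have hle : ∀ x : ℝ, Real.exp (-(s * x)) ≤ (1 - s / t) + s / t * Real.exp (-(t * x)) := fun x => by
    have h := convexOn_exp.2 (Set.mem_univ (0 : ℝ)) (Set.mem_univ (-(t * x))) hp'.le hp.le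
      (by ring)
    rw [← e x] at h
    simpa using h
  have hlt : ∀ x : ℝ, 0 < x →
      Real.exp (-(s * x)) < (1 - s / t) + s / t * Real.exp (-(t * x)) := fun x hx => by
    have h := strictConvexOn_exp.2 (Set.mem_univ (0 : ℝ)) (Set.mem_univ (-(t * x)))
      (by have := mul_pos ht hx; linarith) hp' hp (by ring)
    rw [← e x] at h
    simpa using h
  have hi := integrable_exp_neg_mul hν hs.le
  have hi' : Integrable (fun x => (1 - s / t) + s / t * Real.exp (-(t * x))) ν :=
    (integrable_const _).add ((integrable_exp_neg_mul hν ht.le).const_mul _)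
  have hval : ∫ x, ((1 - s / t) + s / t * Real.exp (-(t * x)) - Real.exp (-(s * x))) ∂ν
      = (1 - s / t) + s / t * lst ν t - lst ν s := by
    rw [integral_sub hi' hi, integral_add (integrable_const _)
      ((integrable_exp_neg_mul hν ht.le).const_mul _), integral_const_mul]
    simp [lst]
  have hge : 0 ≤ᵐ[ν] fun x => (1 - s / t) + s / t * Real.exp (-(t * x)) - Real.exp (-(s * x)) :=
    ae_of_all _ fun x => sub_nonneg.mpr (hle x)
  have hpos : 0 < (1 - s / t) + s / t * lst ν t - lst ν s := by
    rw [← hval]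
    -- Equality would make the law degenerate at 0, against the positive mean.
    refine lt_of_le_of_ne (integral_nonneg_of_ae hge) fun h0 => hm.ne' ?_
    have hz := (integral_eq_zero_iff_of_nonneg_ae hge (hi'.sub hi)).mp h0.symm
    rw [integral_eq_zero_of_ae]
    filter_upwards [hz, hν] with x hx hx0
    by_contra hne
    have := hlt x (lt_of_le_of_ne hx0 (Ne.symm hne))
    simp only [Pi.zero_apply] at hx
    linarith
  rw [div_lt_div_iff₀ ht hs]
  have h := mul_pos ht hpos
  have h' : t * ((1 - s / t) + s / t * lst ν t - lst ν s)
      = t - s + s * lst ν t - t * lst ν s := by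
    field_simp
  rw [h'] at h
  linarith

/-- In terms of k = μ - μγ the equation is (1 - g*(k))/k = 1/μ. Near 0 the left side is close to the
mean, above 1/μ, and at μ it is below 1/μ because g*(μ) > 0; an intermediate value does the rest. -/
lemma exists_lst_eq_one_sub (hν : ∀ᵐ x ∂ν, 0 ≤ x) (h1 : Integrable (fun x : ℝ => x) ν) {mu : ℝ}
    (hmu : 0 < mu) (hlt : 1 / mu < ∫ x, x ∂ν) :
    ∃ k, 0 < k ∧ k < mu ∧ lst ν k = 1 - k / mu := by
  obtain ⟨s, hs1, hs0', hsmu⟩ := (((tendsto_first_moment hν h1).eventually_const_lt hlt).and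
    (Ioo_mem_nhdsGT hmu)).exists
  have hpm := lst_pos hν hmu.le
  have hcont : ContinuousOn (fun s => (1 - lst ν s) / s) (Set.Icc s mu) := fun t ht => by
    have ht0 : 0 < t := hs0'.trans_le ht.1
    have h := (hasDerivAt_lst hν ht0).continuousAt
    exact ((continuousAt_const.sub h).div continuousAt_id ht0.ne').continuousWithinAt
  obtain ⟨k, hk, hkeq⟩ := intermediate_value_Icc' (le_of_lt hsmu) hcont
    (show 1 / mu ∈ Set.Icc _ _ from
      ⟨div_le_div_of_nonneg_right (by linarith) hmu.le, hs1.le⟩)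
  have hk0 : 0 < k := hs0'.trans_le hk.1
  simp only at hkeq
  have hlst : lst ν k = 1 - k / mu := by
    field_simp at hkeq ⊢
    linarith
  refine ⟨k, hk0, lt_of_le_of_ne hk.2 ?_, hlst⟩
  rintro rfl
  rw [div_self hk0.ne'] at hlst
  linarith

lemma eq_of_lst_eq_one_sub (hν : ∀ᵐ x ∂ν, 0 ≤ x) (hm : 0 < ∫ x, x ∂ν) {mu k l : ℝ}
    (hk0 : 0 < k) (hl0 : 0 < l) (hk : lst ν k = 1 - k / mu) (hl : lst ν l = 1 - l / mu) :
    k = l := by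
  have e : ∀ t, 0 < t → lst ν t = 1 - t / mu → (1 - lst ν t) / t = 1 / mu := fun t ht h => by
    rw [h, sub_sub_cancel, div_right_comm, div_self ht.ne']
  by_contra hne
  rcases lt_or_gt_of_ne hne with h | h
  · have := one_sub_lst_div_strictAnti hν hm hk0 h
    rw [e k hk0 hk, e l hl0 hl] at this
    exact lt_irrefl _ this
  · have := one_sub_lst_div_strictAnti hν hm hl0 h
    rw [e k hk0 hk, e l hl0 hl] at this
    exact lt_irrefl _ this

end

section

variable {mu k : ℝ} {νG : Measure ℝ} [IsProbabilityMeasure νG]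

/-- A step maps the exponential law to one with transform (1 - s/(k + s) g*(k)) μ/(s + μ), and the
equation for k reduces this to k/(k + s). Uniqueness of transforms finishes. -/
lemma isStationaryDelay_expMeasure (hmu : 0 < mu) (hk : 0 < k) (hG : ∀ᵐ x ∂νG, 0 ≤ x)
    (hfix : lst νG k = 1 - k / mu) :
    IsStationaryDelay (νG.prod (expMeasure mu)) (expMeasure k) := by
  have := isProbabilityMeasure_expMeasure hmu
  have := isProbabilityMeasure_expMeasure hk
  have hmeas : Measurable fun q : ℝ × (ℝ × ℝ) => lindleyStep q.1 q.2 := measurable_lindleyStep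
  have := Measure.isProbabilityMeasure_map (μ := (expMeasure k).prod (νG.prod (expMeasure mu)))
    hmeas.aemeasurable
  refine ext_of_lst_eq ?_ (ae_nonneg_expMeasure k) fun s hs => ?_
  · rw [ae_map_iff hmeas.aemeasurable measurableSet_Ici]
    have h : ∀ᵐ q ∂((expMeasure k).prod (νG.prod (expMeasure mu))), 0 ≤ q.2.2 :=
      Measure.quasiMeasurePreserving_snd.ae
        (Measure.quasiMeasurePreserving_snd.ae (ae_nonneg_expMeasure mu))
    filter_upwards [h] with q hq using lindleyStep_nonneg _ hq
  · rw [lst_map_lindleyStep, integral_exp_neg_max_sub_expMeasure_prod hk hG hs.le,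
      lst_expMeasure hmu hs.le, lst_expMeasure hk hs.le, hfix]
    field_simp
    ring

/-- Here the delay is the exponential variable, so E[min(D, G)] = (1 - g*(k))/k, and the equation
for k makes this 1/μ. -/
lemma isBalancedDelay_expMeasure (hmu : 0 < mu) (hk : 0 < k) (hG : ∀ᵐ x ∂νG, 0 ≤ x)
    (h1 : Integrable (fun x : ℝ => x) νG) (hfix : lst νG k = 1 - k / mu) :
    IsBalancedDelay (νG.prod (expMeasure mu)) (expMeasure k) where
  isProbabilityMeasure := isProbabilityMeasure_expMeasure hk
  stationary := isStationaryDelay_expMeasure hmu hk hG hfix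
  integral_min := by
    have := isProbabilityMeasure_expMeasure hmu
    have := isProbabilityMeasure_expMeasure hk
    have e : ∀ x : ℝ, ∫ p, min x p.1 ∂(νG.prod (expMeasure mu)) = ∫ y, min x y ∂νG := fun x => by
      rw [integral_fun_fst (fun y : ℝ => min x y)]
      simp
    have hi : Integrable (fun q : ℝ × ℝ => min q.1 q.2) ((expMeasure k).prod νG) := by
      refine Integrable.mono' (g := fun q => q.2) (h1.comp_snd _) (by fun_prop) ?_
      filter_upwards [Measure.quasiMeasurePreserving_fst.ae (ae_nonneg_expMeasure k),
        Measure.quasiMeasurePreserving_snd.ae hG] with q hq1 hq2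
      rw [Real.norm_eq_abs, abs_of_nonneg (le_min hq1 hq2)]
      exact min_le_right _ _
    simp_rw [e]
    rw [integral_integral_swap hi, integral_fun_snd (fun x : ℝ => x), integral_id_expMeasure hmu]
    simp_rw [min_comm]
    rw [integral_min_prod_expMeasure hk hG, hfix]
    simp
    field_simp

lemma lst_aoiLaw_prod_expMeasure (hmu : 0 < mu) (hk : 0 < k) (hG : ∀ᵐ x ∂νG, 0 ≤ x)
    (hπ : IsStableInput (νG.prod (expMeasure mu)))
    (hν : IsBalancedDelay (νG.prod (expMeasure mu)) (expMeasure k)) {s : ℝ} (hs : 0 < s) :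
    lst (aoiLaw (νG.prod (expMeasure mu)) (expMeasure k)) s
      = (1 / (mu * ∫ x, x ∂νG) * (k / (s + k)) + residualLST νG s - residualLST νG (s + k))
        * (mu / (s + mu)) := by
  have := isProbabilityMeasure_expMeasure hmu
  have := isProbabilityMeasure_expMeasure hk
  have hm := mean_interarrival_pos hπ
  rw [integral_fun_fst (fun x : ℝ => x), probReal_univ, one_smul] at hm
  rw [lst_aoiLaw hπ hν hs, integral_exp_neg_peakAge, integral_exp_neg_max_expMeasure_prod hk hG hs.le,
    lst_expMeasure hk hs.le, lst_expMeasure hmu hs.le, integral_fun_fst (fun x : ℝ => x),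
    probReal_univ, one_smul, add_comm k s, residualLST, residualLST]
  generalize ∫ x, x ∂νG = m at *
  field_simp
  ring

/-- The equation for k removes the terms singular in s, leaving a difference quotient of g* at k and
a nested one at 0. -/
lemma one_sub_lst_aoiLaw_prod_expMeasure_div (hmu : 0 < mu) (hk : 0 < k) (hG : ∀ᵐ x ∂νG, 0 ≤ x)
    (hfix : lst νG k = 1 - k / mu) (hπ : IsStableInput (νG.prod (expMeasure mu)))
    (hν : IsBalancedDelay (νG.prod (expMeasure mu)) (expMeasure k)) {s : ℝ} (hs : 0 < s) :
    (1 - lst (aoiLaw (νG.prod (expMeasure mu)) (expMeasure k)) s) / s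
      = 1 / (s + mu) + mu / (s + mu) * (((∫ x, x ∂νG - (1 - lst νG s) / s) / s
        - (lst νG (k + s) - lst νG k) / s / (s + k)) / ∫ x, x ∂νG) := by
  have := isProbabilityMeasure_expMeasure hmu
  have hm := mean_interarrival_pos hπ
  rw [integral_fun_fst (fun x : ℝ => x), probReal_univ, one_smul] at hm
  rw [lst_aoiLaw_prod_expMeasure hmu hk hG hπ hν hs, residualLST, residualLST, add_comm k s, hfix]
  generalize ∫ x, x ∂νG = m at *
  field_simp
  ring

lemma tendsto_one_div_add {a : ℝ} (ha : 0 < a) :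
    Tendsto (fun s : ℝ => 1 / (s + a)) (𝓝[>] 0) (𝓝 (1 / a)) := by
  have h := (tendsto_const_nhds (x := (1 : ℝ))).div (tendsto_id_nhdsGT_zero.add_const a)
    (by rw [zero_add]; exact ha.ne')
  rwa [zero_add] at h

lemma mean_aoiLaw_prod_expMeasure (hmu : 0 < mu) (hk : 0 < k) (hG : ∀ᵐ x ∂νG, 0 ≤ x)
    (h1 : Integrable (fun x : ℝ => x) νG) (h2 : Integrable (fun x : ℝ => x ^ 2) νG)
    (hfix : lst νG k = 1 - k / mu) (hπ : IsStableInput (νG.prod (expMeasure mu)))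
    (hν : IsBalancedDelay (νG.prod (expMeasure mu)) (expMeasure k)) :
    Integrable (fun x : ℝ => x) (aoiLaw (νG.prod (expMeasure mu)) (expMeasure k)) ∧
      ∫ x, x ∂(aoiLaw (νG.prod (expMeasure mu)) (expMeasure k))
        = 1 / mu + ((∫ x, x ^ 2 ∂νG) / 2 - iteratedDeriv 1 (lst νG) k / k) / ∫ x, x ∂νG := by
  have := isProbabilityMeasure_expMeasure hmu
  have := isProbabilityMeasure_aoiLaw hπ hν
  refine first_moment_of_tendsto (ae_nonneg_aoiLaw hπ hν) ?_
  have h := (tendsto_one_div_add hmu).add (((tendsto_one_div_add hmu).const_mul mu).mul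
    (((tendsto_second_moment hG h1 h2).sub
      ((tendsto_lst_slope hG hk).mul (tendsto_one_div_add hk))).div_const (∫ x, x ∂νG)))
  rw [mul_one_div_cancel hmu.ne', one_mul, mul_one_div] at h
  refine h.congr' ?_
  filter_upwards [self_mem_nhdsWithin] with s hs
  rw [one_sub_lst_aoiLaw_prod_expMeasure_div hmu hk hG hfix hπ hν hs, mul_one_div, mul_one_div]

lemma second_moment_aoiLaw_prod_expMeasure (hmu : 0 < mu) (hk : 0 < k) (hG : ∀ᵐ x ∂νG, 0 ≤ x)
    (h1 : Integrable (fun x : ℝ => x) νG) (h2 : Integrable (fun x : ℝ => x ^ 2) νG)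
    (h3 : Integrable (fun x : ℝ => x ^ 3) νG)
    (hfix : lst νG k = 1 - k / mu) (hπ : IsStableInput (νG.prod (expMeasure mu)))
    (hν : IsBalancedDelay (νG.prod (expMeasure mu)) (expMeasure k)) {c : ℝ}
    (hc : c = (∫ x, x ^ 2 ∂νG) / 2 - iteratedDeriv 1 (lst νG) k / k) :
    Integrable (fun x : ℝ => x ^ 2) (aoiLaw (νG.prod (expMeasure mu)) (expMeasure k)) ∧
      ∫ x, x ^ 2 ∂(aoiLaw (νG.prod (expMeasure mu)) (expMeasure k))
        = 2 * (1 / mu * (1 / mu) + (c * (1 / mu) + ((∫ x, x ^ 3 ∂νG) / 6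
          + (iteratedDeriv 2 (lst νG) k / 2 * k - iteratedDeriv 1 (lst νG) k) * (1 / k) * (1 / k)))
            / ∫ x, x ∂νG) := by
  have := isProbabilityMeasure_expMeasure hmu
  have := isProbabilityMeasure_aoiLaw hπ hν
  have hm := mean_interarrival_pos hπ
  rw [integral_fun_fst (fun x : ℝ => x), probReal_univ, one_smul] at hm
  obtain ⟨hi, hmean⟩ := mean_aoiLaw_prod_expMeasure hmu hk hG h1 h2 hfix hπ hν
  refine second_moment_of_tendsto (ae_nonneg_aoiLaw hπ hν) hi ?_
  have h := ((tendsto_one_div_add hmu).const_mul (1 / mu)).add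
    ((((tendsto_one_div_add hmu).const_mul c).add
      (((tendsto_one_div_add hmu).const_mul mu).mul ((tendsto_third_moment hG h1 h2 h3).add
        (((((tendsto_lst_second_order hG hk).mul_const k).sub_const
          (iteratedDeriv 1 (lst νG) k)).mul_const (1 / k)).mul
            (tendsto_one_div_add hk))))).div_const (∫ x, x ∂νG))
  rw [mul_one_div_cancel hmu.ne', one_mul] at h
  refine h.congr' ?_
  filter_upwards [self_mem_nhdsWithin] with s hs
  have hs' : 0 < s := hs
  rw [one_sub_lst_aoiLaw_prod_expMeasure_div hmu hk hG hfix hπ hν hs', hmean, hc]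
  generalize ∫ x, x ∂νG = m at *
  generalize (1 - lst νG s) / s = r
  generalize (lst νG (k + s) - lst νG k) / s = q
  field_simp
  ring

end

/-! ### The two queues. -/

theorem theorem4 {Ω : Type*} [MeasurableSpace Ω] (P : Measure Ω) [IsProbabilityMeasure P]
    (νG νH : Measure ℝ) (Q : FCFSQueue P νG νH)
    (hG_int : Integrable (fun x : ℝ => x) νG) (hG_pos : 0 < ∫ x, x ∂νG)
    (hH_int : Integrable (fun x : ℝ => x) νH) (hH_pos : 0 < ∫ x, x ∂νH)
    (lam ρ : ℝ) (hlam : lam = 1 / ∫ x, x ∂νG) (hρ : ρ = lam * ∫ x, x ∂νH) (hρ_lt : ρ < 1) :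
    -- (i) the M/GI/1 queue
    (νG = expMeasure lam →
      ∃ νD νA : Measure ℝ, Q.IsDelayLaw νD ∧ Q.IsAoILaw νA ∧
        (∀ s : ℝ, 0 < s →
          lst νD s = (1 - ρ) * s / (s - lam + lam * lst νH s) * lst νH s ∧
          lst νA s = ρ * lst νD s * residualLST νH s
            + lst νD (s + lam) * (lam / (s + lam)) * lst νH s ∧
          lst νA s = lst νD s
            - (1 - ρ) * s / (s + lam * lst νH (s + lam)) * lst νH s) ∧
        (Integrable (fun x : ℝ => x ^ 2) νH →
          Integrable (fun x : ℝ => x) νA ∧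
          ∫ x, x ∂νA = lam * (∫ x, x ^ 2 ∂νH) / (2 * (1 - ρ)) + (∫ x, x ∂νH)
            + (1 - ρ) / (ρ * lst νH lam) * ∫ x, x ∂νH) ∧
        (Integrable (fun x : ℝ => x ^ 3) νH →
          Integrable (fun x : ℝ => x ^ 2) νA ∧
          ∫ x, x ^ 2 ∂νA =
            2 * (1 - ρ) * (1 + ρ * lst νH lam - lam * (-iteratedDeriv 1 (lst νH) lam))
                * (∫ x, x ∂νH) ^ 2 / (ρ * lst νH lam) ^ 2
              + lam * (∫ x, x ^ 3 ∂νH) / (3 * (1 - ρ))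
              + (lam * ∫ x, x ^ 2 ∂νH) ^ 2 / (2 * (1 - ρ) ^ 2)
              + (∫ x, x ^ 2 ∂νH) / (1 - ρ))) ∧
    -- (ii) the GI/M/1 queue
    (∀ mu : ℝ, 0 < mu → νH = expMeasure mu →
      ∃ γ : ℝ, (0 < γ ∧ γ < 1 ∧ γ = lst νG (mu - mu * γ)) ∧
        (∀ x : ℝ, 0 < x → x < 1 → x = lst νG (mu - mu * x) → x = γ) ∧
        ∃ νD νA : Measure ℝ, Q.IsDelayLaw νD ∧ Q.IsAoILaw νA ∧
          (∀ s : ℝ, 0 < s →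
            lst νD s = (mu - mu * γ) / (s + mu - mu * γ) ∧
            lst νA s = (ρ * lst νD s + residualLST νG s - residualLST νG (s + mu - mu * γ))
              * (mu / (s + mu))) ∧
          (Integrable (fun x : ℝ => x ^ 2) νG →
            Integrable (fun x : ℝ => x) νA ∧
            ∫ x, x ∂νA = (∫ x, x ^ 2 ∂νG) / (2 * ∫ x, x ∂νG) + (∫ x, x ∂νH)
              + ρ / (1 - γ) * (-iteratedDeriv 1 (lst νG) (mu - mu * γ))) ∧
          (Integrable (fun x : ℝ => x ^ 3) νG →
            Integrable (fun x : ℝ => x ^ 2) νA ∧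
            ∫ x, x ^ 2 ∂νA = (∫ x, x ^ 3 ∂νG) / (3 * ∫ x, x ∂νG)
              + ρ * (∫ x, x ^ 2 ∂νG) + 2 * (∫ x, x ∂νH) ^ 2
              + ρ / (1 - γ) * (iteratedDeriv 2 (lst νG) (mu - mu * γ)
                + 2 * (1 + 1 / (1 - γ)) * (-iteratedDeriv 1 (lst νG) (mu - mu * γ))
                  * ∫ x, x ∂νH))) := by
  have hGp := Q.isProbabilityMeasure_interarrival
  have hHp := Q.isProbabilityMeasure_service
  have hG0 := Q.ae_nonneg_interarrival
  have hH0 := Q.ae_nonneg_service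
  have hlam0 : 0 < lam := by rw [hlam]; positivity
  have hlt : ∫ x, x ∂νH < ∫ x, x ∂νG := by
    rw [hρ, hlam, one_div_mul_eq_div, div_lt_one hG_pos] at hρ_lt
    exact hρ_lt
  have hπ := Q.isStableInput hG_int hH_int hlt
  refine ⟨fun hGe => ?_, fun mu hmu hHe => ?_⟩
  · subst hGe
    obtain ⟨ν, hνp, hνs⟩ := Q.isIIDInput.exists_isStationaryDelay hπ
    have hν0 := hνs.ae_nonneg hπ
    have hν := hνs.isBalancedDelay_of_expMeasure hlam0 hH0 hH_int hν0
    have hload : lam * ∫ x, x ∂νH < 1 := hρ ▸ hρ_lt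
    have hhp := lst_pos hH0 hlam0.le
    have hρ' : 0 < 1 - lam * ∫ x, x ∂νH := by linarith
    refine ⟨ν, _, Q.isDelayLaw hπ hν, Q.isAoILaw hπ hν, fun s hs => ⟨?_, ?_, ?_⟩,
      fun h2 => ?_, fun h3 => ?_⟩
    · have hd := delay_denominator_pos hlam0 hH0 hH_int hload hs
      rw [div_mul_eq_mul_div, eq_div_iff hd.ne', hρ]
      exact hνs.lst_mul_eq hlam0 hH0 hH_int hν0 hs
    · rw [lst_aoiLaw_expMeasure_prod hlam0 hπ hν hν0 hs, hρ, residualLST]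
      field_simp
    · rw [lst_aoiLaw_expMeasure_prod_eq_sub hlam0 hH0 hH_int hπ hν hν0 hs, hρ]
    · obtain ⟨hi, hm⟩ := mean_aoiLaw_expMeasure_prod hlam0 hH0 hH_int hload h2 hπ hν hν0
      refine ⟨hi, ?_⟩
      rw [hm, hρ]
      field_simp
    · have h2 := integrable_sq_of_integrable_cube hH0 hH_int h3
      obtain ⟨hi, hm⟩ := second_moment_aoiLaw_expMeasure_prod hlam0 hH0 hH_int hload h2 h3 hπ hν
        hν0 rfl
      refine ⟨hi, ?_⟩
      rw [hm, hρ]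
      field_simp
      ring
  · subst hHe
    have hHm : ∫ x, x ∂(expMeasure mu) = 1 / mu := integral_id_expMeasure hmu
    -- The rate `k` is found first, and γ = 1 - k/μ is defined from it; ρ < 1 is the condition that
    -- 1/μ lies below the mean interarrival time.
    obtain ⟨k, hk, hkmu, hfix⟩ := exists_lst_eq_one_sub hG0 hG_int hmu (hHm ▸ hlt)
    have hkγ : mu - mu * (1 - k / mu) = k := by
      field_simp
      ring
    have hγ : 0 < 1 - k / mu := by
      rw [sub_pos, div_lt_one hmu]
      exact hkmu
    have hν := isBalancedDelay_expMeasure hmu hk hG0 hG_int hfix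
    refine ⟨1 - k / mu, ⟨hγ, by have := div_pos hk hmu; linarith, ?_⟩, fun x hx0 hx1 hx => ?_,
      expMeasure k, _, Q.isDelayLaw hπ hν, Q.isAoILaw hπ hν, fun s hs => ⟨?_, ?_⟩,
      fun h2 => ?_, fun h3 => ?_⟩
    · rw [hkγ, hfix]
    -- A competing root x corresponds to the rate μ - μx, which must equal `k`; positivity of this
    -- rate excludes the trivial root x = 1.
    · have hl : 0 < mu - mu * x := by nlinarith
      have h := eq_of_lst_eq_one_sub hG0 hG_pos hl hk (mu := mu)
        (by rw [← hx]; field_simp; ring) hfix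
      rw [← h]
      field_simp
      ring
    · rw [add_sub_assoc, hkγ, lst_expMeasure hk hs.le, add_comm]
    · rw [lst_aoiLaw_prod_expMeasure hmu hk hG0 hπ hν hs, add_sub_assoc s, hkγ,
        lst_expMeasure hk hs.le, hρ, hHm, hlam, add_comm k s]
      field_simp
    · obtain ⟨hi, hm⟩ := mean_aoiLaw_prod_expMeasure hmu hk hG0 hG_int h2 hfix hπ hν
      refine ⟨hi, ?_⟩
      rw [hm, hkγ, hρ, hHm, hlam, sub_sub_cancel]
      field_simp
      ring
    · have h2 := integrable_sq_of_integrable_cube hG0 hG_int h3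
      obtain ⟨hi, hm⟩ := second_moment_aoiLaw_prod_expMeasure hmu hk hG0 hG_int h2 h3 hfix hπ hν rfl
      refine ⟨hi, ?_⟩
      rw [hm, hkγ, hρ, hHm, hlam, sub_sub_cancel]
      field_simp
      ring
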